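/- Let $m,n\ge 1$ be coprime integers and $c=m/n$. Let $\mathfrak h\subset\mathbb C^n$ be the span of the differences $y_i-y_j$ of the coordinate vectors $y_1,\dots,y_n$ (the reflection representation of $S_n$), let $\mathfrak h^*$ be the span of the differences $x_i-x_j$, and let $\langle y_i,x_j\rangle=\delta_{ij}$. The rational Cherednik algebra $\mathbf H_c$ of type $\mathfrak{sl}_n$ is the associative $\mathbb C$-algebra generated by $\mathfrak h^*$, $\mathfrak h$ and $S_n$ with the relations $[x,x']=0$, $[y,y']=0$, $sxs^{-1}=s(x)$, $sys^{-1}=s(y)$ and $$[y,x]=\langle y,x\rangle-c\sum_{i<j}\langle y,x_i-x_j\rangle\langle y_i-y_j,x\rangle\,s_{ij}.$$ It acts on the subring $R=\mathbb C[\mathfrak h^*]\subset\mathbb C[x_1,\dots,x_n]$ generated by the $x_i-x_j$: elements of $\mathfrak h^*$ by multiplication, $S_n$ by permuting the variables, and $y=\sum_i v_iy_i\in\mathfrak h$ by $\sum_i v_iD_i$ with the Dunkl operators $D_i p=\frac{\partial p}{\partial x_i}+c\sum_{j\ne i}\frac{s_{ij}p-p}{x_i-x_j}$. Let $L_{m/n}=R/I$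 be the simple quotient of this module, $I$ being the sum of all proper $\mathbf H_c$-submodules. Put $\tilde x_i=x_i-\frac1n\sum_j x_j$, $\tilde y_i=y_i-\frac1n\sum_j y_j$, and let $L_{m/n}(k)$ be the eigenspace with eigenvalue $k$ of $\mathbf h=\frac12\sum_i(\tilde x_i\tilde y_i+\tilde y_i\tilde x_i)\in\mathbf H_c$. Let $\mathfrak a\subset R$ be the ideal generated by symmetric polynomials without constant term (and write $\mathfrak a^j$ also for its image in $L_{m/n}$), and put, for $i\in\mathbb Z$, $$\mathcal F^iL_{m/n}=\sum_{j\ge 0}\Big(\mathfrak a^j\cap\bigoplus_{k<2j-i}L_{m/n}(k)\Big).$$ Let $\Phi$ be the algebra endomorphism of $\mathbf H_c$ with $x_i-x_j\mapsto y_i-y_j$, $y_i-y_j\mapsto-(x_i-x_j)$, $s\mapsto s$, and let $(f,g)=[\Phi(f)\cdot g]|_{x=0}$ be the Dunkl form on $R$, whose kernel is $I$. The algebraic filtration is the increasing filtration $\mathcal F^{alg}_iL_{m/n}=(\mathcal F^iL_{m/n})^\perp$, the orthogonal complement with respect to the induced form on $L_{m/n}$. It satisfies $\mathfrak h^*\mathcal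 F^{alg}_i\subset\mathcal F^{alg}_{i+1}$ and $S_n\mathcal F^{alg}_i=\mathcal F^{alg}_i$, so $S_n$ and $\mathfrak h^*$ act on $\operatorname{gr}L_{m/n}=\bigoplus_i\mathcal F^{alg}_i/\mathcal F^{alg}_{i-1}$, with degrees $0$ and $1$. Let $$H_{m/n}^{\mathcal F^{alg}}=\operatorname{Hom}_{S_n}(\Lambda^*\mathfrak h,\operatorname{gr}L_{m/n})$$ and let $d_1$ be the endomorphism of $H_{m/n}^{\mathcal F^{alg}}$ given by contraction with the map $\mathfrak h\to\mathfrak h^*$, $y_i-y_j\mapsto x_i-x_j$, that is $$(d_1\varphi)(v)=\sum_{i=1}^n\tilde x_i\cdot\varphi(\tilde y_i\wedge v),\qquad v\in\Lambda^*\mathfrak h .$$ Then $d_1^2=0$. The element $1\in L_{m/n}$, which is $S_n$-invariant, lies in $\mathcal F^{alg}_{d}$ but not in $\mathcal F^{alg}_{d-1}$, where $d=\frac{(m-1)(n-1)}2$, and its class in $\operatorname{Hom}_{S_n}(\Lambda^0\mathfrak h,\mathcal F^{alg}_d/\mathcal F^{alg}_{d-1})$ is annihilated by $d_1$. The homology $\ker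 d_1/\operatorname{im}d_1$ is one-dimensional over $\mathbb C$ and is spanned by the class of $1$. -/

import Mathlib

namespace Cherednik

open MvPolynomial

noncomputable section

/-! ### Divided differences and Dunkl operators on `ℂ[x₁, …, xₙ]` -/

theorem X_sub_X_dvd {n : ℕ} (i j : Fin n) (p : MvPolynomial (Fin n) ℂ) :
    (X i - X j : MvPolynomial (Fin n) ℂ) ∣ rename (Equiv.swap i j) p - p := by
  induction p using MvPolynomial.induction_on with
  | C a => simp
  | add p q hp hq =>
    rw [map_add, show rename (Equiv.swap i j) p + rename (Equiv.swap i j) q - (p + q)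
      = (rename (Equiv.swap i j) p - p) + (rename (Equiv.swap i j) q - q) by ring]
    exact dvd_add hp hq
  | mul_X p k hp =>
    have hk : (X i - X j : MvPolynomial (Fin n) ℂ) ∣ X (Equiv.swap i j k) - X k := by
      rcases eq_or_ne k i with rfl | hi
      · rw [Equiv.swap_apply_left]; exact ⟨-1, by ring⟩
      · rcases eq_or_ne k j with rfl | hj
        · rw [Equiv.swap_apply_right]
        · rw [Equiv.swap_apply_of_ne_of_ne hi hj]; simp
    rw [map_mul, rename_X, show rename (Equiv.swap i j) p * X (Equiv.swap i j k) - p * X k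
      = (rename (Equiv.swap i j) p - p) * X (Equiv.swap i j k)
        + p * (X (Equiv.swap i j k) - X k) by ring]
    exact dvd_add (hp.mul_right _) (hk.mul_left _)

theorem X_sub_X_ne_zero {n : ℕ} {i j : Fin n} (h : i ≠ j) :
    (X i - X j : MvPolynomial (Fin n) ℂ) ≠ 0 :=
  sub_ne_zero.2 fun e => h (X_injective e)

/-- The divided difference `p ↦ (s_{ij} p - p) / (x_i - x_j)` for `i ≠ j` (and `0` if `i = j`). -/
def divDiff {n : ℕ} (i j : Fin n) : MvPolynomial (Fin n) ℂ →ₗ[ℂ] MvPolynomial (Fin n) ℂ :=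
  if h : i = j then 0 else
  { toFun := fun p => Classical.choose (X_sub_X_dvd i j p)
    map_add' := fun p q => by
      apply mul_left_cancel₀ (X_sub_X_ne_zero h)
      rw [mul_add, ← Classical.choose_spec (X_sub_X_dvd i j (p + q)),
        ← Classical.choose_spec (X_sub_X_dvd i j p), ← Classical.choose_spec (X_sub_X_dvd i j q),
        map_add]
      ring
    map_smul' := fun a p => by
      apply mul_left_cancel₀ (X_sub_X_ne_zero h)
      rw [RingHom.id_apply, mul_smul_comm, ← Classical.choose_spec (X_sub_X_dvd i j (a • p)),
        ← Classical.choose_spec (X_sub_X_dvd i j p), map_smul, smul_sub] }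

theorem divDiff_spec {n : ℕ} {i j : Fin n} (h : i ≠ j) (p : MvPolynomial (Fin n) ℂ) :
    (X i - X j) * divDiff i j p = rename (Equiv.swap i j) p - p := by
  rw [divDiff, dif_neg h]
  exact (Classical.choose_spec (X_sub_X_dvd i j p)).symm

theorem divDiff_mul {n : ℕ} {i j : Fin n} (h : i ≠ j) (p q : MvPolynomial (Fin n) ℂ) :
    divDiff i j (p * q) = divDiff i j p * q + rename (Equiv.swap i j) p * divDiff i j q := by
  apply mul_left_cancel₀ (X_sub_X_ne_zero h)
  have h1 := divDiff_spec h p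
  have h2 := divDiff_spec h q
  rw [divDiff_spec h, map_mul]
  linear_combination (-q) * h1 - (rename (Equiv.swap i j) p) * h2

theorem divDiff_C {n : ℕ} {i j : Fin n} (h : i ≠ j) (a : ℂ) :
    divDiff i j (C a : MvPolynomial (Fin n) ℂ) = 0 := by
  apply mul_left_cancel₀ (X_sub_X_ne_zero h)
  rw [divDiff_spec h]; simp

theorem rename_divDiff {n : ℕ} {i j : Fin n} (h : i ≠ j) (σ : Equiv.Perm (Fin n))
    (p : MvPolynomial (Fin n) ℂ) :
    rename σ (divDiff i j p) = divDiff (σ i) (σ j) (rename σ p) := by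
  have h' : σ i ≠ σ j := fun e => h (σ.injective e)
  apply mul_left_cancel₀ (X_sub_X_ne_zero h')
  have h1 := congrArg (rename σ) (divDiff_spec h p)
  rw [map_mul, map_sub, map_sub, rename_X, rename_X, rename_rename] at h1
  rw [h1, divDiff_spec h', rename_rename]
  congr 3
  funext k
  simp [Equiv.swap_apply_def, Function.comp]
  split_ifs <;> rfl

/-- The Dunkl operator `D_i p = ∂p/∂x_i + c ∑_{j ≠ i} (s_{ij} p - p) / (x_i - x_j)`. -/
def dunkl {n : ℕ} (c : ℂ) (i : Fin n) : MvPolynomial (Fin n) ℂ →ₗ[ℂ] MvPolynomial (Fin n) ℂ :=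
  (pderiv i : Derivation ℂ (MvPolynomial (Fin n) ℂ) (MvPolynomial (Fin n) ℂ)).toLinearMap
    + c • ∑ j ∈ Finset.univ.erase i, divDiff i j

theorem dunkl_apply {n : ℕ} (c : ℂ) (i : Fin n) (p : MvPolynomial (Fin n) ℂ) :
    dunkl c i p = pderiv i p + c • ∑ j ∈ Finset.univ.erase i, divDiff i j p := by
  simp [dunkl]

theorem rename_dunkl {n : ℕ} (c : ℂ) (i : Fin n) (σ : Equiv.Perm (Fin n))
    (p : MvPolynomial (Fin n) ℂ) :
    rename σ (dunkl c i p) = dunkl c (σ i) (rename σ p) := by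
  rw [dunkl_apply, dunkl_apply, map_add, map_smul, map_sum, pderiv_rename σ.injective]
  congr 2
  refine Finset.sum_bij (fun j _ => σ j) (by simp) (by simp) ?_ ?_
  · intro b hb
    exact ⟨σ.symm b, by simpa [Equiv.symm_apply_eq] using hb, by simp⟩
  · intro j hj
    exact rename_divDiff (Finset.ne_of_mem_erase hj).symm σ p

/-- The Dunkl operators obey the Leibniz rule when one factor is symmetric. -/
theorem dunkl_mul_of_symm {n : ℕ} (c : ℂ) (i : Fin n) (q p : MvPolynomial (Fin n) ℂ)
    (hq : ∀ σ : Equiv.Perm (Fin n), rename σ q = q) :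
    dunkl c i (q * p) = dunkl c i q * p + q * dunkl c i p := by
  have h0 : ∀ j ∈ Finset.univ.erase i, divDiff i j q = 0 := by
    intro j hj
    have hij := (Finset.ne_of_mem_erase hj).symm
    apply mul_left_cancel₀ (X_sub_X_ne_zero hij)
    rw [divDiff_spec hij, hq]; simp
  have h1 : ∀ j ∈ Finset.univ.erase i, divDiff i j (q * p) = q * divDiff i j p := by
    intro j hj
    rw [divDiff_mul (Finset.ne_of_mem_erase hj).symm, h0 j hj, hq]; simp
  simp only [dunkl_apply]
  rw [Finset.sum_congr rfl h1, Finset.sum_eq_zero h0, pderiv_mul, ← Finset.mul_sum, smul_zero,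
    add_zero, mul_add, mul_smul_comm]
  ring

/-- Commutation of a Dunkl operator with multiplication by a linear form `∑ w_k x_k`. -/
theorem dunkl_lin_mul {n : ℕ} (c : ℂ) (i : Fin n) (w : Fin n → ℂ) (p : MvPolynomial (Fin n) ℂ) :
    dunkl c i ((∑ k, w k • X k) * p) = (∑ k, w k • X k) * dunkl c i p + w i • p
      - c • ∑ j, (w i - w j) • rename (Equiv.swap i j) p := by
  have hdd : ∀ j ∈ Finset.univ.erase i, divDiff i j ((∑ k, w k • X k) * p)
      = (∑ k, w k • X k) * divDiff i j p - (w i - w j) • rename (Equiv.swap i j) p := by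
    intro j hj
    have hij := (Finset.ne_of_mem_erase hj).symm
    have hlin : divDiff i j (∑ k, w k • (X k : MvPolynomial (Fin n) ℂ)) = -C (w i - w j) := by
      apply mul_left_cancel₀ (X_sub_X_ne_zero hij)
      rw [divDiff_spec hij, map_sum, ← Finset.sum_sub_distrib,
        ← Finset.sum_subset (Finset.subset_univ {i, j})]
      · rw [Finset.sum_pair hij]
        simp [smul_eq_C_mul]
        ring
      · intro k _ hk
        simp only [Finset.mem_insert, Finset.mem_singleton, not_or] at hk
        rw [map_smul, rename_X, Equiv.swap_apply_of_ne_of_ne hk.1 hk.2, sub_self]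
    rw [mul_comm, divDiff_mul hij, hlin, smul_eq_C_mul]
    ring
  have hpd : pderiv i (∑ k, w k • (X k : MvPolynomial (Fin n) ℂ)) = C (w i) := by
    rw [map_sum, Finset.sum_eq_single i]
    · simp [smul_eq_C_mul]
    · intro k _ hk
      simp [pderiv_X_of_ne hk]
    · simp
  rw [dunkl_apply, dunkl_apply, Finset.sum_congr rfl hdd, pderiv_mul, hpd,
    Finset.sum_sub_distrib, ← Finset.mul_sum]
  have hs : ∑ j, (w i - w j) • rename (Equiv.swap i j) p
      = ∑ j ∈ Finset.univ.erase i, (w i - w j) • rename (Equiv.swap i j) p := by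
    rw [← Finset.sum_erase_add _ _ (Finset.mem_univ i)]; simp
  rw [hs]
  simp only [smul_eq_C_mul]
  ring

theorem dunkl_X_mul {n : ℕ} (c : ℂ) (i k : Fin n) (p : MvPolynomial (Fin n) ℂ) :
    dunkl c i (X k * p) = X k * dunkl c i p + (if i = k then p else 0)
      - c • ∑ j, ((if i = k then 1 else 0) - (if j = k then 1 else 0) : ℂ) •
          rename (Equiv.swap i j) p := by
  have h := dunkl_lin_mul c i (fun l => if l = k then 1 else 0) p
  simpa using h

theorem dunkl_dunkl_X_mul {n : ℕ} (c : ℂ) (i j k : Fin n) (p : MvPolynomial (Fin n) ℂ) :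
    dunkl c i (dunkl c j (X k * p))
      = X k * dunkl c i (dunkl c j p) + (if i = k then dunkl c j p else 0)
        + (if j = k then dunkl c i p else 0)
        - c • ((if i = k then ∑ l, rename (Equiv.swap i l) (dunkl c j p) else 0)
          - rename (Equiv.swap i k) (dunkl c j p)
          + (if j = k then ∑ l, rename (Equiv.swap j l) (dunkl c (Equiv.swap j l i) p) else 0)
          - rename (Equiv.swap j k) (dunkl c (Equiv.swap j k i) p)) := by
  have hsum : ∀ (a : Fin n) (f : Fin n → MvPolynomial (Fin n) ℂ),
      ∑ l, ((if a = k then 1 else 0) - (if l = k then 1 else 0) : ℂ) • f l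
        = (if a = k then ∑ l, f l else 0) - f k := by
    intro a f
    simp only [sub_smul, Finset.sum_sub_distrib, ite_smul, one_smul, zero_smul,
      Finset.sum_ite_eq', Finset.mem_univ, if_true]
    split_ifs <;> simp
  have hr : ∀ l, dunkl c i (rename (Equiv.swap j l) p)
      = rename (Equiv.swap j l) (dunkl c (Equiv.swap j l i) p) := by
    intro l
    rw [rename_dunkl, Equiv.swap_apply_self]
  rw [dunkl_X_mul, map_sub, map_add, map_smul, hsum, map_sub, dunkl_X_mul, hsum]
  have h2 : dunkl c i (if j = k then ∑ l, rename (Equiv.swap j l) p else 0)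
      = if j = k then ∑ l, rename (Equiv.swap j l) (dunkl c (Equiv.swap j l i) p) else 0 := by
    split_ifs
    · rw [map_sum]; exact Finset.sum_congr rfl fun l _ => hr l
    · simp
  have h3 : dunkl c i (if j = k then p else 0) = if j = k then dunkl c i p else 0 := by
    split_ifs <;> simp
  rw [h2, h3, hr]
  generalize rename (Equiv.swap j k) (dunkl c (Equiv.swap j k i) p) = a
  generalize (if j = k then
    ∑ l, rename (Equiv.swap j l) (dunkl c (Equiv.swap j l i) p) else 0) = b
  generalize rename (Equiv.swap i k) (dunkl c j p) = d
  generalize (if i = k then ∑ l, rename (Equiv.swap i l) (dunkl c j p) else 0) = e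
  rw [add_sub_assoc (e - d), smul_add, smul_sub c b a, smul_sub]
  generalize c • a = a
  generalize c • b = b
  generalize c • d = d
  generalize c • e = e
  abel

theorem dunkl_comm_aux {n : ℕ} (c : ℂ) (i j : Fin n) (hij : i ≠ j) (p : MvPolynomial (Fin n) ℂ)
    (hp : dunkl c i (dunkl c j p) = dunkl c j (dunkl c i p)) :
    dunkl c i (dunkl c j (X i * p)) = dunkl c j (dunkl c i (X i * p)) := by
  have hswap : ∑ l, rename (Equiv.swap i l) (dunkl c (Equiv.swap i l j) p)
      = ∑ l, rename (Equiv.swap i l) (dunkl c j p)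
        - rename (Equiv.swap i j) (dunkl c j p) + rename (Equiv.swap i j) (dunkl c i p) := by
    have h1 := Finset.sum_eq_single (s := Finset.univ) (f := fun l =>
      rename (Equiv.swap i l) (dunkl c (Equiv.swap i l j) p)
        - rename (Equiv.swap i l) (dunkl c j p)) j
      (fun l _ hl => by rw [Equiv.swap_apply_of_ne_of_ne hij.symm hl.symm, sub_self])
      (fun h => absurd (Finset.mem_univ j) h)
    rw [Finset.sum_sub_distrib, Equiv.swap_apply_right] at h1
    rw [eq_add_of_sub_eq h1]
    abel
  rw [dunkl_dunkl_X_mul, dunkl_dunkl_X_mul, hp, if_pos rfl, if_neg hij.symm, if_pos rfl,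
    if_neg hij.symm, hswap, Equiv.swap_comm j i,
    Equiv.swap_apply_left, Equiv.swap_self, Equiv.refl_apply]
  generalize rename (Equiv.swap i j) (dunkl c j p) = a
  generalize rename (Equiv.swap i j) (dunkl c i p) = b
  generalize rename (Equiv.refl (Fin n)) (dunkl c j p) = d
  generalize ∑ l, rename (Equiv.swap i l) (dunkl c j p) = e
  rw [add_zero, add_zero, if_neg hij.symm, if_pos rfl]
  congr 2 <;> abel

/-- The Dunkl operators commute. -/
theorem dunkl_comm {n : ℕ} (c : ℂ) (i j : Fin n) (p : MvPolynomial (Fin n) ℂ) :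
    dunkl c i (dunkl c j p) = dunkl c j (dunkl c i p) := by
  rcases eq_or_ne i j with rfl | hij
  · rfl
  induction p using MvPolynomial.induction_on with
  | C a =>
    have h : ∀ l : Fin n, dunkl c l (C a : MvPolynomial (Fin n) ℂ) = 0 := by
      intro l
      rw [dunkl_apply, Finset.sum_eq_zero, pderiv_C, smul_zero, add_zero]
      intro k hk
      exact divDiff_C (Finset.ne_of_mem_erase hk).symm a
    rw [h, h, map_zero, map_zero]
  | add p q hp hq => simp only [map_add, hp, hq]
  | mul_X p k hp =>
    rw [mul_comm p]
    by_cases hi : i = k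
    · subst hi
      exact dunkl_comm_aux c i j hij p hp
    · by_cases hj : j = k
      · subst hj
        exact (dunkl_comm_aux c j i hij.symm p hp.symm).symm
      · rw [dunkl_dunkl_X_mul, dunkl_dunkl_X_mul, hp, if_neg hi, if_neg hj, if_neg hi, if_neg hj,
          if_neg hi, if_neg hj, Equiv.swap_apply_of_ne_of_ne hij hi,
          Equiv.swap_apply_of_ne_of_ne hij.symm hj]
        generalize rename (Equiv.swap i k) (dunkl c j p) = a
        generalize rename (Equiv.swap j k) (dunkl c i p) = b
        congr 2
        abel

/-! ### The reflection representation -/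

/-- The reflection representation of `S_n`, in coordinates: vectors of `ℂⁿ` with zero sum.
It models both `𝔥` (`v ↦ ∑ v_i y_i`) and `𝔥*` (`w ↦ ∑ w_i x_i`); the pairing of `𝔥` and `𝔥*`
is `⟨v, w⟩ = ∑ v_i w_i`. -/
def Refl (n : ℕ) : Submodule ℂ (Fin n → ℂ) where
  carrier := {v | ∑ i, v i = 0}
  add_mem' := fun {v w} hv hw => by
    simp only [Set.mem_ofPred_eq] at *
    simp [Finset.sum_add_distrib, hv, hw]
  zero_mem' := by simp
  smul_mem' := fun a v hv => by
    simp only [Set.mem_ofPred_eq] at *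
    simp [← Finset.mul_sum, hv]

/-- The action of `S_n` on the reflection representation, `σ e_i = e_{σ i}`. -/
def permRefl {n : ℕ} (σ : Equiv.Perm (Fin n)) : Refl n →ₗ[ℂ] Refl n where
  toFun v := ⟨fun i => v.1 (σ.symm i), by
    have h : ∑ i, v.1 i = 0 := v.2
    change ∑ i, v.1 (σ.symm i) = 0
    rw [← h]
    exact Equiv.sum_comp σ.symm v.1⟩
  map_add' _ _ := rfl
  map_smul' _ _ := rfl

/-- The projection `e_i - (e_1 + ⋯ + e_n) / n` of the `i`-th coordinate vector. -/
def eBar {n : ℕ} (i : Fin n) : Refl n :=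
  ⟨fun j => (if j = i then 1 else 0) - 1 / (n : ℂ), by
    have : (n : ℂ) ≠ 0 := Nat.cast_ne_zero.2 (Nat.pos_iff_ne_zero.1 (Fin.pos i))
    change ∑ j, ((if j = i then 1 else 0) - 1 / (n : ℂ)) = 0
    simp [this]⟩

theorem permRefl_eBar {n : ℕ} (σ : Equiv.Perm (Fin n)) (i : Fin n) :
    permRefl σ (eBar i) = eBar (σ i) := by
  ext j
  simp [permRefl, eBar, Equiv.symm_apply_eq]

theorem sum_smul_eBar {n : ℕ} (w : Refl n) : ∑ i, w.1 i • eBar i = w := by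
  ext j
  have h : ∑ i, w.1 i = 0 := w.2
  simp only [eBar, AddSubmonoidClass.coe_finsetSum, SetLike.mk_smul_mk, Finset.sum_apply,
    Pi.smul_apply, smul_eq_mul, mul_sub, Finset.sum_sub_distrib, ← Finset.sum_mul, h]
  simp

/-! ### The rational Cherednik algebra -/

/-- Generators of the rational Cherednik algebra: `x ∈ 𝔥*`, `y ∈ 𝔥`, `s ∈ S_n`. -/
inductive Gen (n : ℕ) : Type
  | x (w : Refl n)
  | y (v : Refl n)
  | s (σ : Equiv.Perm (Fin n))

/-- The defining relations of the rational Cherednik algebra of type `𝔰𝔩_n` with parameter `c`.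
The transpositions are the `s_{ij}` with `i < j`, whose root and coroot are `x_i - x_j` and
`y_i - y_j`. -/
inductive Rel (n : ℕ) (c : ℂ) : FreeAlgebra ℂ (Gen n) → FreeAlgebra ℂ (Gen n) → Prop
  | x_add (w w' : Refl n) : Rel n c (FreeAlgebra.ι ℂ (Gen.x (w + w')))
      (FreeAlgebra.ι ℂ (Gen.x w) + FreeAlgebra.ι ℂ (Gen.x w'))
  | x_smul (a : ℂ) (w : Refl n) : Rel n c (FreeAlgebra.ι ℂ (Gen.x (a • w)))
      (a • FreeAlgebra.ι ℂ (Gen.x w))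
  | y_add (v v' : Refl n) : Rel n c (FreeAlgebra.ι ℂ (Gen.y (v + v')))
      (FreeAlgebra.ι ℂ (Gen.y v) + FreeAlgebra.ι ℂ (Gen.y v'))
  | y_smul (a : ℂ) (v : Refl n) : Rel n c (FreeAlgebra.ι ℂ (Gen.y (a • v)))
      (a • FreeAlgebra.ι ℂ (Gen.y v))
  | s_one : Rel n c (FreeAlgebra.ι ℂ (Gen.s 1)) 1
  | s_mul (σ τ : Equiv.Perm (Fin n)) : Rel n c (FreeAlgebra.ι ℂ (Gen.s (σ * τ)))
      (FreeAlgebra.ι ℂ (Gen.s σ) * FreeAlgebra.ι ℂ (Gen.s τ))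
  | x_comm (w w' : Refl n) : Rel n c
      (FreeAlgebra.ι ℂ (Gen.x w) * FreeAlgebra.ι ℂ (Gen.x w'))
      (FreeAlgebra.ι ℂ (Gen.x w') * FreeAlgebra.ι ℂ (Gen.x w))
  | y_comm (v v' : Refl n) : Rel n c
      (FreeAlgebra.ι ℂ (Gen.y v) * FreeAlgebra.ι ℂ (Gen.y v'))
      (FreeAlgebra.ι ℂ (Gen.y v') * FreeAlgebra.ι ℂ (Gen.y v))
  | s_x (σ : Equiv.Perm (Fin n)) (w : Refl n) : Rel n c
      (FreeAlgebra.ι ℂ (Gen.s σ) * FreeAlgebra.ι ℂ (Gen.x w))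
      (FreeAlgebra.ι ℂ (Gen.x (permRefl σ w)) * FreeAlgebra.ι ℂ (Gen.s σ))
  | s_y (σ : Equiv.Perm (Fin n)) (v : Refl n) : Rel n c
      (FreeAlgebra.ι ℂ (Gen.s σ) * FreeAlgebra.ι ℂ (Gen.y v))
      (FreeAlgebra.ι ℂ (Gen.y (permRefl σ v)) * FreeAlgebra.ι ℂ (Gen.s σ))
  | y_x (v w : Refl n) : Rel n c
      (FreeAlgebra.ι ℂ (Gen.y v) * FreeAlgebra.ι ℂ (Gen.x w)
        - FreeAlgebra.ι ℂ (Gen.x w) * FreeAlgebra.ι ℂ (Gen.y v))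
      (algebraMap ℂ _ (∑ i, v.1 i * w.1 i)
        - c • ∑ p : Fin n × Fin n with p.1 < p.2,
            ((v.1 p.1 - v.1 p.2) * (w.1 p.1 - w.1 p.2)) •
              FreeAlgebra.ι ℂ (Gen.s (Equiv.swap p.1 p.2)))

/-- The rational Cherednik algebra `H_c` of type `𝔰𝔩_n`. -/
def CherednikAlg (n : ℕ) (c : ℂ) : Type := RingQuot (Rel n c)

instance (n : ℕ) (c : ℂ) : Ring (CherednikAlg n c) := inferInstanceAs (Ring (RingQuot (Rel n c)))

instance (n : ℕ) (c : ℂ) : Algebra ℂ (CherednikAlg n c) :=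
  inferInstanceAs (Algebra ℂ (RingQuot (Rel n c)))

/-- The quotient map from the free algebra onto `H_c`. -/
def mkAlg (n : ℕ) (c : ℂ) : FreeAlgebra ℂ (Gen n) →ₐ[ℂ] CherednikAlg n c :=
  RingQuot.mkAlgHom ℂ (Rel n c)

theorem mkAlg_rel {n : ℕ} {c : ℂ} {a b : FreeAlgebra ℂ (Gen n)} (h : Rel n c a b) :
    mkAlg n c a = mkAlg n c b :=
  RingQuot.mkAlgHom_rel ℂ h

/-- The generator `x ∈ 𝔥*` of `H_c`. -/
def xGen {n : ℕ} (c : ℂ) (w : Refl n) : CherednikAlg n c :=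
  mkAlg n c (FreeAlgebra.ι ℂ (Gen.x w))

/-- The generator `y ∈ 𝔥` of `H_c`. -/
def yGen {n : ℕ} (c : ℂ) (v : Refl n) : CherednikAlg n c :=
  mkAlg n c (FreeAlgebra.ι ℂ (Gen.y v))

/-- The element `σ ∈ S_n` of `H_c`. -/
def sGen {n : ℕ} (c : ℂ) (σ : Equiv.Perm (Fin n)) : CherednikAlg n c :=
  mkAlg n c (FreeAlgebra.ι ℂ (Gen.s σ))

section relations

variable {n : ℕ} (c : ℂ)

theorem xGen_add (w w' : Refl n) : xGen c (w + w') = xGen c w + xGen c w' := by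
  simpa [xGen] using mkAlg_rel (Rel.x_add (c := c) w w')

theorem xGen_smul (a : ℂ) (w : Refl n) : xGen c (a • w) = a • xGen c w := by
  simpa [xGen] using mkAlg_rel (Rel.x_smul (c := c) a w)

theorem yGen_add (w w' : Refl n) : yGen c (w + w') = yGen c w + yGen c w' := by
  simpa [yGen] using mkAlg_rel (Rel.y_add (c := c) w w')

theorem yGen_smul (a : ℂ) (w : Refl n) : yGen c (a • w) = a • yGen c w := by
  simpa [yGen] using mkAlg_rel (Rel.y_smul (c := c) a w)

theorem sGen_one : sGen c (1 : Equiv.Perm (Fin n)) = 1 := by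
  simpa [sGen] using mkAlg_rel (Rel.s_one (n := n) (c := c))

theorem sGen_mul (σ τ : Equiv.Perm (Fin n)) : sGen c (σ * τ) = sGen c σ * sGen c τ := by
  simpa [sGen] using mkAlg_rel (Rel.s_mul (c := c) σ τ)

theorem xGen_comm (w w' : Refl n) : xGen c w * xGen c w' = xGen c w' * xGen c w := by
  simpa [xGen] using mkAlg_rel (Rel.x_comm (c := c) w w')

theorem yGen_comm (w w' : Refl n) : yGen c w * yGen c w' = yGen c w' * yGen c w := by
  simpa [yGen] using mkAlg_rel (Rel.y_comm (c := c) w w')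

theorem sGen_xGen (σ : Equiv.Perm (Fin n)) (w : Refl n) :
    sGen c σ * xGen c w = xGen c (permRefl σ w) * sGen c σ := by
  simpa [xGen, sGen] using mkAlg_rel (Rel.s_x (c := c) σ w)

theorem sGen_yGen (σ : Equiv.Perm (Fin n)) (w : Refl n) :
    sGen c σ * yGen c w = yGen c (permRefl σ w) * sGen c σ := by
  simpa [yGen, sGen] using mkAlg_rel (Rel.s_y (c := c) σ w)

theorem yGen_xGen (v w : Refl n) :
    yGen c v * xGen c w - xGen c w * yGen c v = algebraMap ℂ _ (∑ i, v.1 i * w.1 i)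
      - c • ∑ p : Fin n × Fin n with p.1 < p.2,
          ((v.1 p.1 - v.1 p.2) * (w.1 p.1 - w.1 p.2)) • sGen c (Equiv.swap p.1 p.2) := by
  have h := mkAlg_rel (Rel.y_x (c := c) v w)
  rw [map_sub, map_sub, map_mul, map_mul, map_smul, map_sum (mkAlg n c), AlgHom.commutes] at h
  simp only [map_smul] at h
  exact h

end relations

/-- The algebra homomorphism out of `H_c` given by images of the generators that satisfy the
defining relations. -/
def liftAlg {n : ℕ} (c : ℂ) {A : Type*} [Ring A] [Algebra ℂ A] (f : Gen n → A)
    (hf : ∀ ⦃a b : FreeAlgebra ℂ (Gen n)⦄, Rel n c a b →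
      FreeAlgebra.lift ℂ f a = FreeAlgebra.lift ℂ f b) : CherednikAlg n c →ₐ[ℂ] A :=
  RingQuot.liftAlgHom ℂ ⟨FreeAlgebra.lift ℂ f, hf⟩

theorem liftAlg_mk {n : ℕ} (c : ℂ) {A : Type*} [Ring A] [Algebra ℂ A] (f : Gen n → A) (hf)
    (g : Gen n) : liftAlg c f hf (mkAlg n c (FreeAlgebra.ι ℂ g)) = f g := by
  exact RingQuot.liftAlgHom_mkAlgHom_apply ℂ _ _ _ |>.trans (FreeAlgebra.lift_ι_apply f g)

/-- The Fourier transform `Φ : H_c → H_c`, `x_i ↦ y_i`, `y_i ↦ -x_i`, `σ ↦ σ`. -/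
def fourier (n : ℕ) (c : ℂ) : CherednikAlg n c →ₐ[ℂ] CherednikAlg n c :=
  liftAlg c (fun g => match g with
      | Gen.x w => yGen c w
      | Gen.y v => -xGen c v
      | Gen.s σ => sGen c σ) (by
    intro a b h
    induction h with
    | x_add w w' => simp [yGen_add]
    | x_smul a w => simp [yGen_smul]
    | y_add w w' => simp [xGen_add, add_comm]
    | y_smul a w => simp [xGen_smul]
    | s_one => simp [sGen_one]
    | s_mul σ τ => simp [sGen_mul]
    | x_comm w w' => simpa using yGen_comm c w w'
    | y_comm w w' => simpa using xGen_comm c w w'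
    | s_x σ w => simpa using sGen_yGen c σ w
    | s_y σ w => simpa using sGen_xGen c σ w
    | y_x v w =>
      have h := yGen_xGen c w v
      rw [map_sub, map_sub, map_mul, map_mul, map_smul, map_sum (FreeAlgebra.lift ℂ _),
        AlgHom.commutes]
      simp only [map_smul, FreeAlgebra.lift_ι_apply]
      rw [show -xGen c v * yGen c w - yGen c w * -xGen c v
        = yGen c w * xGen c v - xGen c v * yGen c w by noncomm_ring, h]
      simp only [mul_comm])

theorem fourier_xGen {n : ℕ} (c : ℂ) (w : Refl n) : fourier n c (xGen c w) = yGen c w :=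
  liftAlg_mk c _ _ (Gen.x w)

theorem fourier_sGen {n : ℕ} (c : ℂ) (σ : Equiv.Perm (Fin n)) :
    fourier n c (sGen c σ) = sGen c σ :=
  liftAlg_mk c _ _ (Gen.s σ)

/-! ### The polynomial representation -/

/-- The subring `R = ℂ[𝔥*]` of `ℂ[x₁, …, xₙ]` generated by the differences `x_i - x_j`. -/
def diffRing (n : ℕ) : Subalgebra ℂ (MvPolynomial (Fin n) ℂ) :=
  Algebra.adjoin ℂ {p | ∃ i j, p = X i - X j}

theorem X_sub_X_mem {n : ℕ} (i j : Fin n) :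
    (X i - X j : MvPolynomial (Fin n) ℂ) ∈ diffRing n :=
  Algebra.subset_adjoin ⟨i, j, rfl⟩

theorem rename_mem {n : ℕ} (σ : Equiv.Perm (Fin n)) {p : MvPolynomial (Fin n) ℂ}
    (hp : p ∈ diffRing n) : rename σ p ∈ diffRing n := by
  induction hp using Algebra.adjoin_induction with
  | mem p hp =>
    obtain ⟨i, j, rfl⟩ := hp
    rw [map_sub, rename_X, rename_X]
    exact X_sub_X_mem _ _
  | algebraMap a => rw [AlgHom.commutes]; exact Subalgebra.algebraMap_mem _ a
  | add p q _ _ hp hq => rw [map_add]; exact add_mem hp hq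
  | mul p q _ _ hp hq => rw [map_mul]; exact mul_mem hp hq

theorem lin_mem {n : ℕ} (w : Refl n) :
    ∑ k, w.1 k • (X k : MvPolynomial (Fin n) ℂ) ∈ diffRing n := by
  rcases isEmpty_or_nonempty (Fin n) with h | ⟨⟨o⟩⟩
  · simp
  have h : ∑ i, w.1 i = 0 := w.2
  have e : ∑ k, w.1 k • (X k : MvPolynomial (Fin n) ℂ) = ∑ k, w.1 k • (X k - X o) := by
    simp only [smul_sub, Finset.sum_sub_distrib, ← Finset.sum_smul, h]
    simp
  rw [e]
  exact sum_mem fun k _ => Subalgebra.smul_mem _ (X_sub_X_mem _ _) _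

theorem divDiff_mem {n : ℕ} (i j : Fin n) {p : MvPolynomial (Fin n) ℂ}
    (hp : p ∈ diffRing n) : divDiff i j p ∈ diffRing n := by
  rcases eq_or_ne i j with rfl | hij
  · simp [divDiff]
  induction hp using Algebra.adjoin_induction with
  | mem p hp =>
    obtain ⟨k, l, rfl⟩ := hp
    have hX : ∀ k, ∃ a : ℂ, divDiff i j (X k : MvPolynomial (Fin n) ℂ) = C a := by
      intro k
      have : ∃ a : ℂ, (X (Equiv.swap i j k) - X k : MvPolynomial (Fin n) ℂ)
          = (X i - X j) * C a := by
        rcases eq_or_ne k i with rfl | hi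
        · exact ⟨-1, by rw [Equiv.swap_apply_left]; simp⟩
        · rcases eq_or_ne k j with rfl | hj
          · exact ⟨1, by rw [Equiv.swap_apply_right]; simp⟩
          · exact ⟨0, by rw [Equiv.swap_apply_of_ne_of_ne hi hj]; simp⟩
      obtain ⟨a, ha⟩ := this
      refine ⟨a, mul_left_cancel₀ (X_sub_X_ne_zero hij) ?_⟩
      rw [divDiff_spec hij, rename_X, ha]
    obtain ⟨a, ha⟩ := hX k
    obtain ⟨b, hb⟩ := hX l
    rw [map_sub, ha, hb]
    exact sub_mem (Subalgebra.algebraMap_mem _ a) (Subalgebra.algebraMap_mem _ b)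
  | algebraMap a => rw [algebraMap_eq, divDiff_C hij]; exact zero_mem _
  | add p q _ _ hp hq => rw [map_add]; exact add_mem hp hq
  | mul p q hp' hq' hp hq =>
    rw [divDiff_mul hij]
    exact add_mem (mul_mem hp hq') (mul_mem (rename_mem _ hp') hq)

theorem pderiv_mem {n : ℕ} (i : Fin n) {p : MvPolynomial (Fin n) ℂ}
    (hp : p ∈ diffRing n) : pderiv i p ∈ diffRing n := by
  induction hp using Algebra.adjoin_induction with
  | mem p hp =>
    obtain ⟨k, l, rfl⟩ := hp
    rw [map_sub, pderiv_X, pderiv_X]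
    refine sub_mem ?_ ?_ <;>
    · rw [Pi.single_apply]
      split_ifs
      · exact one_mem _
      · exact zero_mem _
  | algebraMap a => rw [algebraMap_eq, pderiv_C]; exact zero_mem _
  | add p q _ _ hp hq => rw [map_add]; exact add_mem hp hq
  | mul p q hp' hq' hp hq =>
    rw [pderiv_mul]
    exact add_mem (mul_mem hp hq') (mul_mem hp' hq)

theorem dunkl_mem {n : ℕ} (c : ℂ) (i : Fin n) {p : MvPolynomial (Fin n) ℂ}
    (hp : p ∈ diffRing n) : dunkl c i p ∈ diffRing n := by
  rw [dunkl_apply]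
  exact add_mem (pderiv_mem i hp)
    (Subalgebra.smul_mem _ (sum_mem fun j _ => divDiff_mem i j hp) _)

/-- The linear form `∑ w_k x_k ∈ 𝔥* ⊂ R`. -/
def linForm {n : ℕ} (w : Refl n) : diffRing n := ⟨∑ k, w.1 k • X k, lin_mem w⟩

/-- The action of a permutation on `R`. -/
def permOp {n : ℕ} (σ : Equiv.Perm (Fin n)) : Module.End ℂ (diffRing n) where
  toFun p := ⟨rename σ p.1, rename_mem σ p.2⟩
  map_add' _ _ := Subtype.ext (map_add _ _ _)
  map_smul' _ _ := Subtype.ext (map_smul _ _ _)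

/-- Multiplication by a linear form on `R`. -/
def mulOp {n : ℕ} (w : Refl n) : Module.End ℂ (diffRing n) :=
  LinearMap.mulLeft ℂ (linForm w)

/-- The Dunkl operator `∑ v_i D_i` on `R`, for `v ∈ 𝔥`. -/
def dunklOp {n : ℕ} (c : ℂ) (v : Refl n) : Module.End ℂ (diffRing n) where
  toFun p := ⟨∑ i, v.1 i • dunkl c i p.1,
    sum_mem fun i _ => Subalgebra.smul_mem _ (dunkl_mem c i p.2) _⟩
  map_add' p q := Subtype.ext (by simp [Finset.sum_add_distrib])
  map_smul' a p := Subtype.ext (by simp [Finset.smul_sum, smul_comm a])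

theorem sum_sum_eq_sum_lt {n : ℕ} {V : Type*} [AddCommGroup V] (f : Fin n → Fin n → V)
    (hf : ∀ i, f i i = 0) :
    ∑ i, ∑ j, f i j = ∑ p : Fin n × Fin n with p.1 < p.2, (f p.1 p.2 + f p.2 p.1) := by
  rw [← Finset.sum_product', Finset.sum_add_distrib, Finset.univ_product_univ,
    ← Finset.sum_filter_add_sum_filter_not Finset.univ (fun p : Fin n × Fin n => p.1 < p.2)]
  congr 1
  have h : ∑ p : Fin n × Fin n with p.1 < p.2, f p.2 p.1
      = ∑ p : Fin n × Fin n with p.2 < p.1, f p.1 p.2 :=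
    Finset.sum_bij (fun p _ => p.swap) (by simp) (by simp)
      (fun b hb => ⟨b.swap, by simpa using hb, by simp⟩)
      (by simp)
  rw [h]
  symm
  apply Finset.sum_subset
  · intro p hp
    simp only [Finset.mem_filter, Finset.mem_univ, true_and, not_lt] at *
    exact hp.le
  · intro p hp hp'
    simp only [Finset.mem_filter, Finset.mem_univ, true_and, not_lt] at *
    rw [le_antisymm hp' hp, hf]

/-- The operator by which a generator of `H_c` acts on `R`. -/
def genOp {n : ℕ} (c : ℂ) : Gen n → Module.End ℂ (diffRing n)
  | Gen.x w => mulOp w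
  | Gen.y v => dunklOp c v
  | Gen.s σ => permOp σ

theorem mulOp_apply {n : ℕ} (w : Refl n) (p : diffRing n) :
    ((mulOp w p : diffRing n) : MvPolynomial (Fin n) ℂ) = (∑ k, w.1 k • X k) * p.1 := rfl

theorem dunklOp_apply {n : ℕ} (c : ℂ) (v : Refl n) (p : diffRing n) :
    ((dunklOp c v p : diffRing n) : MvPolynomial (Fin n) ℂ) = ∑ i, v.1 i • dunkl c i p.1 := rfl

theorem permOp_apply {n : ℕ} (σ : Equiv.Perm (Fin n)) (p : diffRing n) :
    ((permOp σ p : diffRing n) : MvPolynomial (Fin n) ℂ) = rename σ p.1 := rfl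

theorem dunklOp_mulOp {n : ℕ} (c : ℂ) (v w : Refl n) :
    dunklOp c v * mulOp w - mulOp w * dunklOp c v
      = algebraMap ℂ _ (∑ i, v.1 i * w.1 i)
        - c • ∑ p : Fin n × Fin n with p.1 < p.2,
            ((v.1 p.1 - v.1 p.2) * (w.1 p.1 - w.1 p.2)) • permOp (Equiv.swap p.1 p.2) := by
  refine LinearMap.ext fun p => Subtype.ext ?_
  have hL : (((dunklOp c v * mulOp w - mulOp w * dunklOp c v) p : diffRing n) :
      MvPolynomial (Fin n) ℂ)
      = ∑ i, v.1 i • dunkl c i ((∑ k, w.1 k • X k) * p.1)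
        - (∑ k, w.1 k • X k) * ∑ i, v.1 i • dunkl c i p.1 := rfl
  have hS : (((∑ q : Fin n × Fin n with q.1 < q.2,
      ((v.1 q.1 - v.1 q.2) * (w.1 q.1 - w.1 q.2)) • permOp (Equiv.swap q.1 q.2)) p :
        diffRing n) : MvPolynomial (Fin n) ℂ)
      = ∑ i, ∑ j, (v.1 i * (w.1 i - w.1 j)) • rename (Equiv.swap i j) p.1 := by
    rw [sum_sum_eq_sum_lt _ (by simp), LinearMap.sum_apply, AddSubmonoidClass.coe_finsetSum]
    refine Finset.sum_congr rfl fun q _ => ?_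
    rw [LinearMap.smul_apply, Subalgebra.coe_smul, permOp_apply, Equiv.swap_comm q.2 q.1,
      ← add_smul]
    congr 1
    ring
  rw [hL, LinearMap.sub_apply, LinearMap.smul_apply, Subalgebra.coe_sub, Subalgebra.coe_smul, hS,
    Module.algebraMap_end_apply, Subalgebra.coe_smul]
  rw [Finset.mul_sum, ← Finset.sum_sub_distrib, Finset.sum_smul, Finset.smul_sum,
    ← Finset.sum_sub_distrib]
  refine Finset.sum_congr rfl fun i _ => ?_
  have hc : c • ∑ j, (v.1 i * (w.1 i - w.1 j)) • rename (Equiv.swap i j) p.1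
      = v.1 i • c • ∑ j, (w.1 i - w.1 j) • rename (Equiv.swap i j) p.1 := by
    rw [smul_comm (v.1 i) c]
    congr 1
    rw [Finset.smul_sum]
    exact Finset.sum_congr rfl fun j _ => mul_smul _ _ _
  rw [dunkl_lin_mul, hc, smul_sub, smul_add, mul_smul_comm, mul_smul]
  generalize v.1 i • c • ∑ j, (w.1 i - w.1 j) • rename (Equiv.swap i j) p.1 = a
  generalize v.1 i • ((∑ k, w.1 k • X k) * dunkl c i p.1) = b
  generalize v.1 i • w.1 i • p.1 = d
  abel

theorem genOp_rel {n : ℕ} (c : ℂ) ⦃a b : FreeAlgebra ℂ (Gen n)⦄ (h : Rel n c a b) :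
    FreeAlgebra.lift ℂ (genOp c) a = FreeAlgebra.lift ℂ (genOp c) b := by
  induction h with
  | x_add w w' =>
    simp only [FreeAlgebra.lift_ι_apply, map_add, genOp]
    refine LinearMap.ext fun p => Subtype.ext ?_
    simp [mulOp_apply, add_smul, Finset.sum_add_distrib, add_mul]
  | x_smul a w =>
    simp only [FreeAlgebra.lift_ι_apply, map_smul, genOp]
    refine LinearMap.ext fun p => Subtype.ext ?_
    simp only [LinearMap.smul_apply, Subalgebra.coe_smul, mulOp_apply, Submodule.coe_smul,
      Pi.smul_apply, smul_assoc, ← Finset.smul_sum, smul_mul_assoc]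
  | y_add w w' =>
    simp only [FreeAlgebra.lift_ι_apply, map_add, genOp]
    refine LinearMap.ext fun p => Subtype.ext ?_
    simp [dunklOp_apply, add_smul, Finset.sum_add_distrib]
  | y_smul a w =>
    simp only [FreeAlgebra.lift_ι_apply, map_smul, genOp]
    refine LinearMap.ext fun p => Subtype.ext ?_
    simp only [LinearMap.smul_apply, Subalgebra.coe_smul, dunklOp_apply, Submodule.coe_smul,
      Pi.smul_apply, smul_assoc, ← Finset.smul_sum]
  | s_one =>
    simp only [FreeAlgebra.lift_ι_apply, map_one, genOp]
    refine LinearMap.ext fun p => Subtype.ext ?_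
    simp [permOp_apply]
  | s_mul σ τ =>
    simp only [FreeAlgebra.lift_ι_apply, map_mul, genOp]
    refine LinearMap.ext fun p => Subtype.ext ?_
    simp only [Module.End.mul_apply, permOp_apply, rename_rename]
    rfl
  | x_comm w w' =>
    simp only [FreeAlgebra.lift_ι_apply, map_mul, genOp]
    refine LinearMap.ext fun p => Subtype.ext ?_
    simp only [Module.End.mul_apply, mulOp_apply]
    rw [mul_left_comm]
  | y_comm w w' =>
    simp only [FreeAlgebra.lift_ι_apply, map_mul, genOp]
    refine LinearMap.ext fun p => Subtype.ext ?_
    simp only [Module.End.mul_apply, dunklOp_apply, map_sum, map_smul, Finset.smul_sum]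
    rw [Finset.sum_comm]
    refine Finset.sum_congr rfl fun i _ => Finset.sum_congr rfl fun j _ => ?_
    rw [dunkl_comm, smul_comm]
  | s_x σ w =>
    simp only [FreeAlgebra.lift_ι_apply, map_mul, genOp]
    refine LinearMap.ext fun p => Subtype.ext ?_
    simp only [Module.End.mul_apply, permOp_apply, mulOp_apply, map_mul, map_sum, map_smul,
      rename_X]
    congr 1
    rw [← Equiv.sum_comp σ (fun i => (permRefl σ w).1 i • (X i : MvPolynomial (Fin n) ℂ))]
    simp [permRefl]
  | s_y σ w =>
    simp only [FreeAlgebra.lift_ι_apply, map_mul, genOp]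
    refine LinearMap.ext fun p => Subtype.ext ?_
    simp only [Module.End.mul_apply, permOp_apply, dunklOp_apply, map_sum, map_smul,
      rename_dunkl]
    rw [← Equiv.sum_comp σ (fun i => (permRefl σ w).1 i • dunkl c i (rename σ p.1))]
    simp [permRefl]
  | y_x v w =>
    rw [map_sub, map_sub, map_mul, map_mul, map_smul, map_sum (FreeAlgebra.lift ℂ _),
      AlgHom.commutes]
    simp only [map_smul, FreeAlgebra.lift_ι_apply]
    exact dunklOp_mulOp c v w

/-- The polynomial representation `H_c → End(R)`: `x` acts by multiplication, `y` by Dunkl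
operators, `S_n` by permuting the variables. -/
def polyRepHom (n : ℕ) (c : ℂ) : CherednikAlg n c →ₐ[ℂ] Module.End ℂ (diffRing n) :=
  liftAlg c (genOp c) (genOp_rel c)

/-- The polynomial representation `M_c`: the ring `R`, as a module over `H_c`. -/
def PolyRep (n : ℕ) (_c : ℂ) : Type := diffRing n

instance (n : ℕ) (c : ℂ) : CommRing (PolyRep n c) := inferInstanceAs (CommRing (diffRing n))

instance (n : ℕ) (c : ℂ) : Algebra ℂ (PolyRep n c) := inferInstanceAs (Algebra ℂ (diffRing n))

instance (n : ℕ) (c : ℂ) : Module (CherednikAlg n c) (PolyRep n c) :=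
  Module.compHom (diffRing n) (polyRepHom n c).toRingHom

theorem cherednik_smul_def {n : ℕ} {c : ℂ} (h : CherednikAlg n c) (p : PolyRep n c) :
    h • p = polyRepHom n c h p := rfl

instance (n : ℕ) (c : ℂ) : IsScalarTower ℂ (CherednikAlg n c) (PolyRep n c) where
  smul_assoc a h p := by
    rw [cherednik_smul_def, map_smul]
    rfl

theorem xGen_smul_def {n : ℕ} {c : ℂ} (w : Refl n) (p : PolyRep n c) :
    xGen c w • p = mulOp w p := by
  rw [cherednik_smul_def]
  exact congrArg (fun T : Module.End ℂ (diffRing n) => T p) (liftAlg_mk c _ _ (Gen.x w))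

theorem yGen_smul_def {n : ℕ} {c : ℂ} (v : Refl n) (p : PolyRep n c) :
    yGen c v • p = dunklOp c v p := by
  rw [cherednik_smul_def]
  exact congrArg (fun T : Module.End ℂ (diffRing n) => T p) (liftAlg_mk c _ _ (Gen.y v))

theorem sGen_smul_def {n : ℕ} {c : ℂ} (σ : Equiv.Perm (Fin n)) (p : PolyRep n c) :
    sGen c σ • p = permOp σ p := by
  rw [cherednik_smul_def]
  exact congrArg (fun T : Module.End ℂ (diffRing n) => T p) (liftAlg_mk c _ _ (Gen.s σ))

/-! ### The simple quotient `L_c`, its grading and the Dunkl form -/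

/-- The largest proper `H_c`-submodule `I_c` of `M_c`: the sum of all proper submodules. -/
def maxSub (n : ℕ) (c : ℂ) : Submodule (CherednikAlg n c) (PolyRep n c) :=
  sSup {N | N ≠ ⊤}

/-- The representation `L_c = M_c / I_c` of `H_c`. -/
def LRep (n : ℕ) (c : ℂ) : Type := PolyRep n c ⧸ maxSub n c

instance (n : ℕ) (c : ℂ) : AddCommGroup (LRep n c) :=
  inferInstanceAs (AddCommGroup (PolyRep n c ⧸ maxSub n c))

instance (n : ℕ) (c : ℂ) : Module (CherednikAlg n c) (LRep n c) :=
  inferInstanceAs (Module (CherednikAlg n c) (PolyRep n c ⧸ maxSub n c))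

instance (n : ℕ) (c : ℂ) : Module ℂ (LRep n c) :=
  inferInstanceAs (Module ℂ (PolyRep n c ⧸ maxSub n c))

/-- The quotient map `M_c → L_c`. -/
def toL (n : ℕ) (c : ℂ) : PolyRep n c →ₗ[ℂ] LRep n c := (maxSub n c).mkQ.restrictScalars ℂ

theorem toL_smul {n : ℕ} {c : ℂ} (h : CherednikAlg n c) (p : PolyRep n c) :
    toL n c (h • p) = h • toL n c p := rfl

theorem toL_surjective (n : ℕ) (c : ℂ) : Function.Surjective (toL n c) :=
  (maxSub n c).mkQ_surjective

/-- An element of `H_c`, as a linear operator on `L_c`. -/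
def actL {n : ℕ} {c : ℂ} (h : CherednikAlg n c) : Module.End ℂ (LRep n c) where
  toFun v := h • v
  map_add' := smul_add h
  map_smul' a v := by
    obtain ⟨p, rfl⟩ := toL_surjective n c v
    rw [RingHom.id_apply, ← map_smul, ← toL_smul, ← toL_smul, ← map_smul]
    congr 1
    exact map_smul (polyRepHom n c h) a p

theorem actL_apply {n : ℕ} {c : ℂ} (h : CherednikAlg n c) (v : LRep n c) : actL h v = h • v := rfl

/-- The grading element `𝐡 = ½ ∑ (x̃_i ỹ_i + ỹ_i x̃_i) ∈ H_c`, where `x̃_i`, `ỹ_i` are the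
projections of `x_i`, `y_i` to `𝔥*`, `𝔥`. It equals
`½ ∑ (x_i y_i + y_i x_i) - ½ (x̄ ȳ + ȳ x̄)` with `x̄ = n^{-1/2} ∑ x_i`, `ȳ = n^{-1/2} ∑ y_i`. -/
def gradingElt (n : ℕ) (c : ℂ) : CherednikAlg n c :=
  (1 / 2 : ℂ) • ∑ i : Fin n,
    (xGen c (eBar i) * yGen c (eBar i) + yGen c (eBar i) * xGen c (eBar i))

/-- The component `L_c(k)`: the eigenspace of `𝐡` with eigenvalue `k`. -/
def gradedPiece (n : ℕ) (c : ℂ) (k : ℤ) : Submodule ℂ (LRep n c) :=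
  Module.End.eigenspace (actL (gradingElt n c)) (k : ℂ)

/-- The value of a polynomial at `x = 0`. -/
def evalZero (n : ℕ) (c : ℂ) : PolyRep n c →ₗ[ℂ] ℂ :=
  ((aeval (fun _ => (0 : ℂ))).comp (diffRing n).val).toLinearMap

/-- The ideal of `R = M_c` generated by symmetric polynomials without constant term. -/
def symIdeal (n : ℕ) (c : ℂ) : Ideal (PolyRep n c) :=
  Ideal.span {p | (∀ σ : Equiv.Perm (Fin n), sGen c σ • p = p) ∧ evalZero n c p = 0}

/-- The image in `L_c` of the `j`-th power of the ideal generated by symmetric polynomials of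
positive degree. -/
def symPow (n : ℕ) (c : ℂ) (j : ℕ) : Submodule ℂ (LRep n c) :=
  ((symIdeal n c ^ j).restrictScalars ℂ).map (toL n c)

/-- The decreasing filtration `F^i L_c = ∑_j (𝔞^j ∩ ⨁_{k < 2j - i} L_c(k))`. -/
def decFilt (n : ℕ) (c : ℂ) (i : ℤ) : Submodule ℂ (LRep n c) :=
  ⨆ j : ℕ, symPow n c j ⊓ ⨆ k : ℤ, ⨆ _ : k < 2 * (j : ℤ) - i, gradedPiece n c k

/-- The subalgebra of `H_c` generated by `𝔥*`, through which `ℂ[𝔥*] → H_c` is defined. -/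
abbrev xSubalg (n : ℕ) (c : ℂ) : Subalgebra ℂ (CherednikAlg n c) :=
  Algebra.adjoin ℂ (Set.range (xGen (n := n) c))

theorem xSubalg_isMulCommutative (n : ℕ) (c : ℂ) : IsMulCommutative (xSubalg n c) :=
  Algebra.isMulCommutative_adjoin ℂ (by
    rintro _ ⟨w, rfl⟩ _ ⟨w', rfl⟩
    exact xGen_comm c w w')

open scoped IsMulCommutative in
/-- The algebra homomorphism `ℂ[x₁, …, xₙ] → H_c`, `x_i ↦ x̃_i`. On `R = ℂ[𝔥*]` it is the
inclusion `ℂ[𝔥*] ⊂ H_c`. -/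
def polyToAlg (n : ℕ) (c : ℂ) : MvPolynomial (Fin n) ℂ →ₐ[ℂ] CherednikAlg n c :=
  have := xSubalg_isMulCommutative n c
  (xSubalg n c).val.comp
    (aeval fun i => (⟨xGen c (eBar i), Algebra.subset_adjoin ⟨_, rfl⟩⟩ : xSubalg n c))

theorem polyToAlg_X {n : ℕ} (c : ℂ) (i : Fin n) : polyToAlg n c (X i) = xGen c (eBar i) := by
  simp [polyToAlg]

/-- The Dunkl form `(f, g)_c = [Φ(f) · g]|_{x = 0}` on `M_c`. -/
def dunklForm (n : ℕ) (c : ℂ) : LinearMap.BilinForm ℂ (PolyRep n c) :=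
  LinearMap.mk₂ ℂ
    (fun f g => evalZero n c (fourier n c (polyToAlg n c ((diffRing n).val f)) • g))
    (fun f f' g => by
      rw [← map_add (evalZero n c), ← add_smul, ← map_add (fourier n c),
        ← map_add (polyToAlg n c)]
      rfl)
    (fun a f g => by
      rw [← map_smul (evalZero n c), ← smul_assoc, ← map_smul (fourier n c),
        ← map_smul (polyToAlg n c)]
      rfl)
    (fun f g g' => by rw [smul_add, map_add])
    (fun a f g => by
      rw [← map_smul (evalZero n c)]
      congr 1
      exact map_smul (polyRepHom n c _) a g)

theorem dunklForm_apply {n : ℕ} {c : ℂ} (f g : PolyRep n c) : dunklForm n c f g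
    = evalZero n c (fourier n c (polyToAlg n c ((diffRing n).val f)) • g) := rfl

/-- The orthogonal complement `V^⊥ ⊆ L_c` of `V ⊆ L_c` with respect to the form that the Dunkl
form induces on `L_c`: the classes of those `f ∈ M_c` that are orthogonal to every `g ∈ M_c` whose
class lies in `V`. -/
def dunklPerp {n : ℕ} {c : ℂ} (V : Submodule ℂ (LRep n c)) : Submodule ℂ (LRep n c) :=
  Submodule.map (toL n c)
    { carrier := {f | ∀ g, toL n c g ∈ V → dunklForm n c f g = 0}
      add_mem' := fun {f f'} hf hf' g hg => by
        rw [map_add, LinearMap.add_apply, hf g hg, hf' g hg, add_zero]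
      zero_mem' := fun g _ => by rw [map_zero, LinearMap.zero_apply]
      smul_mem' := fun a f hf g hg => by
        rw [map_smul, LinearMap.smul_apply, hf g hg, smul_zero] }

/-- The algebraic filtration `F^alg_i L_c = (F^i L_c)^⊥`. -/
def algFilt (n : ℕ) (c : ℂ) (i : ℤ) : Submodule ℂ (LRep n c) := dunklPerp (decFilt n c i)

/-! ### Compatibility of the algebraic filtration with `𝔥*` and `S_n` -/

section compat

variable {n : ℕ} {c : ℂ}

theorem xGen_sum_eBar (w : Refl n) : ∑ i, w.1 i • xGen c (eBar i) = xGen c w := by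
  let φ : Refl n →ₗ[ℂ] CherednikAlg n c :=
    { toFun := xGen c, map_add' := xGen_add c, map_smul' := xGen_smul c }
  have h := congrArg φ (sum_smul_eBar w)
  rw [map_sum] at h
  simp only [map_smul] at h
  exact h

theorem yGen_sum_eBar (w : Refl n) : ∑ i, w.1 i • yGen c (eBar i) = yGen c w := by
  let φ : Refl n →ₗ[ℂ] CherednikAlg n c :=
    { toFun := yGen c, map_add' := yGen_add c, map_smul' := yGen_smul c }
  have h := congrArg φ (sum_smul_eBar w)
  rw [map_sum] at h
  simp only [map_smul] at h
  exact h

theorem polyToAlg_lin (w : Refl n) : polyToAlg n c (∑ k, w.1 k • X k) = xGen c w := by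
  rw [map_sum, ← xGen_sum_eBar]
  exact Finset.sum_congr rfl fun i _ => by rw [map_smul, polyToAlg_X]

theorem dunklForm_xGen (w : Refl n) (f g : PolyRep n c) :
    dunklForm n c (xGen c w • f) g = dunklForm n c f (yGen c w • g) := by
  have h : (diffRing n).val (xGen c w • f : PolyRep n c)
      = (diffRing n).val f * ∑ k, w.1 k • X k := by
    rw [xGen_smul_def, mul_comm]; rfl
  rw [dunklForm_apply, dunklForm_apply, h, map_mul, map_mul, polyToAlg_lin, fourier_xGen, mul_smul]

theorem evalZero_sGen (σ : Equiv.Perm (Fin n)) (p : PolyRep n c) :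
    evalZero n c (sGen c σ • p) = evalZero n c p := by
  rw [sGen_smul_def]
  change aeval (fun _ => (0 : ℂ)) (rename σ ((diffRing n).val p))
    = aeval (fun _ => (0 : ℂ)) ((diffRing n).val p)
  rw [aeval_rename]
  rfl

theorem polyToAlg_rename (σ : Equiv.Perm (Fin n)) (p : MvPolynomial (Fin n) ℂ) :
    polyToAlg n c (rename σ p) * sGen c σ = sGen c σ * polyToAlg n c p := by
  induction p using MvPolynomial.induction_on with
  | C a =>
    rw [rename_C, ← algebraMap_eq, AlgHom.commutes]
    exact Algebra.commutes a _
  | add p q hp hq => rw [map_add, map_add, map_add, add_mul, mul_add, hp, hq]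
  | mul_X p i hp =>
    rw [map_mul, map_mul, map_mul, rename_X, polyToAlg_X, polyToAlg_X, mul_assoc,
      ← permRefl_eBar, ← sGen_xGen, ← mul_assoc, hp, mul_assoc]

theorem dunklForm_sGen (σ : Equiv.Perm (Fin n)) (f g : PolyRep n c) :
    dunklForm n c (sGen c σ • f) (sGen c σ • g) = dunklForm n c f g := by
  have h : (diffRing n).val (sGen c σ • f : PolyRep n c)
      = rename σ ((diffRing n).val f) := by
    rw [sGen_smul_def]; rfl
  have h' := congrArg (fourier n c) (polyToAlg_rename (c := c) σ ((diffRing n).val f))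
  rw [map_mul, map_mul, fourier_sGen] at h'
  rw [dunklForm_apply, dunklForm_apply, h, ← mul_smul, h', mul_smul, evalZero_sGen]

theorem sGen_gradingElt (σ : Equiv.Perm (Fin n)) :
    sGen c σ * gradingElt n c = gradingElt n c * sGen c σ := by
  rw [gradingElt, mul_smul_comm, smul_mul_assoc, Finset.mul_sum, Finset.sum_mul,
    ← Equiv.sum_comp σ (fun i => (xGen c (eBar i) * yGen c (eBar i)
      + yGen c (eBar i) * xGen c (eBar i)) * sGen c σ)]
  congr 1
  refine Finset.sum_congr rfl fun i _ => ?_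
  rw [mul_add, add_mul, ← mul_assoc, ← mul_assoc, sGen_xGen, sGen_yGen, permRefl_eBar,
    mul_assoc, mul_assoc, sGen_xGen, sGen_yGen, permRefl_eBar, mul_assoc, mul_assoc]

theorem yGen_xGen_eBar (v : Refl n) (i : Fin n) :
    yGen c v * xGen c (eBar i) - xGen c (eBar i) * yGen c v = algebraMap ℂ _ (v.1 i)
      - c • ∑ p : Fin n × Fin n with p.1 < p.2,
          ((v.1 p.1 - v.1 p.2) * ((if p.1 = i then 1 else 0) - (if p.2 = i then 1 else 0))) •
            sGen c (Equiv.swap p.1 p.2) := by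
  have hv : ∑ i, v.1 i = 0 := v.2
  have h1 : ∑ j, v.1 j * (eBar i).1 j = v.1 i := by
    simp [eBar, mul_sub, Finset.sum_sub_distrib, ← Finset.sum_mul, hv]
  rw [yGen_xGen, h1]
  simp [eBar]

theorem yGen_gradingElt (v : Refl n) :
    yGen c v * gradingElt n c - gradingElt n c * yGen c v = yGen c v := by
  have hs : ∀ p : Fin n × Fin n,
      sGen c (Equiv.swap p.1 p.2) * (yGen c (eBar p.1) - yGen c (eBar p.2))
        + (yGen c (eBar p.1) - yGen c (eBar p.2)) * sGen c (Equiv.swap p.1 p.2) = 0 := by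
    intro p
    rw [mul_sub, sGen_yGen, sGen_yGen, permRefl_eBar, permRefl_eBar, Equiv.swap_apply_left,
      Equiv.swap_apply_right, sub_mul]
    abel
  have hi : ∀ i : Fin n, yGen c v * (xGen c (eBar i) * yGen c (eBar i)
        + yGen c (eBar i) * xGen c (eBar i))
      - (xGen c (eBar i) * yGen c (eBar i) + yGen c (eBar i) * xGen c (eBar i)) * yGen c v
      = (yGen c v * xGen c (eBar i) - xGen c (eBar i) * yGen c v) * yGen c (eBar i)
        + yGen c (eBar i) * (yGen c v * xGen c (eBar i) - xGen c (eBar i) * yGen c v) := by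
    intro i
    have h := yGen_comm c v (eBar i)
    have h1 : xGen c (eBar i) * yGen c (eBar i) * yGen c v
        = xGen c (eBar i) * yGen c v * yGen c (eBar i) := by
      rw [mul_assoc, ← h, mul_assoc]
    have h2 : yGen c v * (yGen c (eBar i) * xGen c (eBar i))
        = yGen c (eBar i) * (yGen c v * xGen c (eBar i)) := by
      rw [← mul_assoc, h, mul_assoc]
    rw [mul_add, add_mul, h1, h2, sub_mul, mul_sub, mul_assoc, mul_assoc, mul_assoc]
    abel
  have hj : ∀ i : Fin n,
      (yGen c v * xGen c (eBar i) - xGen c (eBar i) * yGen c v) * yGen c (eBar i)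
        + yGen c (eBar i) * (yGen c v * xGen c (eBar i) - xGen c (eBar i) * yGen c v)
      = (2 : ℂ) • v.1 i • yGen c (eBar i) - c • ∑ p : Fin n × Fin n with p.1 < p.2,
          (v.1 p.1 - v.1 p.2) •
            ((if p.1 = i then (1 : ℂ) else 0) - (if p.2 = i then 1 else 0)) •
            (sGen c (Equiv.swap p.1 p.2) * yGen c (eBar i)
              + yGen c (eBar i) * sGen c (Equiv.swap p.1 p.2)) := by
    intro i
    rw [yGen_xGen_eBar, sub_mul, mul_sub, smul_mul_assoc, mul_smul_comm, Finset.sum_mul,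
      Finset.mul_sum, ← Algebra.commutes, ← Algebra.smul_def, two_smul]
    simp only [smul_add, Finset.sum_add_distrib, smul_mul_assoc, mul_smul_comm, mul_smul]
    abel
  have hz : ∑ i : Fin n, ∑ p : Fin n × Fin n with p.1 < p.2,
          (v.1 p.1 - v.1 p.2) •
            ((if p.1 = i then (1 : ℂ) else 0) - (if p.2 = i then 1 else 0)) •
            (sGen c (Equiv.swap p.1 p.2) * yGen c (eBar i)
              + yGen c (eBar i) * sGen c (Equiv.swap p.1 p.2)) = 0 := by
    rw [Finset.sum_comm]
    refine Finset.sum_eq_zero fun p _ => ?_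
    rw [← Finset.smul_sum]
    simp only [sub_smul, ite_smul, one_smul, zero_smul, Finset.sum_sub_distrib,
      Finset.sum_ite_eq, Finset.mem_univ, if_true]
    have h := hs p
    rw [mul_sub, sub_mul] at h
    rw [← smul_zero (v.1 p.1 - v.1 p.2), ← h, ← sub_smul]
    congr 1
    abel
  rw [gradingElt, mul_smul_comm, smul_mul_assoc, ← smul_sub, Finset.mul_sum, Finset.sum_mul,
    ← Finset.sum_sub_distrib, Finset.sum_congr rfl fun i _ => (hi i).trans (hj i),
    Finset.sum_sub_distrib, ← Finset.smul_sum, ← Finset.smul_sum, hz, yGen_sum_eBar, smul_zero,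
    sub_zero, smul_smul]
  norm_num

theorem yGen_mul_of_symm (v : Refl n) (q p : PolyRep n c)
    (hq : ∀ σ : Equiv.Perm (Fin n), sGen c σ • q = q) :
    yGen c v • (q * p) = (yGen c v • q) * p + q * (yGen c v • p) := by
  have hq' : ∀ σ : Equiv.Perm (Fin n), rename σ ((diffRing n).val q) = (diffRing n).val q := by
    intro σ
    have h := hq σ
    rw [sGen_smul_def] at h
    exact congrArg (diffRing n).val h
  rw [yGen_smul_def, yGen_smul_def, yGen_smul_def]
  refine Subtype.ext ?_
  change ∑ i, v.1 i • dunkl c i ((diffRing n).val q * (diffRing n).val p)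
    = (∑ i, v.1 i • dunkl c i ((diffRing n).val q)) * (diffRing n).val p
      + (diffRing n).val q * ∑ i, v.1 i • dunkl c i ((diffRing n).val p)
  rw [Finset.sum_mul, Finset.mul_sum, ← Finset.sum_add_distrib]
  refine Finset.sum_congr rfl fun i _ => ?_
  rw [dunkl_mul_of_symm c i _ _ hq', smul_add, smul_mul_assoc, mul_smul_comm]

theorem sGen_mul_poly (σ : Equiv.Perm (Fin n)) (q p : PolyRep n c) :
    sGen c σ • (q * p) = (sGen c σ • q) * (sGen c σ • p) := by
  rw [sGen_smul_def, sGen_smul_def, sGen_smul_def]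
  refine Subtype.ext ?_
  exact map_mul (rename σ) _ _

theorem sGen_symIdeal_pow (σ : Equiv.Perm (Fin n)) (j : ℕ) (p : PolyRep n c)
    (hp : p ∈ symIdeal n c ^ j) : sGen c σ • p ∈ symIdeal n c ^ j := by
  let φ : PolyRep n c →+* PolyRep n c :=
    { toFun := fun p => sGen c σ • p
      map_add' := smul_add _
      map_zero' := smul_zero _
      map_mul' := sGen_mul_poly σ
      map_one' := by
        rw [sGen_smul_def]
        exact Subtype.ext (map_one (rename σ)) }
  have h1 : symIdeal n c ≤ (symIdeal n c).comap φ := by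
    refine Ideal.span_le.2 fun q hq => ?_
    have : φ q = q := hq.1 σ
    change φ q ∈ symIdeal n c
    rw [this]
    exact Ideal.subset_span hq
  have h2 : symIdeal n c ^ j ≤ (symIdeal n c ^ j).comap φ :=
    (Ideal.pow_right_mono h1 j).trans (Ideal.le_comap_pow φ j)
  exact h2 hp

theorem yGen_symIdeal_pow (v : Refl n) (j : ℕ) (p : PolyRep n c)
    (hp : p ∈ symIdeal n c ^ j) : yGen c v • p ∈ symIdeal n c ^ (j - 1) := by
  induction j generalizing p with
  | zero => simp
  | succ j ih =>
    rw [Nat.add_sub_cancel]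
    rw [pow_succ'] at hp
    induction hp using Submodule.mul_induction_on' with
    | add p _ q _ hp hq => rw [smul_add]; exact add_mem hp hq
    | mem_mul_mem s hs p hp =>
      induction hs using Submodule.span_induction generalizing p with
      | zero => rw [zero_mul, smul_zero]; exact zero_mem _
      | add s t _ _ hs ht => rw [add_mul, smul_add]; exact add_mem (hs p hp) (ht p hp)
      | smul r s _ hs =>
        rw [smul_eq_mul, mul_comm r s, mul_assoc]
        exact hs _ (Ideal.mul_mem_left _ _ hp)
      | mem q hq =>
        rw [yGen_mul_of_symm v q p hq.1]
        refine add_mem (Ideal.mul_mem_left _ _ hp) ?_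
        rcases j with _ | j
        · simp
        · rw [pow_succ']
          exact Ideal.mul_mem_mul (Ideal.subset_span hq) (ih p hp)

theorem mem_gradedPiece {k : ℤ} {u : LRep n c} :
    u ∈ gradedPiece n c k ↔ gradingElt n c • u = (k : ℂ) • u :=
  Module.End.mem_eigenspace_iff

theorem sGen_decFilt (σ : Equiv.Perm (Fin n)) (i : ℤ) (u : LRep n c)
    (hu : u ∈ decFilt n c i) : sGen c σ • u ∈ decFilt n c i := by
  suffices h : decFilt n c i ≤ (decFilt n c i).comap (actL (sGen c σ)) from h hu
  refine iSup_le fun j => ?_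
  rw [← Submodule.map_le_iff_le_comap]
  refine le_trans ?_ (le_iSup _ j)
  refine (Submodule.map_inf_le _).trans (inf_le_inf ?_ ?_)
  · rintro _ ⟨_, ⟨p, hp, rfl⟩, rfl⟩
    exact ⟨sGen c σ • p, sGen_symIdeal_pow σ j p hp, rfl⟩
  · simp only [Submodule.map_iSup]
    refine iSup₂_mono fun k _ => ?_
    rintro _ ⟨u, hu, rfl⟩
    have hu' : gradingElt n c • u = (k : ℂ) • u := mem_gradedPiece.1 hu
    rw [mem_gradedPiece, actL_apply, ← mul_smul, ← sGen_gradingElt, mul_smul, hu', ← actL_apply,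
      map_smul, actL_apply]

theorem yGen_decFilt (v : Refl n) (i : ℤ) (u : LRep n c)
    (hu : u ∈ decFilt n c (i + 1)) : yGen c v • u ∈ decFilt n c i := by
  suffices h : decFilt n c (i + 1) ≤ (decFilt n c i).comap (actL (yGen c v)) from h hu
  refine iSup_le fun j => ?_
  rw [← Submodule.map_le_iff_le_comap]
  refine le_trans ?_ (le_iSup _ (j - 1))
  refine (Submodule.map_inf_le _).trans (inf_le_inf ?_ ?_)
  · rintro _ ⟨_, ⟨p, hp, rfl⟩, rfl⟩
    exact ⟨yGen c v • p, yGen_symIdeal_pow v j p hp, rfl⟩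
  · simp only [Submodule.map_iSup]
    refine iSup₂_le fun k hk => ?_
    refine le_trans ?_ (le_iSup₂_of_le (k - 1) (by omega) le_rfl)
    rintro _ ⟨u, hu, rfl⟩
    have hu' : gradingElt n c • u = (k : ℂ) • u := mem_gradedPiece.1 hu
    have h : gradingElt n c * yGen c v = yGen c v * gradingElt n c - yGen c v := by
      rw [sub_eq_of_eq_add' (sub_eq_iff_eq_add.1 (yGen_gradingElt v))]
    rw [mem_gradedPiece, actL_apply, ← mul_smul, h, sub_smul, mul_smul, hu', ← actL_apply,
      ← actL_apply, map_smul]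
    push_cast
    rw [sub_smul, one_smul]

/-- `x · F^alg_i ⊆ F^alg_{i+1}` for `x ∈ 𝔥*`. -/
theorem xGen_algFilt (w : Refl n) (i : ℤ) (u : LRep n c) (hu : u ∈ algFilt n c i) :
    xGen c w • u ∈ algFilt n c (i + 1) := by
  obtain ⟨f, hf, rfl⟩ := hu
  refine ⟨xGen c w • f, fun g hg => ?_, rfl⟩
  rw [dunklForm_xGen]
  exact hf _ (by rw [toL_smul]; exact yGen_decFilt w i _ hg)

/-- `σ · F^alg_i ⊆ F^alg_i` for `σ ∈ S_n`. -/
theorem sGen_algFilt (σ : Equiv.Perm (Fin n)) (i : ℤ) (u : LRep n c) (hu : u ∈ algFilt n c i) :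
    sGen c σ • u ∈ algFilt n c i := by
  obtain ⟨f, hf, rfl⟩ := hu
  refine ⟨sGen c σ • f, fun g hg => ?_, rfl⟩
  have hg' : g = sGen c σ • sGen c σ⁻¹ • g := by
    rw [← mul_smul, ← sGen_mul, mul_inv_cancel, sGen_one, one_smul]
  rw [hg', dunklForm_sGen]
  exact hf _ (by rw [toL_smul]; exact sGen_decFilt _ i _ hg)

end compat

/-! ### The associated graded space and the differential `d₁` -/

/-- The graded piece `F^alg_i / F^alg_{i-1}`. -/
def grPiece (n : ℕ) (c : ℂ) (i : ℤ) : Type :=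
  algFilt n c i ⧸ (algFilt n c (i - 1)).submoduleOf (algFilt n c i)

instance (n : ℕ) (c : ℂ) (i : ℤ) : AddCommGroup (grPiece n c i) :=
  inferInstanceAs (AddCommGroup
    (algFilt n c i ⧸ (algFilt n c (i - 1)).submoduleOf (algFilt n c i)))

instance (n : ℕ) (c : ℂ) (i : ℤ) : Module ℂ (grPiece n c i) :=
  inferInstanceAs (Module ℂ
    (algFilt n c i ⧸ (algFilt n c (i - 1)).submoduleOf (algFilt n c i)))

/-- The quotient map `F^alg_i → F^alg_i / F^alg_{i-1}`. -/
def toGrPiece (n : ℕ) (c : ℂ) (i : ℤ) : algFilt n c i →ₗ[ℂ] grPiece n c i :=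
  ((algFilt n c (i - 1)).submoduleOf (algFilt n c i)).mkQ

/-- The map `F^alg_i / F^alg_{i-1} → F^alg_j / F^alg_{j-1}` induced by an operator on `L_c` that
maps `F^alg_i` to `F^alg_j` and `F^alg_{i-1}` to `F^alg_{j-1}`. -/
def grPieceMap {n : ℕ} {c : ℂ} (T : Module.End ℂ (LRep n c)) (i j : ℤ)
    (h : ∀ u ∈ algFilt n c i, T u ∈ algFilt n c j)
    (h' : ∀ u ∈ algFilt n c (i - 1), T u ∈ algFilt n c (j - 1)) :
    grPiece n c i →ₗ[ℂ] grPiece n c j :=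
  Submodule.mapQ _ _ (T.restrict h) (fun u hu => h' u.1 hu)

/-- The associated graded space `gr L_c = ⨁_i F^alg_i / F^alg_{i-1}`. -/
abbrev GrL (n : ℕ) (c : ℂ) : Type := DirectSum ℤ (grPiece n c)

/-- The class in `F^alg_i / F^alg_{i-1}` of an element of `F^alg_i`. -/
def grMk {n : ℕ} {c : ℂ} (i : ℤ) (u : LRep n c) (hu : u ∈ algFilt n c i) : GrL n c :=
  DirectSum.lof ℂ ℤ (grPiece n c) i (toGrPiece n c i ⟨u, hu⟩)

/-- The action of `x ∈ 𝔥*` on `gr L_c`, of degree one: the class of `u ∈ F^alg_i` goes to the class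
of `x u ∈ F^alg_{i+1}`. -/
def xGr {n : ℕ} {c : ℂ} (w : Refl n) : Module.End ℂ (GrL n c) :=
  DirectSum.toModule ℂ ℤ (GrL n c) fun i =>
    DirectSum.lof ℂ ℤ (grPiece n c) (i + 1) ∘ₗ
      grPieceMap (actL (xGen c w)) i (i + 1) (xGen_algFilt w i) (fun u hu => by
        have h := xGen_algFilt w (i - 1) u hu
        rw [sub_add_cancel] at h
        rwa [add_sub_cancel_right, actL_apply])

/-- The action of `S_n` on `gr L_c`. -/
def sGr {n : ℕ} {c : ℂ} (σ : Equiv.Perm (Fin n)) : Module.End ℂ (GrL n c) :=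
  DirectSum.toModule ℂ ℤ (GrL n c) fun i =>
    DirectSum.lof ℂ ℤ (grPiece n c) i ∘ₗ
      grPieceMap (actL (sGen c σ)) i i (sGen_algFilt σ i) (sGen_algFilt σ (i - 1))

theorem xGr_grMk {n : ℕ} {c : ℂ} (w : Refl n) (i : ℤ) (u : LRep n c) (hu : u ∈ algFilt n c i) :
    xGr w (grMk i u hu) = grMk (i + 1) (xGen c w • u) (xGen_algFilt w i u hu) := by
  rw [xGr, grMk, DirectSum.toModule_lof]
  rfl

theorem sGr_grMk {n : ℕ} {c : ℂ} (σ : Equiv.Perm (Fin n)) (i : ℤ) (u : LRep n c)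
    (hu : u ∈ algFilt n c i) :
    sGr σ (grMk i u hu) = grMk i (sGen c σ • u) (sGen_algFilt σ i u hu) := by
  rw [sGr, grMk, DirectSum.toModule_lof]
  rfl

theorem GrL_hom_ext {n : ℕ} {c : ℂ} {S T : Module.End ℂ (GrL n c)}
    (h : ∀ i u hu, S (grMk i u hu) = T (grMk i u hu)) : S = T := by
  refine DirectSum.linearMap_ext ℂ fun i => LinearMap.ext fun u => ?_
  obtain ⟨⟨u, hu⟩, rfl⟩ := Submodule.Quotient.mk_surjective _ u
  exact h i u hu

theorem sGr_xGr {n : ℕ} {c : ℂ} (σ : Equiv.Perm (Fin n)) (w : Refl n) :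
    (sGr σ * xGr w : Module.End ℂ (GrL n c)) = xGr (permRefl σ w) * sGr σ := by
  refine GrL_hom_ext fun i u hu => ?_
  simp only [Module.End.mul_apply, xGr_grMk, sGr_grMk, ← mul_smul, sGen_xGen]

/-- The `S_n`-equivariant linear maps `Λ^* 𝔥 → gr L_c`. -/
def equivariantMaps (n : ℕ) (c : ℂ) : Submodule ℂ (ExteriorAlgebra ℂ (Refl n) →ₗ[ℂ] GrL n c) where
  carrier := {φ | ∀ σ v, φ (ExteriorAlgebra.map (permRefl σ) v) = sGr σ (φ v)}
  add_mem' := fun {φ ψ} hφ hψ σ v => by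
    rw [LinearMap.add_apply, hφ, hψ, LinearMap.add_apply, map_add]
  zero_mem' := fun σ v => by rw [LinearMap.zero_apply, LinearMap.zero_apply, map_zero]
  smul_mem' := fun a φ hφ σ v => by
    rw [LinearMap.smul_apply, hφ, LinearMap.smul_apply, map_smul]

/-- The space `H_c^{F^alg} = Hom_{S_n}(Λ^* 𝔥, gr L_c)`. -/
def HomSn (n : ℕ) (c : ℂ) : Type := equivariantMaps n c

instance (n : ℕ) (c : ℂ) : AddCommGroup (HomSn n c) :=
  inferInstanceAs (AddCommGroup (equivariantMaps n c))

instance (n : ℕ) (c : ℂ) : Module ℂ (HomSn n c) :=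
  inferInstanceAs (Module ℂ (equivariantMaps n c))

/-- Contraction with the equivariant map `α : 𝔥 → 𝔥* ⊂ H_c`, `y_i - y_j ↦ x_i - x_j`: the map
`φ` on `Λ^k 𝔥` goes to the composite `Λ^{k-1} 𝔥 → 𝔥 ⊗ Λ^k 𝔥 → H_c ⊗ gr L_c → gr L_c` of
`v ↦ ∑_i ỹ_i ⊗ (ỹ_i ∧ v)` (the dual of contraction, for `𝔥 ≅ 𝔥*`), `α ⊗ φ` and the action. -/
def contraction (n : ℕ) (c : ℂ) : (ExteriorAlgebra ℂ (Refl n) →ₗ[ℂ] GrL n c) →ₗ[ℂ]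
    (ExteriorAlgebra ℂ (Refl n) →ₗ[ℂ] GrL n c) where
  toFun φ := ∑ i : Fin n, xGr (eBar i) ∘ₗ φ ∘ₗ
    LinearMap.mulLeft ℂ (ExteriorAlgebra.ι ℂ (eBar i : Refl n))
  map_add' φ ψ := LinearMap.ext fun v => by
    simp [LinearMap.sum_apply, Finset.sum_add_distrib]
  map_smul' a φ := LinearMap.ext fun v => by
    simp [LinearMap.sum_apply, Finset.smul_sum]

theorem contraction_apply {n : ℕ} {c : ℂ} (φ : ExteriorAlgebra ℂ (Refl n) →ₗ[ℂ] GrL n c)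
    (v : ExteriorAlgebra ℂ (Refl n)) : contraction n c φ v
      = ∑ i : Fin n, xGr (eBar i) (φ (ExteriorAlgebra.ι ℂ (eBar i) * v)) := by
  simp [contraction, LinearMap.sum_apply]

theorem contraction_mem {n : ℕ} {c : ℂ} (φ : ExteriorAlgebra ℂ (Refl n) →ₗ[ℂ] GrL n c)
    (hφ : φ ∈ equivariantMaps n c) : contraction n c φ ∈ equivariantMaps n c := by
  intro σ v
  rw [contraction_apply, contraction_apply, map_sum, ← Equiv.sum_comp σ]
  refine Finset.sum_congr rfl fun i _ => ?_
  have h : sGr σ (xGr (eBar i) (φ (ExteriorAlgebra.ι ℂ (eBar i) * v)))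
      = xGr (eBar (σ i)) (sGr σ (φ (ExteriorAlgebra.ι ℂ (eBar i) * v))) := by
    rw [← permRefl_eBar]
    exact LinearMap.congr_fun (sGr_xGr σ (eBar i)) _
  rw [h, ← hφ σ, map_mul (ExteriorAlgebra.map (permRefl σ)), ExteriorAlgebra.map_apply_ι,
    permRefl_eBar]

/-- The differential `d₁` of `H_c^{F^alg} = Hom_{S_n}(Λ^* 𝔥, gr L_c)`. -/
def dOne (n : ℕ) (c : ℂ) : HomSn n c →ₗ[ℂ] HomSn n c :=
  (contraction n c).restrict (p := equivariantMaps n c) (q := equivariantMaps n c)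
    (fun φ hφ => contraction_mem φ hφ)

/-- The homology `ker d₁ / im d₁`. -/
abbrev homologyDOne (n : ℕ) (c : ℂ) : Type :=
  LinearMap.ker (dOne n c) ⧸ (LinearMap.range (dOne n c)).submoduleOf (LinearMap.ker (dOne n c))

/-- For `S_n`-invariant `u ∈ F^alg_i`, that is `u ∈ 𝐞 L_c = Hom_{S_n}(Λ^0 𝔥, L_c)`, the class
of `u` in `Hom_{S_n}(Λ^0 𝔥, F^alg_i / F^alg_{i-1}) ⊆ Hom_{S_n}(Λ^* 𝔥, gr L_c)`. -/
def invClass {n : ℕ} {c : ℂ} (i : ℤ) (u : LRep n c) (hu : u ∈ algFilt n c i)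
    (hinv : ∀ σ : Equiv.Perm (Fin n), sGen c σ • u = u) : HomSn n c :=
  ⟨(ExteriorAlgebra.algebraMapInv (R := ℂ) (M := Refl n)).toLinearMap.smulRight (grMk i u hu),
    fun σ v => by
      have h : ExteriorAlgebra.algebraMapInv (ExteriorAlgebra.map (permRefl σ) v)
          = ExteriorAlgebra.algebraMapInv (R := ℂ) v := by
        change ((ExteriorAlgebra.algebraMapInv (R := ℂ)).comp
          (ExteriorAlgebra.map (permRefl σ))) v = _
        congr 1
        ext w
        simp [ExteriorAlgebra.algebraMapInv]
      rw [LinearMap.smulRight_apply, LinearMap.smulRight_apply, map_smul, sGr_grMk,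
        AlgHom.toLinearMap_apply, AlgHom.toLinearMap_apply, h]
      simp only [hinv]⟩

theorem sGen_one_poly {n : ℕ} {c : ℂ} (σ : Equiv.Perm (Fin n)) :
    sGen c σ • toL n c 1 = toL n c 1 := by
  rw [← toL_smul, sGen_smul_def]
  congr 1
  exact Subtype.ext (map_one (rename σ))

end

end Cherednik

namespace Cherednik

open MvPolynomial

noncomputable section

/-! ### The Euler element -/

section euler

variable {n : ℕ} {c : ℂ}

/-! The proof is Hodge theory for a filtered Koszul complex. Before passing to the associated graded
space, the operator `(dφ)(v) = ∑ x̃_i φ(ẽ_i ∧ v)` already acts on `Hom_{S_n}(Λ^* 𝔥, L_c)` with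
square zero (`diffL`). A homotopy for it is `(sφ)(v) = ∑ ỹ_i φ(ι_i v)` (`htpyL`). By the commutation
relation, the reflection terms of `[y, x]` combine on equivariant maps into `c ∑ (1 - s_{ij})`, and
the Laplacian `ds + sd` is the Euler element plus the exterior degree (`diffL_htpyL_apply`). The
Euler element acts by polynomial degree, so the Laplacian is invertible except on polynomial degree
`0` and exterior degree `0`, where its kernel is spanned by the class of `1`
(`eq_smul_oneL_of_laplL`).

To transfer this to `gr L_c`, the homotopy must lower the filtration by one, just as `d` raises it
by one (`htpyL_mem_filtL`). This is the main point. The Dunkl form makes `x` and `y` adjoint, so by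
duality the claim concerns the Koszul differential on invariants of `R ⊗ Λ^* 𝔥`: it must send
coefficients in `𝔞^j` to coefficients in `𝔞^{j+1}`. Multiplication by symmetric polynomials reduces
this to `j = 0` (`sum_perm_koszul_mem_pow`). Modulo `𝔞`, every invariant form is a combination of
products of the forms `∑_i x̃_i^b ẽ_i`, and the differential replaces a factor by the power sum `∑_i
x̃_i^{b+1}`, which lies in `𝔞` (`sum_koszul_wedge_mem`). The reduction to such products averages
over stabilizers (`mem_adjoinMod_of_invariant`).

Given both shifts, `exists_homotopy` shows that a cycle of `gr` is, modulo a boundary and lower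
filtration, represented by a harmonic element, hence by a multiple of `1`. The class of `1` is not a
boundary: `1` pairs to `1` with itself, while `(x u, 1) = (u, y · 1) = 0`. Its filtration index is
read off from the eigenvalue of `𝐡` on `1`, namely `-(m-1)(n-1)/2`.

No decomposition into homogeneous polynomials is used. It is replaced by `RegularAt`, annihilation
by a polynomial in the operator with nonzero constant term. -/

instance (n : ℕ) (c : ℂ) : IsScalarTower ℂ (CherednikAlg n c) (LRep n c) where
  smul_assoc a h u := by
    obtain ⟨p, rfl⟩ := toL_surjective n c u
    rw [← toL_smul, ← toL_smul, ← map_smul, smul_assoc]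

theorem fourier_yGen (v : Refl n) : fourier n c (yGen c v) = -xGen c v :=
  liftAlg_mk c _ _ (Gen.y v)

theorem fourier_gradingElt : fourier n c (gradingElt n c) = -gradingElt n c := by
  rw [gradingElt, map_smul, map_sum, ← smul_neg, ← Finset.sum_neg_distrib]
  congr 1
  refine Finset.sum_congr rfl fun i _ => ?_
  rw [map_add, map_mul, map_mul, fourier_xGen, fourier_yGen]
  noncomm_ring

/-- This is the Fourier image of `[y, 𝐡] = y`, because `Φ` sends `y` to `-x` and `𝐡` to `-𝐡`. -/
theorem gradingElt_xGen (w : Refl n) :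
    gradingElt n c * xGen c w = xGen c w * gradingElt n c + xGen c w := by
  have h := congrArg (fourier n c) (yGen_gradingElt (c := c) w)
  rw [map_sub, map_mul, map_mul, fourier_yGen, fourier_gradingElt] at h
  have h2 : xGen c w * gradingElt n c - gradingElt n c * xGen c w = - xGen c w := by
    rw [← h]; noncomm_ring
  rw [← neg_inj, ← sub_eq_zero]
  rw [← sub_eq_zero] at h2
  rw [← h2]
  abel

/-- The Euler element `∑ x̃_i ỹ_i + c ∑_{i < j} (1 - s_{ij})`, which acts on `M_c` by the degree. -/
def eulerElt (n : ℕ) (c : ℂ) : CherednikAlg n c :=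
  ∑ i : Fin n, xGen c (eBar i) * yGen c (eBar i)
    + c • ∑ p : Fin n × Fin n with p.1 < p.2, (1 - sGen c (Equiv.swap p.1 p.2))

theorem card_lt_pairs (n : ℕ) :
    2 * ((Finset.univ.filter fun p : Fin n × Fin n => p.1 < p.2).card : ℂ) = n * (n - 1) := by
  have h := sum_sum_eq_sum_lt (n := n) (V := ℂ) (fun i j => if i = j then 0 else 1) (by simp)
  have h2 : ∑ p : Fin n × Fin n with p.1 < p.2,
      ((if p.1 = p.2 then 0 else 1) + (if p.2 = p.1 then 0 else 1) : ℂ)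
      = ∑ p : Fin n × Fin n with p.1 < p.2, 2 := by
    refine Finset.sum_congr rfl fun p hp => ?_
    have hp' : p.1 < p.2 := (Finset.mem_filter.1 hp).2
    rw [if_neg hp'.ne, if_neg hp'.ne']
    norm_num
  rw [h2, Finset.sum_const, nsmul_eq_mul] at h
  rw [mul_comm, ← h]
  have h1 : ∀ i j : Fin n, (if i = j then 0 else 1 : ℂ) = 1 - if i = j then 1 else 0 := by
    intro i j; split_ifs <;> simp
  simp only [h1, Finset.sum_sub_distrib]
  simp [mul_sub]

theorem sum_mul_eBar (v : Refl n) (i : Fin n) : ∑ j, v.1 j * (eBar i).1 j = v.1 i := by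
  have hv : ∑ i, v.1 i = 0 := v.2
  simp [eBar, mul_sub, Finset.sum_sub_distrib, ← Finset.sum_mul, hv]

/-- Reordering gives `𝐡 = ∑ x̃_i ỹ_i + ½ ∑ [ỹ_i, x̃_i]`. The scalar parts of the commutators add up
to `n - 1`, and each transposition occurs twice, from its two moved indices. Writing `-s = (1 - s) -
1` then contributes `-c n(n-1)/2` to the constant. -/
theorem gradingElt_eq (hn : 0 < n) : gradingElt n c
    = eulerElt n c + algebraMap ℂ _ (((n : ℂ) - 1) * (1 - c * n) / 2) := by
  have hn' : (n : ℂ) ≠ 0 := Nat.cast_ne_zero.2 hn.ne'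
  have h1 : ∀ i : Fin n, xGen c (eBar i) * yGen c (eBar i) + yGen c (eBar i) * xGen c (eBar i)
      = (2 : ℂ) • (xGen c (eBar i) * yGen c (eBar i)) + (algebraMap ℂ _ (1 - 1 / (n : ℂ))
        - c • ∑ p : Fin n × Fin n with p.1 < p.2,
          (((if p.1 = i then 1 else 0) - (if p.2 = i then 1 else 0) : ℂ) *
          ((if p.1 = i then 1 else 0) - (if p.2 = i then 1 else 0))) •
            sGen c (Equiv.swap p.1 p.2)) := by
    intro i
    have h := yGen_xGen_eBar (c := c) (eBar i) i
    have e1 : (eBar i).1 i = 1 - 1 / (n : ℂ) := by simp [eBar]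
    have e2 : ∀ p q : Fin n, (eBar i).1 p - (eBar i).1 q
        = (if p = i then 1 else 0) - (if q = i then 1 else 0) := by intro p q; simp [eBar]
    simp only [e2] at h
    rw [e1] at h
    rw [← h, two_smul]
    abel
  have h2 : ∑ i : Fin n, ∑ p : Fin n × Fin n with p.1 < p.2,
          (((if p.1 = i then 1 else 0) - (if p.2 = i then 1 else 0) : ℂ) *
          ((if p.1 = i then 1 else 0) - (if p.2 = i then 1 else 0))) •
            sGen c (Equiv.swap p.1 p.2)
      = (2 : ℂ) • ∑ p : Fin n × Fin n with p.1 < p.2, sGen c (Equiv.swap p.1 p.2) := by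
    rw [Finset.sum_comm, Finset.smul_sum]
    refine Finset.sum_congr rfl fun p hp => ?_
    have hp' : p.1 < p.2 := (Finset.mem_filter.1 hp).2
    rw [← Finset.sum_smul]
    congr 1
    have : ∀ i : Fin n, (((if p.1 = i then 1 else 0) - (if p.2 = i then 1 else 0) : ℂ) *
          ((if p.1 = i then 1 else 0) - (if p.2 = i then 1 else 0)))
        = (if p.1 = i then 1 else 0) + (if p.2 = i then 1 else 0) := by
      intro i
      by_cases h1 : p.1 = i
      · have h2 : p.2 ≠ i := by rw [← h1]; exact hp'.ne'
        simp [h1, h2]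
      · by_cases h2 : p.2 = i <;> simp [h1, h2]
    simp only [this, Finset.sum_add_distrib]
    simp
    norm_num
  rw [gradingElt, Finset.sum_congr rfl fun i _ => h1 i, Finset.sum_add_distrib,
    Finset.sum_sub_distrib, ← Finset.smul_sum, ← Finset.smul_sum, h2, eulerElt,
    Finset.sum_sub_distrib, Finset.sum_const, Finset.sum_const, Finset.card_univ, Fintype.card_fin]
  simp only [Algebra.algebraMap_eq_smul_one, ← Nat.cast_smul_eq_nsmul ℂ]
  generalize ∑ p : Fin n × Fin n with p.1 < p.2, sGen c (Equiv.swap p.1 p.2) = S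
  have hc := card_lt_pairs n
  generalize ((Finset.univ.filter fun p : Fin n × Fin n => p.1 < p.2).card : ℂ) = N at hc
  have hN : N = n * (n - 1) / 2 := by rw [← hc]; ring
  rw [hN]
  match_scalars <;> field_simp <;> ring

theorem eulerElt_xGen (hn : 0 < n) (w : Refl n) :
    eulerElt n c * xGen c w = xGen c w * (eulerElt n c + 1) := by
  have h := gradingElt_xGen (c := c) w
  rw [gradingElt_eq hn, add_mul, mul_add, Algebra.commutes] at h
  rw [mul_add, mul_one]
  exact add_right_cancel (h.trans (by abel))

theorem yGen_smul_one (v : Refl n) : yGen c v • (1 : PolyRep n c) = 0 := by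
  rw [yGen_smul_def]
  refine Subtype.ext ?_
  change ∑ i, v.1 i • dunkl c i (1 : MvPolynomial (Fin n) ℂ) = 0
  refine Finset.sum_eq_zero fun i _ => ?_
  have : dunkl c i (1 : MvPolynomial (Fin n) ℂ) = 0 := by
    rw [dunkl_apply, Finset.sum_eq_zero, ← C_1, pderiv_C, smul_zero, add_zero]
    intro k hk
    rw [← C_1]
    exact divDiff_C (Finset.ne_of_mem_erase hk).symm 1
  rw [this, smul_zero]

theorem sGen_smul_one (σ : Equiv.Perm (Fin n)) : sGen c σ • (1 : PolyRep n c) = 1 := by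
  rw [sGen_smul_def]
  exact Subtype.ext (map_one (rename σ))

theorem eulerElt_smul_one : eulerElt n c • (1 : PolyRep n c) = 0 := by
  rw [eulerElt, add_smul, Finset.sum_smul, smul_assoc, Finset.sum_smul]
  simp only [mul_smul, yGen_smul_one, sub_smul, sGen_smul_one, one_smul, sub_self, smul_zero,
    Finset.sum_const_zero, add_zero]

/-! ### Generation of `M_c` by the linear forms -/

/-- The linear form `x̃_i` as an element of `M_c`. -/
def xLin (n : ℕ) (c : ℂ) (i : Fin n) : PolyRep n c := linForm (eBar i)

theorem xGen_smul_eq (i : Fin n) (p : PolyRep n c) :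
    xGen c (eBar i) • p = xLin n c i * p := by
  rw [xGen_smul_def]; rfl

theorem coe_xLin (i : Fin n) : (diffRing n).val (xLin n c i)
    = X i - C (1 / (n : ℂ)) * ∑ j, X j := by
  change ∑ k, (eBar i).1 k • (X k : MvPolynomial (Fin n) ℂ) = _
  simp only [eBar, sub_smul, ite_smul, one_smul, zero_smul, Finset.sum_sub_distrib,
    Finset.sum_ite_eq', Finset.mem_univ, if_true, smul_eq_C_mul, Finset.mul_sum]

theorem sGen_xLin (σ : Equiv.Perm (Fin n)) (i : Fin n) :
    sGen c σ • xLin n c i = xLin n c (σ i) := by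
  have h := congrArg (· • (1 : PolyRep n c)) (sGen_xGen c σ (eBar i))
  simpa [mul_smul, sGen_smul_one, xGen_smul_eq, permRefl_eBar] using h

/-- The inclusion of `M_c = R` in `ℂ[x₁, …, xₙ]`. -/
def polyVal (n : ℕ) (c : ℂ) : PolyRep n c →ₐ[ℂ] MvPolynomial (Fin n) ℂ := (diffRing n).val

theorem polyVal_injective : Function.Injective (polyVal n c) := Subtype.val_injective

theorem polyVal_xLin (i : Fin n) : polyVal n c (xLin n c i)
    = X i - C (1 / (n : ℂ)) * ∑ j, X j := coe_xLin i

theorem sum_xLin : ∑ i, xLin n c i = 0 := by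
  rcases isEmpty_or_nonempty (Fin n) with h | ⟨⟨o⟩⟩
  · simp
  have hn : (n : ℂ) ≠ 0 := Nat.cast_ne_zero.2 (Nat.pos_iff_ne_zero.1 (Fin.pos o))
  apply polyVal_injective
  rw [map_sum, map_zero]
  simp only [polyVal_xLin, Finset.sum_sub_distrib, Finset.sum_const, Finset.card_univ,
    Fintype.card_fin]
  rw [← smul_eq_C_mul, ← Nat.cast_smul_eq_nsmul ℂ, smul_smul]
  simp [hn]

theorem adjoin_xLin : Algebra.adjoin ℂ (Set.range (xLin n c)) = ⊤ := by
  refine eq_top_iff.2 fun p _ => ?_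
  have h : diffRing n ≤ (Algebra.adjoin ℂ (Set.range (xLin n c))).map (polyVal n c) := by
    refine Algebra.adjoin_le ?_
    rintro _ ⟨i, j, rfl⟩
    refine ⟨xLin n c i - xLin n c j, Subalgebra.sub_mem _ (Algebra.subset_adjoin ⟨i, rfl⟩)
      (Algebra.subset_adjoin ⟨j, rfl⟩), ?_⟩
    change polyVal n c _ = _
    rw [map_sub, polyVal_xLin, polyVal_xLin]
    ring
  obtain ⟨q, hq, e⟩ := h (Subtype.prop p : polyVal n c p ∈ diffRing n)
  rwa [← polyVal_injective e]

/-- Induction along multiplication by linear forms: exactly what is needed for statements that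
propagate through commutation relations with `x`. -/
theorem polyRep_induction {P : PolyRep n c → Prop} (one : P 1)
    (add : ∀ p q, P p → P q → P (p + q)) (smul : ∀ (a : ℂ) p, P p → P (a • p))
    (x : ∀ i p, P p → P (xLin n c i * p)) (p : PolyRep n c) : P p := by
  have h : ∀ q ∈ Algebra.adjoin ℂ (Set.range (xLin n c)), ∀ p, P p → P (q * p) := by
    intro q hq
    induction hq using Algebra.adjoin_induction with
    | mem q hq =>
      obtain ⟨i, rfl⟩ := hq
      exact x i
    | algebraMap a =>
      intro p hp
      rw [← Algebra.smul_def]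
      exact smul a p hp
    | add q r _ _ hq hr =>
      intro p hp
      rw [add_mul]
      exact add _ _ (hq p hp) (hr p hp)
    | mul q r _ _ hq hr =>
      intro p hp
      rw [mul_assoc]
      exact hq _ (hr p hp)
  have := h p (by rw [adjoin_xLin]; trivial) 1 one
  rwa [mul_one] at this

theorem exists_eq_const_add (p : PolyRep n c) :
    ∃ (a : ℂ) (f : Fin n → PolyRep n c), p = a • 1 + ∑ i, xLin n c i * f i := by
  induction p using polyRep_induction with
  | one => exact ⟨1, 0, by simp⟩
  | add p q hp hq =>
    obtain ⟨a, f, rfl⟩ := hp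
    obtain ⟨b, g, rfl⟩ := hq
    refine ⟨a + b, f + g, ?_⟩
    simp only [Pi.add_apply, mul_add, Finset.sum_add_distrib, add_smul]
    abel
  | smul a p hp =>
    obtain ⟨b, f, rfl⟩ := hp
    refine ⟨a * b, a • f, ?_⟩
    simp only [Pi.smul_apply, mul_smul_comm, ← Finset.smul_sum, smul_add, mul_smul]
  | x i p _ =>
    refine ⟨0, Pi.single i p, ?_⟩
    rw [zero_smul, zero_add, Finset.sum_eq_single i]
    · simp
    · intro j _ hj
      simp [Pi.single_eq_of_ne hj]
    · simp

end euler

/-! ### Operators that are invertible on cyclic submodules -/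

section regular

variable {A V : Type*} [Ring A] [Algebra ℂ A] [AddCommGroup V] [Module A V]

/-- `T` is annihilated on `u` by a polynomial with nonzero constant term. -/
def RegularAt (T : A) (u : V) : Prop :=
  ∃ Q : Polynomial ℂ, Q.eval 0 ≠ 0 ∧ Polynomial.aeval T Q • u = 0

theorem RegularAt.add {T : A} {u v : V} (hu : RegularAt T u) (hv : RegularAt T v) :
    RegularAt T (u + v) := by
  obtain ⟨Q, hQ, hu⟩ := hu
  obtain ⟨R, hR, hv⟩ := hv
  refine ⟨Q * R, by rw [Polynomial.eval_mul]; exact mul_ne_zero hQ hR, ?_⟩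
  rw [smul_add, map_mul, mul_smul _ _ v, hv, smul_zero, add_zero,
    (Commute.all Q R).map (Polynomial.aeval T) |>.eq, mul_smul, hu, smul_zero]

theorem RegularAt.zero (T : A) : RegularAt T (0 : V) :=
  ⟨1, by simp, by simp⟩

theorem RegularAt.sum {T : A} {ι : Type*} (s : Finset ι) (u : ι → V)
    (h : ∀ i, RegularAt T (u i)) : RegularAt T (∑ i ∈ s, u i) := by
  classical
  induction s using Finset.induction_on with
  | empty => simpa using RegularAt.zero T
  | insert i s hi ih =>
    rw [Finset.sum_insert hi]
    exact (h i).add ih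

/-- The relation `T S = S T'` extends to polynomials, so the polynomial that works for `T'` on `u`
works for `T` on `S u`. -/
theorem RegularAt.smul_of_intertwine {T T' S : A} (h : T * S = S * T') {u : V}
    (hu : RegularAt T' u) : RegularAt T (S • u) := by
  obtain ⟨Q, hQ, hu⟩ := hu
  refine ⟨Q, hQ, ?_⟩
  have (Q : Polynomial ℂ) : Polynomial.aeval T Q * S = S * Polynomial.aeval T' Q := by
    induction Q using Polynomial.induction_on' with
    | add p q hp hq => rw [map_add, map_add, add_mul, mul_add, hp, hq]
    | monomial k a =>
      have hk : S * T' ^ k = T ^ k * S := SemiconjBy.pow_right (show SemiconjBy S T' T from h.symm) k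
      rw [Polynomial.aeval_monomial, Polynomial.aeval_monomial, mul_assoc, ← hk, ← mul_assoc,
        ← mul_assoc, Algebra.commutes]
  rw [← mul_smul, this, mul_smul, hu, smul_zero]

variable [Module ℂ V] [IsScalarTower ℂ A V]

theorem aeval_smul_of_eigen {T : A} {a : ℂ} {u : V} (h : T • u = a • u) (Q : Polynomial ℂ) :
    Polynomial.aeval T Q • u = Q.eval a • u := by
  induction Q using Polynomial.induction_on' with
  | add p q hp hq => rw [map_add, add_smul, hp, hq, Polynomial.eval_add, add_smul]
  | monomial k b =>
    rw [Polynomial.aeval_monomial, Polynomial.eval_monomial, ← Algebra.smul_def, smul_assoc,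
      mul_smul]
    congr 1
    induction k with
    | zero => simp
    | succ k ih => rw [pow_succ, mul_smul, h, smul_comm, ih, smul_smul, pow_succ, mul_comm]

/-- On the kernel of `T` the polynomial `Q(T)` is the scalar `Q(0)`, which is nonzero. -/
theorem RegularAt.eq_zero {T : A} {u : V} (hu : RegularAt T u) (h : T • u = 0) : u = 0 := by
  obtain ⟨Q, hQ, hu⟩ := hu
  rw [aeval_smul_of_eigen (a := 0) (by rw [h, zero_smul])] at hu
  exact (smul_eq_zero.1 hu).resolve_left hQ

theorem RegularAt.of_eigen {T : A} {a : ℂ} {u : V} (h : T • u = a • u) (ha : a ≠ 0) :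
    RegularAt T u := by
  refine ⟨Polynomial.X - Polynomial.C a, by simpa using ha, ?_⟩
  rw [aeval_smul_of_eigen h]
  simp

theorem RegularAt.smul {T : A} {u : V} (hu : RegularAt T u) (a : ℂ) :
    RegularAt T (a • u) := by
  rw [← one_smul A u, ← smul_assoc]
  refine RegularAt.smul_of_intertwine (T' := T) ?_ hu
  rw [mul_smul_comm, mul_one, smul_mul_assoc, one_mul]

end regular

/-! ### The Euler element on polynomials and the Dunkl form on `L_c` -/

section form

variable {n : ℕ} {c : ℂ}

/-- The Euler element `E` kills `1` and satisfies `(E + k) x = x (E + k + 1)`. Hence the shift only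
grows along the induction, and the eigenvalue met at `1` is a positive integer. -/
theorem regularAt_euler_add (hn : 0 < n) (p : PolyRep n c) :
    ∀ k : ℕ, 0 < k → RegularAt (eulerElt n c + (k : CherednikAlg n c)) p := by
  induction p using polyRep_induction with
  | one =>
    intro k hk
    refine RegularAt.of_eigen (a := k) ?_ (Nat.cast_ne_zero.2 hk.ne')
    rw [add_smul, eulerElt_smul_one, zero_add, ← map_natCast (algebraMap ℂ (CherednikAlg n c)),
      Algebra.algebraMap_eq_smul_one, smul_assoc, one_smul]
  | add p q hp hq => exact fun k hk => (hp k hk).add (hq k hk)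
  | smul a p hp => exact fun k hk => (hp k hk).smul a
  | x i p hp =>
    intro k hk
    rw [← xGen_smul_eq]
    refine RegularAt.smul_of_intertwine ?_ (hp (k + 1) k.succ_pos)
    rw [add_mul, eulerElt_xGen hn, Nat.cast_comm, ← mul_add]
    push_cast
    congr 1
    abel

theorem regularAt_euler_x (hn : 0 < n) (i : Fin n) (p : PolyRep n c) :
    RegularAt (eulerElt n c) (xLin n c i * p) := by
  rw [← xGen_smul_eq]
  refine RegularAt.smul_of_intertwine (eulerElt_xGen hn _) ?_
  simpa using regularAt_euler_add hn p 1 one_pos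

theorem evalZero_mul (p q : PolyRep n c) :
    evalZero n c (p * q) = evalZero n c p * evalZero n c q :=
  map_mul ((aeval (fun _ => (0 : ℂ))).comp (diffRing n).val) p q

theorem evalZero_one : evalZero n c 1 = 1 :=
  map_one ((aeval (fun _ => (0 : ℂ))).comp (diffRing n).val)

theorem evalZero_xLin (i : Fin n) : evalZero n c (xLin n c i) = 0 := by
  change aeval (fun _ => (0 : ℂ)) ((diffRing n).val (xLin n c i)) = 0
  rw [coe_xLin]
  simp

theorem eq_evalZero_add (p : PolyRep n c) : ∃ (f : Fin n → PolyRep n c),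
    p = evalZero n c p • 1 + ∑ i, xLin n c i * f i := by
  obtain ⟨a, f, h⟩ := exists_eq_const_add p
  refine ⟨f, ?_⟩
  have : evalZero n c p = a := by
    rw [h, map_add, map_smul, map_sum, evalZero_one]
    simp [evalZero_mul, evalZero_xLin]
  rwa [this]

theorem eq_top_of_one_mem {N : Submodule (CherednikAlg n c) (PolyRep n c)} (h : 1 ∈ N) :
    N = ⊤ := by
  refine eq_top_iff.2 fun p _ => ?_
  induction p using polyRep_induction with
  | one => exact h
  | add p q hp hq => exact add_mem (hp trivial) (hq trivial)
  | smul a p hp => exact Submodule.smul_of_tower_mem N a (hp trivial)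
  | x i p hp => rw [← xGen_smul_eq]; exact N.smul_mem _ (hp trivial)

/-- The Euler element is regular on the part of `p` without constant term. A suitable polynomial in
it removes that part and keeps a nonzero multiple of the constant term. A submodule containing `p`
with `p(0) ≠ 0` therefore contains `1`, which generates everything. -/
theorem evalZero_of_mem_proper (hn : 0 < n) {N : Submodule (CherednikAlg n c) (PolyRep n c)}
    (hN : N ≠ ⊤) {p : PolyRep n c} (hp : p ∈ N) : evalZero n c p = 0 := by
  by_contra h0
  obtain ⟨f, h⟩ := eq_evalZero_add p
  obtain ⟨Q, hQ, hQ'⟩ := RegularAt.sum Finset.univ (fun i => xLin n c i * f i)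
    (fun i => regularAt_euler_x hn i (f i))
  have h1 := N.smul_mem (Polynomial.aeval (eulerElt n c) Q) hp
  rw [h, smul_add, hQ', add_zero, smul_comm, aeval_smul_of_eigen (a := 0)
    (by rw [eulerElt_smul_one, zero_smul]), smul_smul] at h1
  apply hN
  apply eq_top_of_one_mem
  have h2 := Submodule.smul_of_tower_mem N (evalZero n c p * Q.eval 0)⁻¹ h1
  rwa [smul_smul, inv_mul_cancel₀ (mul_ne_zero h0 hQ), one_smul] at h2

theorem evalZero_of_mem_maxSub (hn : 0 < n) {p : PolyRep n c} (hp : p ∈ maxSub n c) :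
    evalZero n c p = 0 := by
  -- Vanishing at `0` does not itself define a submodule. `Z` is the largest submodule on which it
  -- holds, so it contains every proper submodule and hence their sum.
  let Z : Submodule (CherednikAlg n c) (PolyRep n c) :=
    { carrier := {p | ∀ h : CherednikAlg n c, evalZero n c (h • p) = 0}
      add_mem' := fun {p q} hp hq h => by rw [smul_add, map_add, hp, hq, add_zero]
      zero_mem' := fun h => by rw [smul_zero, map_zero]
      smul_mem' := fun g p hp h => by rw [← mul_smul]; exact hp _ }
  have hZ : maxSub n c ≤ Z := sSup_le fun N hN p hp h =>
    evalZero_of_mem_proper hn hN (N.smul_mem h hp)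
  simpa using hZ hp 1

theorem dunklForm_one (p : PolyRep n c) : dunklForm n c 1 p = evalZero n c p := by
  rw [dunklForm_apply, show (diffRing n).val (1 : PolyRep n c) = 1 from rfl, map_one, map_one,
    one_smul]

theorem dunklForm_sGen_left (σ : Equiv.Perm (Fin n)) (f g : PolyRep n c) :
    dunklForm n c (sGen c σ • f) g = dunklForm n c f (sGen c σ⁻¹ • g) := by
  rw [← dunklForm_sGen σ f, ← mul_smul, ← sGen_mul, mul_inv_cancel, sGen_one, one_smul]

/-- The bracket formula is symmetric in `v` and `w`, and transpositions are self-adjoint for the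
form. -/
theorem dunklForm_bracket (v w : Refl n) (f g : PolyRep n c) :
    dunklForm n c ((yGen c v * xGen c w - xGen c w * yGen c v) • f) g
      = dunklForm n c f ((yGen c w * xGen c v - xGen c v * yGen c w) • g) := by
  rw [yGen_xGen, yGen_xGen, sub_smul, sub_smul, map_sub, map_sub, LinearMap.sub_apply]
  congr 1
  · simp only [Algebra.algebraMap_eq_smul_one, smul_assoc, one_smul, map_smul,
      LinearMap.smul_apply, mul_comm]
  · simp only [smul_assoc, Finset.sum_smul, map_smul, map_sum, LinearMap.smul_apply,
      LinearMap.sum_apply, dunklForm_sGen_left, Equiv.swap_inv]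
    congr 1
    exact Finset.sum_congr rfl fun p _ => by rw [mul_comm]

/-- For `f = 1` both sides vanish. In the induction step, `y` is moved past `x̃_i`, the bracket is
handled by `dunklForm_bracket`, and the adjointness of `x` to `y` holds by definition of the form.
-/
theorem dunklForm_yGen (v : Refl n) (f g : PolyRep n c) :
    dunklForm n c (yGen c v • f) g = dunklForm n c f (xGen c v • g) := by
  induction f using polyRep_induction generalizing v g with
  | one =>
    rw [yGen_smul_one, map_zero, LinearMap.zero_apply, dunklForm_one, xGen_smul_def]
    let q : PolyRep n c := linForm v
    change 0 = evalZero n c (q * g)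
    rw [evalZero_mul]
    have : evalZero n c q = 0 := by
      change aeval (fun _ => (0 : ℂ)) (∑ k, v.1 k • (X k : MvPolynomial (Fin n) ℂ)) = 0
      simp
    rw [this, zero_mul]
  | add p q hp hq => rw [smul_add, map_add, LinearMap.add_apply, hp, hq, map_add,
      LinearMap.add_apply]
  | smul a p hp => rw [smul_comm (yGen c v) a, LinearMap.map_smul, LinearMap.smul_apply, hp,
      LinearMap.map_smul, LinearMap.smul_apply]
  | x i p hp =>
    have h1 := dunklForm_bracket v (eBar i) p g
    rw [sub_smul, sub_smul, map_sub, map_sub, LinearMap.sub_apply, sub_eq_iff_eq_add, mul_smul,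
      mul_smul, mul_smul, mul_smul, dunklForm_xGen _ (yGen c v • p), hp] at h1
    rw [← xGen_smul_eq, h1, dunklForm_xGen]
    ring

theorem dunklForm_comm (f g : PolyRep n c) : dunklForm n c f g = dunklForm n c g f := by
  induction f using polyRep_induction generalizing g with
  | one =>
    induction g using polyRep_induction with
    | one => rfl
    | add p q hp hq => rw [map_add, map_add, LinearMap.add_apply, hp, hq]
    | smul a p hp => rw [map_smul, map_smul, LinearMap.smul_apply, hp]
    | x i p hp => rw [← xGen_smul_eq, dunklForm_xGen, yGen_smul_one, ← dunklForm_yGen,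
        yGen_smul_one, map_zero, map_zero, LinearMap.zero_apply]
  | add p q hp hq => rw [map_add, map_add, LinearMap.add_apply, hp, hq]
  | smul a p hp => rw [map_smul, map_smul, LinearMap.smul_apply, hp]
  | x i p hp => rw [← xGen_smul_eq, dunklForm_xGen, hp, dunklForm_yGen]

theorem dunklForm_of_mem_maxSub (hn : 0 < n) (f : PolyRep n c) {g : PolyRep n c}
    (hg : g ∈ maxSub n c) : dunklForm n c f g = 0 :=
  evalZero_of_mem_maxSub hn ((maxSub n c).smul_mem _ hg)

theorem toL_eq_iff {f g : PolyRep n c} : toL n c f = toL n c g ↔ f - g ∈ maxSub n c :=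
  Submodule.Quotient.eq _

/-- The radical contains `maxSub` on the right, since that is a submodule of polynomials vanishing
at `0`, and on the left by symmetry. This is all that descent to `L_c` requires. -/
theorem dunklForm_congr (hn : 0 < n) {f f' g g' : PolyRep n c} (hf : toL n c f = toL n c f')
    (hg : toL n c g = toL n c g') : dunklForm n c f g = dunklForm n c f' g' := by
  have h1 := dunklForm_of_mem_maxSub hn f (toL_eq_iff.1 hg)
  have h2 := dunklForm_of_mem_maxSub hn g' (toL_eq_iff.1 hf)
  rw [map_sub, sub_eq_zero] at h1 h2
  rw [h1, dunklForm_comm, h2, dunklForm_comm]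

/-- The form that the Dunkl form induces on `L_c`. -/
def formL (hn : 0 < n) : LRep n c →ₗ[ℂ] LRep n c →ₗ[ℂ] ℂ :=
  LinearMap.mk₂ ℂ (fun u w => dunklForm n c (Function.surjInv (toL_surjective n c) u)
      (Function.surjInv (toL_surjective n c) w))
    (fun u u' w => by
      rw [← LinearMap.add_apply, ← map_add]
      exact dunklForm_congr hn (by simp [Function.surjInv_eq]) rfl)
    (fun a u w => by
      rw [← LinearMap.smul_apply, ← map_smul]
      exact dunklForm_congr hn (by simp [Function.surjInv_eq]) rfl)
    (fun u w w' => by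
      rw [← map_add]
      exact dunklForm_congr hn rfl (by simp [Function.surjInv_eq]))
    (fun a u w => by
      rw [← map_smul]
      exact dunklForm_congr hn rfl (by simp [Function.surjInv_eq]))

theorem formL_toL (hn : 0 < n) (f g : PolyRep n c) :
    formL hn (toL n c f) (toL n c g) = dunklForm n c f g :=
  dunklForm_congr hn (Function.surjInv_eq _ _) (Function.surjInv_eq _ _)

theorem mem_algFilt_iff (hn : 0 < n) {i : ℤ} {u : LRep n c} :
    u ∈ algFilt n c i ↔ ∀ w ∈ decFilt n c i, formL hn u w = 0 := by
  constructor
  · rintro ⟨f, hf, rfl⟩ w hw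
    obtain ⟨g, rfl⟩ := toL_surjective n c w
    rw [formL_toL]
    exact hf g hw
  · intro h
    obtain ⟨f, rfl⟩ := toL_surjective n c u
    exact ⟨f, fun g hg => by rw [← formL_toL hn]; exact h _ hg, rfl⟩

theorem formL_yGen (hn : 0 < n) (v : Refl n) (u w : LRep n c) :
    formL hn (yGen c v • u) w = formL hn u (xGen c v • w) := by
  obtain ⟨f, rfl⟩ := toL_surjective n c u
  obtain ⟨g, rfl⟩ := toL_surjective n c w
  rw [← toL_smul, ← toL_smul, formL_toL, formL_toL, dunklForm_yGen]

theorem formL_xGen (hn : 0 < n) (v : Refl n) (u w : LRep n c) :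
    formL hn (xGen c v • u) w = formL hn u (yGen c v • w) := by
  obtain ⟨f, rfl⟩ := toL_surjective n c u
  obtain ⟨g, rfl⟩ := toL_surjective n c w
  rw [← toL_smul, ← toL_smul, formL_toL, formL_toL, dunklForm_xGen]

theorem formL_sGen (hn : 0 < n) (σ : Equiv.Perm (Fin n)) (u w : LRep n c) :
    formL hn (sGen c σ • u) (sGen c σ • w) = formL hn u w := by
  obtain ⟨f, rfl⟩ := toL_surjective n c u
  obtain ⟨g, rfl⟩ := toL_surjective n c w
  rw [← toL_smul, ← toL_smul, formL_toL, formL_toL, dunklForm_sGen]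

end form

/-! ### Polynomials with a large stabilizer -/

section stabilizer

variable {n : ℕ} {c : ℂ}

/-- The action of a permutation on `M_c`, as an algebra homomorphism. -/
def permAlg (n : ℕ) (c : ℂ) (σ : Equiv.Perm (Fin n)) : PolyRep n c →ₐ[ℂ] PolyRep n c :=
  AlgHom.ofLinearMap
    { toFun := fun p => sGen c σ • p
      map_add' := smul_add _
      map_smul' := fun a p => smul_comm _ a p }
    (sGen_smul_one σ) (sGen_mul_poly σ)

theorem permAlg_apply (σ : Equiv.Perm (Fin n)) (p : PolyRep n c) :
    permAlg n c σ p = sGen c σ • p := rfl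

theorem permAlg_xLin (σ : Equiv.Perm (Fin n)) (i : Fin n) :
    permAlg n c σ (xLin n c i) = xLin n c (σ i) := sGen_xLin σ i

theorem permAlg_mul (σ τ : Equiv.Perm (Fin n)) (p : PolyRep n c) :
    permAlg n c (σ * τ) p = permAlg n c σ (permAlg n c τ p) := by
  simp only [permAlg_apply, sGen_mul, mul_smul]

theorem permAlg_mem_symIdeal (σ : Equiv.Perm (Fin n)) {p : PolyRep n c}
    (hp : p ∈ symIdeal n c) : permAlg n c σ p ∈ symIdeal n c := by
  have := sGen_symIdeal_pow σ 1 p (by rwa [pow_one])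
  rwa [pow_one] at this

theorem powerSum_mem_symIdeal (b : ℕ) : ∑ i, xLin n c i ^ (b + 1) ∈ symIdeal n c := by
  refine Ideal.subset_span ⟨fun σ => ?_, ?_⟩
  · rw [← permAlg_apply, map_sum, ← Equiv.sum_comp σ (fun i => xLin n c i ^ (b + 1))]
    simp only [map_pow, permAlg_xLin]
  · rw [map_sum]
    refine Finset.sum_eq_zero fun i _ => ?_
    rw [pow_succ, evalZero_mul, evalZero_xLin, mul_zero]

/-- The polynomials in the `x̃_i` with `i ∈ A`, modulo symmetric polynomials of positive degree. -/
def adjoinMod (n : ℕ) (c : ℂ) (A : Finset (Fin n)) : Submodule ℂ (PolyRep n c) :=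
  Subalgebra.toSubmodule (Algebra.adjoin ℂ (xLin n c '' A)) ⊔ (symIdeal n c).restrictScalars ℂ

/-- A power sum over the complement of `A` is the full power sum, which lies in the ideal, minus the
power sum over `A`. Exponent `0` is separate, as the full sum is then a constant. -/
theorem sum_compl_pow_mem_adjoinMod (A : Finset (Fin n)) (b : ℕ) (g : PolyRep n c)
    (hg : g ∈ Algebra.adjoin ℂ (xLin n c '' A)) :
    ∑ i ∈ Aᶜ, g * xLin n c i ^ b ∈ adjoinMod n c A := by
  rcases b with _ | b
  · simp only [pow_zero, mul_one, Finset.sum_const]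
    exact nsmul_mem (Submodule.mem_sup_left hg) _
  · have h := Finset.sum_add_sum_compl A (fun i => xLin n c i ^ (b + 1))
    rw [← Finset.mul_sum, eq_sub_of_add_eq' h, mul_sub]
    refine sub_mem (Submodule.mem_sup_right (Ideal.mul_mem_left _ _ (powerSum_mem_symIdeal b)))
      (Submodule.mem_sup_left ?_)
    rw [Subalgebra.mem_toSubmodule]
    exact mul_mem hg (sum_mem fun i hi => pow_mem (Algebra.subset_adjoin (Set.mem_image_of_mem _ (Finset.mem_coe.2 hi))) _)

theorem permAlg_of_mem_adjoin (A : Finset (Fin n)) (σ : Equiv.Perm (Fin n))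
    (hσ : ∀ i ∈ A, σ i = i) {g : PolyRep n c} (hg : g ∈ Algebra.adjoin ℂ (xLin n c '' A)) :
    permAlg n c σ g = g := by
  have : Algebra.adjoin ℂ (xLin n c '' A) ≤ AlgHom.equalizer (permAlg n c σ) (AlgHom.id ℂ _) := by
    refine Algebra.adjoin_le ?_
    rintro _ ⟨i, hi, rfl⟩
    change permAlg n c σ (xLin n c i) = xLin n c i
    rw [permAlg_xLin, hσ i hi]
  exact this hg

/-- Expanded in powers of `x̃_t` with coefficients in the variables of `A`, the swaps spread
`x̃_t^b` over the complement of `A` and fix the coefficients. The result is a sum of the kind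
treated in `sum_compl_pow_mem_adjoinMod`. -/
theorem sum_swap_mem_adjoinMod (A : Finset (Fin n)) {t : Fin n} (ht : t ∉ A) (g : PolyRep n c)
    (hg : g ∈ Algebra.adjoin ℂ (xLin n c '' (insert t A : Finset (Fin n)))) :
    ∑ i ∈ Aᶜ, permAlg n c (Equiv.swap t i) g ∈ adjoinMod n c A := by
  have hm : ∀ m ∈ Submonoid.closure (xLin n c '' (insert t A : Finset (Fin n))),
      ∃ q ∈ Algebra.adjoin ℂ (xLin n c '' A), ∃ b : ℕ, m = q * xLin n c t ^ b := by
    intro m hm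
    induction hm using Submonoid.closure_induction with
    | one => exact ⟨1, one_mem _, 0, by simp⟩
    | mem m hm =>
      obtain ⟨i, hi, rfl⟩ := hm
      rcases Finset.mem_insert.1 (Finset.mem_coe.1 hi) with rfl | hi
      · exact ⟨1, one_mem _, 1, by simp⟩
      · exact ⟨_, Algebra.subset_adjoin ⟨i, hi, rfl⟩, 0, by simp⟩
    | mul m m' _ _ h h' =>
      obtain ⟨q, hq, b, rfl⟩ := h
      obtain ⟨q', hq', b', rfl⟩ := h'
      exact ⟨q * q', mul_mem hq hq', b + b', by ring⟩
  rw [← Subalgebra.mem_toSubmodule, Algebra.adjoin_eq_span] at hg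
  induction hg using Submodule.span_induction with
  | zero => simp
  | add p q _ _ hp hq =>
    simp only [map_add, Finset.sum_add_distrib]
    exact add_mem hp hq
  | smul a p _ hp =>
    simp only [map_smul, ← Finset.smul_sum]
    exact Submodule.smul_mem _ _ hp
  | mem m h =>
    obtain ⟨q, hq, b, rfl⟩ := hm m h
    rw [Finset.sum_congr rfl (g := fun i => q * xLin n c i ^ b)]
    · exact sum_compl_pow_mem_adjoinMod A b q hq
    · intro i hi
      rw [map_mul, map_pow, permAlg_xLin, Equiv.swap_apply_left, permAlg_of_mem_adjoin A _ _ hq]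
      intro j hj
      refine Equiv.swap_apply_of_ne_of_ne ?_ ?_
      · rintro rfl; exact ht hj
      · rintro rfl; exact Finset.mem_compl.1 hi hj

/-- A polynomial that is fixed by all permutations that fix `A` pointwise is a polynomial in the
`x̃_i` with `i ∈ A`, modulo symmetric polynomials of positive degree. -/
theorem mem_adjoinMod_of_invariant (A : Finset (Fin n)) (f : PolyRep n c)
    (hf : ∀ σ : Equiv.Perm (Fin n), (∀ i ∈ A, σ i = i) → permAlg n c σ f = f) :
    f ∈ adjoinMod n c A := by
  induction hk : Aᶜ.card generalizing A with
  | zero =>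
    rw [Finset.card_eq_zero, Finset.compl_eq_empty_iff] at hk
    subst hk
    refine Submodule.mem_sup_left ?_
    rw [Finset.coe_univ, Set.image_univ, adjoin_xLin]
    trivial
  | succ k ih =>
    obtain ⟨t, ht⟩ : Aᶜ.Nonempty := Finset.card_pos.1 (by omega)
    have ht' : t ∉ A := Finset.mem_compl.1 ht
    have h1 := ih (insert t A) (fun σ hσ => hf σ fun i hi => hσ i (Finset.mem_insert_of_mem hi))
      (by rw [Finset.compl_insert, Finset.card_erase_of_mem ht, hk]; rfl)
    obtain ⟨g, hg, q, hq, rfl⟩ := Submodule.mem_sup.1 h1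
    -- The swaps of `t` with the indices outside `A` fix the invariant polynomial `g + q`, so
    -- averaging over them changes nothing. On `g` the same average eliminates the variable `x̃_t`.
    -- The term `i = t` is the identity.
    have h2 : ∑ i ∈ Aᶜ, permAlg n c (Equiv.swap t i) (g + q) = ((k + 1 : ℕ) : ℂ) • (g + q) := by
      rw [Finset.sum_congr rfl (g := fun _ => g + q), Finset.sum_const, hk, Nat.cast_smul_eq_nsmul]
      intro i hi
      refine hf _ fun j hj => Equiv.swap_apply_of_ne_of_ne ?_ ?_
      · rintro rfl; exact ht' hj
      · rintro rfl; exact Finset.mem_compl.1 hi hj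
    have h3 : ((k + 1 : ℕ) : ℂ) ≠ 0 := Nat.cast_ne_zero.2 k.succ_ne_zero
    rw [← Submodule.smul_mem_iff _ h3, ← h2]
    simp only [map_add, Finset.sum_add_distrib]
    exact add_mem (sum_swap_mem_adjoinMod A ht' g hg)
      (Submodule.mem_sup_right (sum_mem fun i _ => permAlg_mem_symIdeal _ hq))

end stabilizer

/-! ### The exterior algebra of the reflection representation -/

section exterior

variable {n : ℕ} {c : ℂ}

/-- The `i`-th coordinate on `𝔥`. -/
def coordDual {n : ℕ} (i : Fin n) : Module.Dual ℂ (Refl n) :=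
  (LinearMap.proj i).comp (Refl n).subtype

/-- Contraction of `Λ^* 𝔥` with the `i`-th coordinate. -/
def contract {n : ℕ} (i : Fin n) : ExteriorAlgebra ℂ (Refl n) →ₗ[ℂ] ExteriorAlgebra ℂ (Refl n) :=
  CliffordAlgebra.contractLeft (Q := (0 : QuadraticForm ℂ (Refl n))) (coordDual i)

theorem contract_one (i : Fin n) : contract i 1 = 0 :=
  CliffordAlgebra.contractLeft_one _ _

theorem contract_ι_mul (i : Fin n) (w : Refl n) (v : ExteriorAlgebra ℂ (Refl n)) :
    contract i (ExteriorAlgebra.ι ℂ w * v) = w.1 i • v - ExteriorAlgebra.ι ℂ w * contract i v :=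
  CliffordAlgebra.contractLeft_ι_mul _ _ _

/-- The product of the vectors `ẽ_{a_j}` in `Λ^* 𝔥`. -/
def wedge {n k : ℕ} (a : Fin k → Fin n) : ExteriorAlgebra ℂ (Refl n) :=
  ExteriorAlgebra.ιMulti ℂ k fun j => (eBar (a j) : Refl n)

theorem wedge_zero (a : Fin 0 → Fin n) : wedge a = 1 :=
  ExteriorAlgebra.ιMulti_zero_apply _

theorem wedge_cons {k : ℕ} (i : Fin n) (a : Fin k → Fin n) :
    wedge (Fin.cons i a : Fin (k + 1) → Fin n) = ExteriorAlgebra.ι ℂ (eBar i) * wedge a := by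
  rw [wedge, ExteriorAlgebra.ιMulti_succ_apply]
  rfl

theorem wedge_of_not_injective {k : ℕ} (a : Fin k → Fin n) (ha : ¬ Function.Injective a) :
    wedge a = 0 :=
  AlternatingMap.map_eq_zero_of_not_injective _ _
    fun h => ha (Function.Injective.of_comp (f := fun i => (eBar i : Refl n)) h)

theorem map_permRefl_wedge {k : ℕ} (σ : Equiv.Perm (Fin n)) (a : Fin k → Fin n) :
    ExteriorAlgebra.map (permRefl σ) (wedge a) = wedge (σ ∘ a) := by
  rw [wedge, ExteriorAlgebra.map_apply_ιMulti, wedge]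
  congr 1
  funext j
  exact permRefl_eBar σ (a j)

theorem span_wedge : Submodule.span ℂ (Set.range fun a : (Σ k : ℕ, Fin k → Fin n) => wedge a.2)
    = ⊤ := by
  refine Submodule.eq_top_iff'.2 fun v => ?_
  induction v using CliffordAlgebra.left_induction with
  | algebraMap r =>
    rw [Algebra.algebraMap_eq_smul_one]
    refine Submodule.smul_mem _ _ (Submodule.subset_span ⟨⟨0, Fin.elim0⟩, wedge_zero _⟩)
  | add x y hx hy => exact add_mem hx hy
  | ι_mul v w hv =>
    rw [← sum_smul_eBar w, map_sum, Finset.sum_mul]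
    refine sum_mem fun i _ => ?_
    rw [map_smul, smul_mul_assoc]
    refine Submodule.smul_mem _ _ ?_
    induction hv using Submodule.span_induction with
    | zero => rw [mul_zero]; exact zero_mem _
    | add x y _ _ hx hy => rw [mul_add]; exact add_mem hx hy
    | smul a x _ hx => rw [mul_smul_comm]; exact Submodule.smul_mem _ _ hx
    | mem x hx =>
      obtain ⟨⟨k, a⟩, rfl⟩ := hx
      exact Submodule.subset_span ⟨⟨k + 1, Fin.cons i a⟩, wedge_cons i a⟩

/-- Products with a repeated index vanish, which leaves finitely many spanning products, of length
at most `n`. -/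
instance (n : ℕ) : Module.Finite ℂ (ExteriorAlgebra ℂ (Refl n)) := by
  rw [Module.finite_def, ← span_wedge]
  have h : (Set.range fun a : (Σ k : ℕ, Fin k → Fin n) => wedge a.2)
      ⊆ insert 0 (Set.range fun a : (Σ k : Fin (n + 1), Fin k → Fin n) => wedge a.2) := by
    rintro _ ⟨⟨k, a⟩, rfl⟩
    by_cases ha : Function.Injective a
    · have hk : k ≤ n := by simpa using Fintype.card_le_of_injective a ha
      exact Set.mem_insert_of_mem _ ⟨⟨⟨k, by omega⟩, a⟩, rfl⟩
    · exact Or.inl (wedge_of_not_injective a ha)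
  exact Submodule.fg_span (((Set.finite_range _).insert _).subset h)

end exterior

/-! ### Invariant forms and the Koszul differential -/

section koszul

variable {n : ℕ} {c : ℂ}

theorem sum_eBar_smul_xLin (i : Fin n) : ∑ l, (eBar i).1 l • xLin n c l = xLin n c i := by
  have h : ∑ l, (1 / (n : ℂ)) • xLin n c l = 0 := by rw [← Finset.smul_sum, sum_xLin, smul_zero]
  simp only [eBar, sub_smul, Finset.sum_sub_distrib, h, ite_smul, one_smul, zero_smul,
    Finset.sum_ite_eq', Finset.mem_univ, if_true, sub_zero]

/-- The component along `λ` of the Koszul differential of `f ⊗ v`. -/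
def koszul (lam : Module.Dual ℂ (ExteriorAlgebra ℂ (Refl n))) (f : PolyRep n c)
    (v : ExteriorAlgebra ℂ (Refl n)) : PolyRep n c :=
  ∑ l, lam (contract l v) • (xLin n c l * f)

/-- The antiderivation rule of contraction: removing the new factor `ẽ_i` produces `x̃_i`, and the
other terms form the differential of the shorter product, with `ẽ_i ∧` absorbed into the functional.
This is why `λ` is kept arbitrary in the inductions. -/
theorem koszul_ι_mul (lam : Module.Dual ℂ (ExteriorAlgebra ℂ (Refl n))) (f : PolyRep n c)
    (i : Fin n) (v : ExteriorAlgebra ℂ (Refl n)) :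
    koszul lam f (ExteriorAlgebra.ι ℂ (eBar i) * v) = lam v • (xLin n c i * f)
      - koszul (lam ∘ₗ LinearMap.mulLeft ℂ (ExteriorAlgebra.ι ℂ (eBar i))) f v := by
  simp only [koszul, contract_ι_mul, map_sub, map_smul, sub_smul, Finset.sum_sub_distrib]
  congr 1
  conv_rhs => rw [← sum_eBar_smul_xLin, Finset.sum_mul, Finset.smul_sum]
  refine Finset.sum_congr rfl fun l _ => ?_
  rw [smul_mul_assoc, smul_smul, smul_eq_mul, mul_comm]

theorem koszul_mul (lam : Module.Dual ℂ (ExteriorAlgebra ℂ (Refl n))) (q f : PolyRep n c)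
    (v : ExteriorAlgebra ℂ (Refl n)) : koszul lam (q * f) v = q * koszul lam f v := by
  simp only [koszul, Finset.mul_sum, mul_smul_comm, mul_left_comm q]

theorem koszul_add (lam : Module.Dual ℂ (ExteriorAlgebra ℂ (Refl n))) (f g : PolyRep n c)
    (v : ExteriorAlgebra ℂ (Refl n)) : koszul lam (f + g) v = koszul lam f v + koszul lam g v := by
  simp only [koszul, mul_add, smul_add, Finset.sum_add_distrib]

theorem koszul_smul (lam : Module.Dual ℂ (ExteriorAlgebra ℂ (Refl n))) (a : ℂ) (f : PolyRep n c)
    (v : ExteriorAlgebra ℂ (Refl n)) : koszul lam (a • f) v = a • koszul lam f v := by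
  rw [← smul_one_mul, koszul_mul, smul_one_mul]

theorem koszul_mem_symIdeal (lam : Module.Dual ℂ (ExteriorAlgebra ℂ (Refl n))) {f : PolyRep n c}
    (hf : f ∈ symIdeal n c) (v : ExteriorAlgebra ℂ (Refl n)) :
    koszul lam f v ∈ symIdeal n c := by
  rw [← mul_one f, koszul_mul]
  exact Ideal.mul_mem_right _ _ hf

/-- Summed over all tuples, including those with repetitions, the form factors as the product of the
one-forms `∑_i x̃_i^{b_j} ẽ_i`. The differential turns one factor into the power sum of exponent
`b_j + 1 > 0`, an element of the ideal. -/
theorem sum_koszul_wedge_mem {k : ℕ} (b : Fin k → ℕ)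
    (lam : Module.Dual ℂ (ExteriorAlgebra ℂ (Refl n))) :
    ∑ a : Fin k → Fin n, koszul lam (∏ j, xLin n c (a j) ^ b j) (wedge a) ∈ symIdeal n c := by
  induction k generalizing lam with
  | zero =>
    refine sum_mem fun a _ => ?_
    rw [wedge_zero, koszul]
    simp [contract_one]
  | succ k ih =>
    rw [← Equiv.sum_comp (Fin.consEquiv fun _ => Fin n), Fintype.sum_prod_type]
    have h1 : ∀ (i : Fin n) (a : Fin k → Fin n),
        koszul lam (∏ j, xLin n c ((Fin.consEquiv fun _ => Fin n) (i, a) j) ^ b j)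
          (wedge ((Fin.consEquiv fun _ => Fin n) (i, a)))
        = xLin n c i ^ (b 0 + 1) * (lam (wedge a) • ∏ j, xLin n c (a j) ^ b j.succ)
          - xLin n c i ^ b 0 * koszul (lam ∘ₗ LinearMap.mulLeft ℂ (ExteriorAlgebra.ι ℂ (eBar i)))
            (∏ j, xLin n c (a j) ^ b j.succ) (wedge a) := by
      intro i a
      change koszul lam (∏ j, xLin n c ((Fin.cons i a : Fin (k + 1) → Fin n) j) ^ b j)
        (wedge (Fin.cons i a : Fin (k + 1) → Fin n)) = _
      rw [wedge_cons, koszul_ι_mul, Fin.prod_univ_succ]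
      simp only [Fin.cons_zero, Fin.cons_succ]
      rw [koszul_mul, mul_smul_comm, pow_succ']
      congr 2
      ring
    simp only [h1, Finset.sum_sub_distrib]
    refine sub_mem ?_ ?_
    · rw [Finset.sum_comm]
      refine sum_mem fun a _ => ?_
      rw [← Finset.sum_mul]
      exact Ideal.mul_mem_right _ _ (powerSum_mem_symIdeal _)
    · refine sum_mem fun i _ => ?_
      rw [← Finset.mul_sum]
      exact Ideal.mul_mem_left _ _ (ih _ _)

theorem exists_perm_comp_eq {k : ℕ} {a a' : Fin k → Fin n} (ha : Function.Injective a)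
    (ha' : Function.Injective a') : ∃ σ : Equiv.Perm (Fin n), σ ∘ a = a' := by
  classical
  let e : {i // i ∈ Set.range a} ≃ {i // i ∈ Set.range a'} :=
    (Equiv.ofInjective a ha).symm.trans (Equiv.ofInjective a' ha')
  refine ⟨e.extendSubtype, funext fun j => ?_⟩
  rw [Function.comp_apply, Equiv.extendSubtype_apply_of_mem e _ ⟨j, rfl⟩]
  have : (Equiv.ofInjective a ha).symm ⟨a j, ⟨j, rfl⟩⟩ = j := Equiv.ofInjective_symm_apply ha j
  simp [e, this]

/-- Orbit counting: `S_n` is transitive on injective tuples, and `N` is the order of the stabilizer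
of `a`. The hypothesis `h0` allows the sum to run over all tuples, which is what makes it factor in
`sum_koszul_wedge_mem`. -/
theorem sum_perm_comp_eq {k : ℕ} {V : Type*} [AddCommMonoid V] (a : Fin k → Fin n)
    (ha : Function.Injective a) (h : (Fin k → Fin n) → V)
    (h0 : ∀ a', ¬ Function.Injective a' → h a' = 0) :
    ∃ N : ℕ, ∑ σ : Equiv.Perm (Fin n), h (σ ∘ a) = N • ∑ a', h a' := by
  classical
  refine ⟨(Finset.univ.filter fun σ : Equiv.Perm (Fin n) => σ ∘ a = a).card, ?_⟩
  rw [← Finset.sum_fiberwise (s := Finset.univ)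
    (g := fun σ : Equiv.Perm (Fin n) => (σ ∘ a : Fin k → Fin n)), Finset.smul_sum]
  refine Finset.sum_congr rfl fun a' _ => ?_
  rw [Finset.sum_congr rfl (g := fun _ => h a')
    (fun σ hσ => congrArg h (Finset.mem_filter.1 hσ).2), Finset.sum_const]
  by_cases ha' : Function.Injective a'
  · obtain ⟨τ, rfl⟩ := exists_perm_comp_eq ha ha'
    congr 1
    refine Finset.card_bij (fun σ _ => τ⁻¹ * σ) ?_ ?_ ?_
    · intro σ hσ
      simp only [Finset.mem_filter, Finset.mem_univ, true_and] at hσ ⊢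
      rw [Equiv.Perm.coe_mul, Function.comp_assoc, hσ, ← Function.comp_assoc,
        ← Equiv.Perm.coe_mul, inv_mul_cancel]
      rfl
    · intro σ _ σ' _ e
      exact mul_left_cancel e
    · intro σ hσ
      simp only [Finset.mem_filter, Finset.mem_univ, true_and] at hσ
      refine ⟨τ * σ, ?_, by simp⟩
      simp only [Finset.mem_filter, Finset.mem_univ, true_and]
      rw [Equiv.Perm.coe_mul, Function.comp_assoc, hσ]
  · rw [h0 a' ha', smul_zero, smul_zero]

/-- When the coefficient involves only the variables indexed by the tuple, each of its monomials
attaches one power to each wedge factor. The symmetrization is then a multiple of the full sum over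
tuples. -/
theorem sum_perm_koszul_wedge_mem_of_adjoin
    (lam : Module.Dual ℂ (ExteriorAlgebra ℂ (Refl n))) {k : ℕ} (a : Fin k → Fin n)
    (ha : Function.Injective a) {g : PolyRep n c}
    (hg : g ∈ Algebra.adjoin ℂ (Set.range (xLin n c ∘ a))) :
    ∑ σ : Equiv.Perm (Fin n), koszul lam (permAlg n c σ g) (wedge (σ ∘ a)) ∈ symIdeal n c := by
  rw [Algebra.adjoin_range_eq_range_aeval] at hg
  obtain ⟨G, rfl⟩ := hg
  induction G using MvPolynomial.induction_on' with
  | add p q hp hq =>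
    have : ∀ σ, permAlg n c σ ((aeval (xLin n c ∘ a)).toRingHom (p + q))
      = permAlg n c σ ((aeval (xLin n c ∘ a)).toRingHom p)
        + permAlg n c σ ((aeval (xLin n c ∘ a)).toRingHom q) := by
      intro σ
      rw [map_add, map_add]
    simp only [this, koszul_add, Finset.sum_add_distrib]
    exact add_mem hp hq
  | monomial b r =>
    have h : ∀ σ : Equiv.Perm (Fin n), permAlg n c σ
        ((aeval (xLin n c ∘ a)).toRingHom (monomial b r))
        = r • ∏ j, xLin n c ((σ ∘ a) j) ^ b j := by
      intro σ
      change permAlg n c σ (aeval (xLin n c ∘ a) (monomial b r)) = _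
      rw [aeval_monomial, ← Algebra.smul_def, map_smul, Finsupp.prod_fintype _ _ (by simp),
        map_prod]
      simp only [map_pow, Function.comp_apply, permAlg_xLin]
    simp only [h, koszul_smul, ← Finset.smul_sum]
    refine Submodule.smul_of_tower_mem _ r ?_
    obtain ⟨N, hN⟩ := sum_perm_comp_eq a ha
      (fun a' => koszul lam (∏ j, xLin n c (a' j) ^ b j) (wedge a')) (fun a' h' => by
        rw [wedge_of_not_injective a' h', koszul]
        simp)
    rw [hN]
    exact nsmul_mem (sum_koszul_wedge_mem _ lam) N

/-- Symmetrization only sees the average of `f` over the stabilizer of the tuple. That average is,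
modulo the ideal, a polynomial in the variables of the tuple, and the ideal is preserved by
permutations and by the Koszul differential. -/
theorem sum_perm_koszul_wedge_mem
    (lam : Module.Dual ℂ (ExteriorAlgebra ℂ (Refl n))) {k : ℕ} (a : Fin k → Fin n)
    (f : PolyRep n c) :
    ∑ σ : Equiv.Perm (Fin n), koszul lam (permAlg n c σ f) (wedge (σ ∘ a)) ∈ symIdeal n c := by
  classical
  by_cases ha : Function.Injective a
  swap
  · refine sum_mem fun σ _ => ?_
    rw [wedge_of_not_injective _ fun h => ha h.of_comp, koszul]
    simp
  let G : Finset (Equiv.Perm (Fin n)) := Finset.univ.filter fun τ => τ ∘ a = a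
  have hG : ∀ τ, τ ∈ G ↔ τ ∘ a = a := by simp [G]
  have hG0 : (G.card : ℂ) ≠ 0 :=
    Nat.cast_ne_zero.2 (Finset.card_ne_zero_of_mem ((hG 1).2 rfl))
  let f' : PolyRep n c := ∑ τ ∈ G, permAlg n c τ f
  -- Each `τ` in the stabilizer `G` leaves the wedge unchanged, so substituting `σ τ` for `σ` makes
  -- every term of `f'` contribute the same sum.
  have h1 : ∑ σ : Equiv.Perm (Fin n), koszul lam (permAlg n c σ f') (wedge (σ ∘ a))
      = (G.card : ℂ) • ∑ σ : Equiv.Perm (Fin n),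
        koszul lam (permAlg n c σ f) (wedge (σ ∘ a)) := by
    have hk : ∀ σ : Equiv.Perm (Fin n), koszul lam (permAlg n c σ f') (wedge (σ ∘ a))
        = ∑ τ ∈ G, koszul lam (permAlg n c (σ * τ) f) (wedge ((σ * τ : Equiv.Perm (Fin n)) ∘ a)) := by
      intro σ
      have e : ∀ τ ∈ G, koszul lam (permAlg n c (σ * τ) f)
          (wedge ((σ * τ : Equiv.Perm (Fin n)) ∘ a))
          = koszul lam (permAlg n c σ (permAlg n c τ f)) (wedge (σ ∘ a)) := by
        intro τ hτ
        rw [Equiv.Perm.coe_mul, Function.comp_assoc, (hG τ).1 hτ, permAlg_mul]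
      rw [Finset.sum_congr rfl e]
      simp only [f', map_sum, koszul, Finset.mul_sum, Finset.smul_sum]
      rw [Finset.sum_comm]
    simp only [hk]
    rw [Finset.sum_comm, Nat.cast_smul_eq_nsmul, ← Finset.sum_const]
    refine Finset.sum_congr rfl fun τ _ => ?_
    exact Equiv.sum_comp (Equiv.mulRight τ)
      (fun σ => koszul lam (permAlg n c σ f) (wedge (σ ∘ a)))
  have h2 : f' ∈ adjoinMod n c (Finset.univ.image a) := by
    refine mem_adjoinMod_of_invariant _ _ fun σ hσ => ?_
    have hσa : σ ∘ a = a := funext fun j => hσ _ (Finset.mem_image_of_mem a (Finset.mem_univ j))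
    simp only [f', map_sum, ← permAlg_mul]
    refine Finset.sum_bij (fun τ _ => σ * τ) ?_ ?_ ?_ ?_
    · intro τ hτ
      rw [hG] at hτ ⊢
      rw [Equiv.Perm.coe_mul, Function.comp_assoc, hτ, hσa]
    · intro τ _ τ' _ e
      exact mul_left_cancel e
    · intro τ hτ
      refine ⟨σ⁻¹ * τ, ?_, by simp⟩
      rw [hG] at hτ ⊢
      have : (σ⁻¹ : Equiv.Perm (Fin n)) ∘ a = a := by
        conv_lhs => rw [← hσa, ← Function.comp_assoc, ← Equiv.Perm.coe_mul, inv_mul_cancel]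
        rfl
      rw [Equiv.Perm.coe_mul, Function.comp_assoc, hτ, this]
    · intro τ _
      rfl
  obtain ⟨g, hg, q, hq, hgq⟩ := Submodule.mem_sup.1 h2
  have hg' : g ∈ Algebra.adjoin ℂ (Set.range (xLin n c ∘ a)) := by
    rw [Set.range_comp]
    simpa using hg
  rw [← Submodule.restrictScalars_mem ℂ, ← Submodule.smul_mem_iff _ hG0, ← h1, ← hgq]
  simp only [map_add, koszul_add, Finset.sum_add_distrib]
  exact add_mem (sum_perm_koszul_wedge_mem_of_adjoin lam a ha hg')
    (sum_mem fun σ _ => koszul_mem_symIdeal lam (permAlg_mem_symIdeal σ hq) _)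

/-- The Koszul differential maps the symmetrization of `f ⊗ v` to forms with coefficients in
the ideal generated by symmetric polynomials of positive degree. -/
theorem sum_perm_koszul_mem (lam : Module.Dual ℂ (ExteriorAlgebra ℂ (Refl n)))
    (f : PolyRep n c) (v : ExteriorAlgebra ℂ (Refl n)) :
    ∑ σ : Equiv.Perm (Fin n), koszul lam (permAlg n c σ f) (ExteriorAlgebra.map (permRefl σ) v)
      ∈ symIdeal n c := by
  have hv : v ∈ Submodule.span ℂ
      (Set.range fun a : (Σ k : ℕ, Fin k → Fin n) => wedge a.2) := by
    rw [span_wedge]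
    trivial
  induction hv using Submodule.span_induction with
  | zero =>
    simp [koszul]
  | add x y _ _ hx hy =>
    simp only [koszul, map_add, add_smul, Finset.sum_add_distrib] at hx hy ⊢
    exact add_mem hx hy
  | smul r x _ hx =>
    simp only [koszul, map_smul, smul_eq_mul, mul_smul, ← Finset.smul_sum] at hx ⊢
    exact Submodule.smul_of_tower_mem _ r hx
  | mem x hx =>
    obtain ⟨⟨k, a⟩, rfl⟩ := hx
    simp only [map_permRefl_wedge]
    exact sum_perm_koszul_wedge_mem lam a f

/-- Symmetric polynomials commute with symmetrization and with the Koszul differential. The `j`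
symmetric factors of `f` come out, and the differential supplies one more factor of the ideal. -/
theorem sum_perm_koszul_mem_pow (lam : Module.Dual ℂ (ExteriorAlgebra ℂ (Refl n))) (j : ℕ)
    {f : PolyRep n c} (hf : f ∈ symIdeal n c ^ j) (v : ExteriorAlgebra ℂ (Refl n)) :
    ∑ σ : Equiv.Perm (Fin n), koszul lam (permAlg n c σ f) (ExteriorAlgebra.map (permRefl σ) v)
      ∈ symIdeal n c ^ (j + 1) := by
  induction j generalizing f with
  | zero =>
    rw [zero_add, pow_one]
    exact sum_perm_koszul_mem lam f v
  | succ j ih =>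
    rw [pow_succ'] at hf
    induction hf using Submodule.mul_induction_on' with
    | add p _ q _ hp hq =>
      simp only [map_add, koszul_add, Finset.sum_add_distrib]
      exact add_mem hp hq
    | mem_mul_mem s hs p hp =>
      induction hs using Submodule.span_induction generalizing p with
      | zero =>
        simp only [zero_mul, map_zero]
        simp [koszul]
      | add s t _ _ hs ht =>
        simp only [add_mul, map_add, koszul_add, Finset.sum_add_distrib]
        exact add_mem (hs p hp) (ht p hp)
      | smul r s _ hs =>
        rw [smul_eq_mul, mul_comm r s, mul_assoc]
        exact hs _ (Ideal.mul_mem_left _ _ hp)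
      | mem q hq =>
        have hq' : ∀ σ, permAlg n c σ q = q := hq.1
        simp only [map_mul, hq', koszul_mul, ← Finset.mul_sum]
        rw [pow_succ' _ (j + 1)]
        exact Ideal.mul_mem_mul (Ideal.subset_span hq) (ih hp)

end koszul

/-! ### A homotopy lemma for filtered complexes -/

section homotopy

variable {V : Type*} [AddCommGroup V] [Module ℂ V]

theorem aeval_mem_of_stable (N : Module.End ℂ V) (W : Submodule ℂ V) (h : ∀ u ∈ W, N u ∈ W)
    (Q : Polynomial ℂ) {u : V} (hu : u ∈ W) : Polynomial.aeval N Q u ∈ W := by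
  induction Q using Polynomial.induction_on' with
  | add p q hp hq =>
    rw [map_add, LinearMap.add_apply]
    exact add_mem hp hq
  | monomial k a =>
    rw [Polynomial.aeval_monomial, Module.End.mul_apply, Module.algebraMap_end_apply]
    refine W.smul_mem _ ?_
    induction k with
    | zero => simpa using hu
    | succ k ih =>
      rw [pow_succ', Module.End.mul_apply]
      exact h _ ih

/-- Splitting `Q = X Q₁ + a` with `a ≠ 0` inverts `N = ds + sd` away from its kernel: `a u = Q(N) u
- N Q₁(N) u`. The first term is harmonic because `Q(N)` kills `N u`. With `g = Q₁(N) u`, the second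
is `-(d s g + s d g)`: a boundary of something in `W (i - 1)`, plus a term that lies in `W (i - 1)`
because `d u ∈ W i` forces `d g ∈ W i`. -/
theorem exists_homotopy (d s : Module.End ℂ V) (hd : d * d = 0) (W : ℤ → Submodule ℂ V)
    (hdW : ∀ i, ∀ u ∈ W i, d u ∈ W (i + 1)) (hsW : ∀ i, ∀ u ∈ W i, s u ∈ W (i - 1))
    (hreg : ∀ u : V, RegularAt (d * s + s * d) ((d * s + s * d) u))
    (i : ℤ) (u : V) (hu : u ∈ W i) (hdu : d u ∈ W i) :
    ∃ q ∈ W i, (d * s + s * d) q = 0 ∧ ∃ v ∈ W (i - 1), u - q - d v ∈ W (i - 1) := by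
  set N := d * s + s * d with hN
  have hNW : ∀ i, ∀ u ∈ W i, N u ∈ W i := by
    intro i u hu
    have h1 := hdW _ _ (hsW _ _ hu)
    have h2 := hsW _ _ (hdW _ _ hu)
    rw [sub_add_cancel] at h1
    rw [add_sub_cancel_right] at h2
    exact add_mem h1 h2
  have hdN : Commute d N := by
    change d * N = N * d
    rw [hN, mul_add, add_mul, ← mul_assoc, hd, mul_assoc s, hd]
    noncomm_ring
  obtain ⟨Q, hQ, hQu⟩ := hreg u
  have hsplit := congrArg (fun P => Polynomial.aeval N P u) (Polynomial.divX_mul_X_add Q)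
  have hcomm : Polynomial.aeval N Q (N u) = N (Polynomial.aeval N Q u) := by
    have h := (Commute.all Q Polynomial.X).map (Polynomial.aeval N)
    rw [Polynomial.aeval_X] at h
    exact LinearMap.congr_fun h.eq u
  have hcomm' : Polynomial.aeval N Q.divX (N u) = N (Polynomial.aeval N Q.divX u) := by
    have h := (Commute.all Q.divX Polynomial.X).map (Polynomial.aeval N)
    rw [Polynomial.aeval_X] at h
    exact LinearMap.congr_fun h.eq u
  have hcommd : Polynomial.aeval N Q.divX (d u) = d (Polynomial.aeval N Q.divX u) := by
    have h : Commute d (Polynomial.aeval N Q.divX) := by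
      refine Polynomial.induction_on' (motive := fun P => Commute d (Polynomial.aeval N P))
        Q.divX ?_ ?_
      · intro p q hp hq
        rw [map_add]
        exact hp.add_right hq
      · intro k a
        rw [Polynomial.aeval_monomial]
        exact (Algebra.commute_algebraMap_right a d).mul_right (hdN.pow_right k)
    exact (LinearMap.congr_fun h.eq u).symm
  rw [← Polynomial.coeff_zero_eq_eval_zero] at hQ
  set a := Q.coeff 0
  simp only [map_add, map_mul, Polynomial.aeval_X, Polynomial.aeval_C, LinearMap.add_apply,
    Module.End.mul_apply, Module.algebraMap_end_apply] at hsplit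
  rw [hcomm'] at hsplit
  set g := Polynomial.aeval N Q.divX u
  have hg : g ∈ W i := aeval_mem_of_stable N _ (hNW i) _ hu
  have hdg : d g ∈ W i := by
    rw [← hcommd]
    exact aeval_mem_of_stable N _ (hNW i) _ hdu
  refine ⟨a⁻¹ • Polynomial.aeval N Q u,
    (W i).smul_mem _ (aeval_mem_of_stable N _ (hNW i) _ hu), ?_,
    -(a⁻¹ • s g), neg_mem ((W _).smul_mem _ (hsW _ _ hg)), ?_⟩
  · rw [map_smul, ← hcomm]
    exact (congrArg (a⁻¹ • ·) hQu).trans (smul_zero _)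
  · have h3 : N g = d (s g) + s (d g) := rfl
    have h2 : u - a⁻¹ • Polynomial.aeval N Q u - d (-(a⁻¹ • s g)) = -(a⁻¹ • s (d g)) := by
      rw [← hsplit, h3, map_neg, map_smul]
      simp only [smul_add, smul_smul, inv_mul_cancel₀ hQ, one_smul]
      abel
    rw [h2]
    exact neg_mem ((W _).smul_mem _ (hsW _ _ hdg))

end homotopy

/-! ### The differential and the homotopy on equivariant maps `Λ^* 𝔥 → L_c` -/

section operators

variable {n : ℕ} {c : ℂ}

theorem contract_map_permRefl (σ : Equiv.Perm (Fin n)) (i : Fin n)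
    (v : ExteriorAlgebra ℂ (Refl n)) : contract (σ i) (ExteriorAlgebra.map (permRefl σ) v)
      = ExteriorAlgebra.map (permRefl σ) (contract i v) := by
  induction v using CliffordAlgebra.left_induction with
  | algebraMap r =>
    rw [Algebra.algebraMap_eq_smul_one, map_smul, map_smul, map_smul, map_smul, map_one,
      contract_one, contract_one, map_zero]
  | add x y hx hy => simp only [map_add, hx, hy]
  | ι_mul v w hv =>
    change contract (σ i) (ExteriorAlgebra.map (permRefl σ) (ExteriorAlgebra.ι ℂ w * v))
      = ExteriorAlgebra.map (permRefl σ) (contract i (ExteriorAlgebra.ι ℂ w * v))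
    rw [map_mul, ExteriorAlgebra.map_apply_ι, contract_ι_mul, contract_ι_mul, map_sub, map_smul,
      map_mul, ExteriorAlgebra.map_apply_ι, hv]
    simp [permRefl]

theorem ι_mul_ι_mul_swap (w w' : Refl n) (v : ExteriorAlgebra ℂ (Refl n)) :
    ExteriorAlgebra.ι ℂ w * (ExteriorAlgebra.ι ℂ w' * v)
      = -(ExteriorAlgebra.ι ℂ w' * (ExteriorAlgebra.ι ℂ w * v)) := by
  rw [← mul_assoc, ← mul_assoc, ← neg_mul]
  congr 1
  exact eq_neg_of_add_eq_zero_left (ExteriorAlgebra.ι_add_mul_swap _ _)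

/-- The transposition acts on `𝔥` by `w ↦ w - (w_p - w_q) e` with `e = ẽ_p - ẽ_q`. In its
multiplicative extension to `Λ^* 𝔥` all terms containing `e` twice vanish, so only the part linear
in `e` remains. -/
theorem map_permRefl_swap (p q : Fin n) (v : ExteriorAlgebra ℂ (Refl n)) :
    ExteriorAlgebra.map (permRefl (Equiv.swap p q)) v
      = v - ExteriorAlgebra.ι ℂ (eBar p - eBar q) * (contract p v - contract q v) := by
  have hw : ∀ w : Refl n, permRefl (Equiv.swap p q) w
      = w - (w.1 p - w.1 q) • (eBar p - eBar q) := by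
    intro w
    ext j
    rcases eq_or_ne p q with rfl | hpq
    · simp [permRefl]
    · have : (permRefl (Equiv.swap p q) w).1 j = w.1 (Equiv.swap p q j) := rfl
      rw [this]
      by_cases hp : j = p
      · subst hp
        simp [eBar, hpq]
      · by_cases hq : j = q
        · subst hq
          simp [eBar, hp]
          ring
        · rw [Equiv.swap_apply_of_ne_of_ne hp hq]
          simp [eBar, hp, hq]
  induction v using CliffordAlgebra.left_induction with
  | algebraMap r =>
    rw [Algebra.algebraMap_eq_smul_one, map_smul, map_smul, map_smul, map_one,
      contract_one, contract_one]
    simp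
  | add x y hx hy =>
    simp only [map_add, hx, hy, mul_sub, mul_add]
    abel
  | ι_mul v w hv =>
    change ExteriorAlgebra.map (permRefl (Equiv.swap p q)) (ExteriorAlgebra.ι ℂ w * v)
      = ExteriorAlgebra.ι ℂ w * v - ExteriorAlgebra.ι ℂ (eBar p - eBar q)
        * (contract p (ExteriorAlgebra.ι ℂ w * v) - contract q (ExteriorAlgebra.ι ℂ w * v))
    rw [map_mul, ExteriorAlgebra.map_apply_ι, contract_ι_mul, contract_ι_mul, hv, hw, map_sub,
      map_smul]
    set e := ExteriorAlgebra.ι ℂ (eBar p - eBar q : Refl n) with he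
    set D := contract p v
    set D' := contract q v
    have h1 : ∀ u, e * (e * u) = 0 := by
      intro u
      rw [← mul_assoc, he, ExteriorAlgebra.ι_sq_zero, zero_mul]
    have h2 : ∀ u, e * (ExteriorAlgebra.ι ℂ w * u) = -(ExteriorAlgebra.ι ℂ w * (e * u)) :=
      ι_mul_ι_mul_swap _ _
    simp only [sub_mul, mul_sub, smul_mul_assoc, mul_smul_comm, h1, h2, sub_smul]
    simp only [smul_zero]
    abel

/-- The number operator `∑ ẽ_i ∧ ι_i` of `Λ^* 𝔥`. -/
def numberOp (v : ExteriorAlgebra ℂ (Refl n)) : ExteriorAlgebra ℂ (Refl n) :=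
  ∑ i, ExteriorAlgebra.ι ℂ (eBar i) * contract i v

theorem numberOp_wedge {k : ℕ} (a : Fin k → Fin n) :
    numberOp (wedge a) = (k : ℂ) • wedge a := by
  induction k with
  | zero => simp [wedge_zero, numberOp, contract_one]
  | succ k ih =>
    obtain ⟨i, a, rfl⟩ : ∃ i a', a = Fin.cons i a' := ⟨a 0, Fin.tail a, (Fin.cons_self_tail a).symm⟩
    have ih := ih a
    rw [wedge_cons, numberOp]
    simp only [contract_ι_mul, mul_sub, Finset.sum_sub_distrib, mul_smul_comm, ← smul_mul_assoc]
    rw [← Finset.sum_mul]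
    have h1 : ∑ l, (eBar i).1 l • ExteriorAlgebra.ι ℂ (eBar l) = ExteriorAlgebra.ι ℂ (eBar i) := by
      conv_rhs => rw [← sum_smul_eBar (eBar i), map_sum]
      simp only [map_smul]
    have h2 : ∀ l u, ExteriorAlgebra.ι ℂ (eBar l : Refl n) * (ExteriorAlgebra.ι ℂ (eBar i) * u)
        = -(ExteriorAlgebra.ι ℂ (eBar i) * (ExteriorAlgebra.ι ℂ (eBar l) * u)) :=
      fun l u => ι_mul_ι_mul_swap _ _ u
    simp only [h1, h2, Finset.sum_neg_distrib, ← Finset.mul_sum]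
    rw [numberOp] at ih
    rw [ih]
    push_cast
    rw [mul_smul_comm, smul_mul_assoc, add_smul, one_smul]
    abel

/-- The `S_n`-equivariant linear maps `Λ^* 𝔥 → L_c`. -/
def equivariantL (n : ℕ) (c : ℂ) : Submodule ℂ (ExteriorAlgebra ℂ (Refl n) →ₗ[ℂ] LRep n c) where
  carrier := {φ | ∀ σ v, φ (ExteriorAlgebra.map (permRefl σ) v) = sGen c σ • φ v}
  add_mem' := fun {φ ψ} hφ hψ σ v => by
    rw [LinearMap.add_apply, hφ, hψ, LinearMap.add_apply, smul_add]
  zero_mem' := fun σ v => by rw [LinearMap.zero_apply, LinearMap.zero_apply, smul_zero]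
  smul_mem' := fun a φ hφ σ v => by
    rw [LinearMap.smul_apply, hφ, LinearMap.smul_apply, smul_comm]

/-- The differential `(dφ)(v) = ∑ x̃_i φ(ẽ_i ∧ v)` on equivariant maps `Λ^* 𝔥 → L_c`. -/
def diffL (n : ℕ) (c : ℂ) : Module.End ℂ (equivariantL n c) where
  toFun φ := ⟨∑ i : Fin n, actL (xGen c (eBar i)) ∘ₗ φ.1 ∘ₗ
      LinearMap.mulLeft ℂ (ExteriorAlgebra.ι ℂ (eBar i : Refl n)), fun σ v => by
    simp only [LinearMap.sum_apply, LinearMap.comp_apply, actL_apply, LinearMap.mulLeft_apply]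
    rw [Finset.smul_sum, ← Equiv.sum_comp σ]
    refine Finset.sum_congr rfl fun i _ => ?_
    rw [← mul_smul, sGen_xGen, mul_smul, ← φ.2, map_mul (ExteriorAlgebra.map (permRefl σ)),
      ExteriorAlgebra.map_apply_ι,
      permRefl_eBar]⟩
  map_add' φ ψ := Subtype.ext <| LinearMap.ext fun v => by
    simp [LinearMap.sum_apply, Finset.sum_add_distrib]
  map_smul' a φ := Subtype.ext <| LinearMap.ext fun v => by
    simp [LinearMap.sum_apply, Finset.smul_sum]

/-- The homotopy `(sφ)(v) = ∑ ỹ_i φ(ι_i v)` on equivariant maps `Λ^* 𝔥 → L_c`. -/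
def htpyL (n : ℕ) (c : ℂ) : Module.End ℂ (equivariantL n c) where
  toFun φ := ⟨∑ i : Fin n, actL (yGen c (eBar i)) ∘ₗ φ.1 ∘ₗ contract i, fun σ v => by
    simp only [LinearMap.sum_apply, LinearMap.comp_apply, actL_apply]
    rw [Finset.smul_sum, ← Equiv.sum_comp σ]
    refine Finset.sum_congr rfl fun i _ => ?_
    rw [← mul_smul, sGen_yGen, mul_smul, ← φ.2, contract_map_permRefl, permRefl_eBar]⟩
  map_add' φ ψ := Subtype.ext <| LinearMap.ext fun v => by
    simp [LinearMap.sum_apply, Finset.sum_add_distrib]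
  map_smul' a φ := Subtype.ext <| LinearMap.ext fun v => by
    simp [LinearMap.sum_apply, Finset.smul_sum]

theorem diffL_apply (φ : equivariantL n c) (v : ExteriorAlgebra ℂ (Refl n)) :
    (diffL n c φ).1 v = ∑ i, xGen c (eBar i) • φ.1 (ExteriorAlgebra.ι ℂ (eBar i) * v) := by
  simp [diffL, LinearMap.sum_apply, actL_apply]

theorem htpyL_apply (φ : equivariantL n c) (v : ExteriorAlgebra ℂ (Refl n)) :
    (htpyL n c φ).1 v = ∑ i, yGen c (eBar i) • φ.1 (contract i v) := by
  simp [htpyL, LinearMap.sum_apply, actL_apply]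

theorem sum_sum_eq_zero_of_antisymm {ι V : Type*} [Fintype ι] [AddCommGroup V] [Module ℂ V]
    (f : ι → ι → V) (hf : ∀ i j, f i j = -f j i) : ∑ i, ∑ j, f i j = 0 := by
  have h : ∑ i, ∑ j, f i j = -∑ i, ∑ j, f i j := by
    conv_lhs => rw [Finset.sum_comm]
    simp only [← Finset.sum_neg_distrib]
    exact Finset.sum_congr rfl fun i _ => Finset.sum_congr rfl fun j _ => hf j i
  have h2 : (2 : ℂ) • ∑ i, ∑ j, f i j = 0 := by
    rw [two_smul]
    nth_rewrite 1 [h]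
    exact neg_add_cancel _
  exact (smul_eq_zero.1 h2).resolve_left two_ne_zero

theorem diffL_mul_diffL : diffL n c * diffL n c = 0 := by
  refine LinearMap.ext fun φ => Subtype.ext <| LinearMap.ext fun v => ?_
  change (diffL n c (diffL n c φ)).1 v = 0
  rw [diffL_apply]
  simp only [diffL_apply, Finset.smul_sum, ← mul_smul]
  refine sum_sum_eq_zero_of_antisymm _ fun i j => ?_
  rw [xGen_comm, ι_mul_ι_mul_swap, map_neg, smul_neg]

/-- The diagonal contractions give `∑ x̃_i ỹ_i`, and the remaining terms assemble into commutators
`[ỹ_l, x̃_i]` applied to `φ(ẽ_i ∧ ι_l v)`. Their scalar parts give the number operator. Their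
reflection parts give `-c ∑ s φ(v - s v)`, which by equivariance and `s² = 1` is `c ∑ (1 - s) φ(v)`,
the missing part of the Euler element. -/
theorem diffL_htpyL_apply (φ : equivariantL n c) (v : ExteriorAlgebra ℂ (Refl n)) :
    ((diffL n c * htpyL n c + htpyL n c * diffL n c) φ).1 v
      = eulerElt n c • φ.1 v + φ.1 (numberOp v) := by
  change (diffL n c (htpyL n c φ)).1 v + (htpyL n c (diffL n c φ)).1 v = _
  have h1 : (diffL n c (htpyL n c φ)).1 v = ∑ i : Fin n, (xGen c (eBar i) * yGen c (eBar i)) • φ.1 v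
      - ∑ i : Fin n, ∑ l : Fin n, (xGen c (eBar i) * yGen c (eBar l)) •
        φ.1 (ExteriorAlgebra.ι ℂ (eBar i) * contract l v) := by
    rw [diffL_apply, ← Finset.sum_sub_distrib]
    refine Finset.sum_congr rfl fun i _ => ?_
    rw [htpyL_apply]
    simp only [contract_ι_mul, map_sub, smul_sub, Finset.sum_sub_distrib, Finset.smul_sum,
      ← mul_smul]
    congr 1
    rw [← yGen_sum_eBar (eBar i), Finset.mul_sum, Finset.sum_smul]
    refine Finset.sum_congr rfl fun l _ => ?_
    rw [map_smul, mul_smul_comm, smul_assoc, smul_comm]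
  have h2 : (htpyL n c (diffL n c φ)).1 v = ∑ i : Fin n, ∑ l : Fin n, (yGen c (eBar l) * xGen c (eBar i)) •
        φ.1 (ExteriorAlgebra.ι ℂ (eBar i) * contract l v) := by
    rw [htpyL_apply, Finset.sum_comm]
    refine Finset.sum_congr rfl fun l _ => ?_
    rw [diffL_apply, Finset.smul_sum]
    simp only [← mul_smul]
  have h3 : ∀ i l : Fin n, (yGen c (eBar l) * xGen c (eBar i)) •
        φ.1 (ExteriorAlgebra.ι ℂ (eBar i) * contract l v)
      - (xGen c (eBar i) * yGen c (eBar l)) •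
        φ.1 (ExteriorAlgebra.ι ℂ (eBar i) * contract l v)
      = φ.1 ((eBar i).1 l • ExteriorAlgebra.ι ℂ (eBar i) * contract l v)
        - c • ∑ p : Fin n × Fin n with p.1 < p.2, sGen c (Equiv.swap p.1 p.2) •
          φ.1 ((((if p.1 = l then 1 else 0) - (if p.2 = l then 1 else 0) : ℂ) •
            ((if p.1 = i then 1 else 0) - (if p.2 = i then 1 else 0) : ℂ) •
            (ExteriorAlgebra.ι ℂ (eBar i) * contract l v))) := by
    intro i l
    have e1 : ∑ j, (eBar l).1 j * (eBar i).1 j = (eBar i).1 l := by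
      rw [← sum_mul_eBar (eBar i) l]
      exact Finset.sum_congr rfl fun j _ => mul_comm _ _
    have e2 : ∀ i p q : Fin n, (eBar i).1 p - (eBar i).1 q
        = (if p = i then 1 else 0) - (if q = i then 1 else 0) := by intro i p q; simp [eBar]
    rw [← sub_smul, yGen_xGen, e1, sub_smul, Algebra.algebraMap_eq_smul_one, smul_assoc, one_smul,
      smul_mul_assoc, map_smul, smul_assoc, Finset.sum_smul]
    simp only [e2, map_smul, smul_assoc, mul_smul]
    congr 2
    refine Finset.sum_congr rfl fun p _ => ?_
    rw [smul_comm (sGen c _), smul_comm (sGen c _)]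
  have h4 : ∑ i : Fin n, ∑ l : Fin n, φ.1 ((eBar i).1 l • ExteriorAlgebra.ι ℂ (eBar i) * contract l v)
      = φ.1 (numberOp v) := by
    rw [Finset.sum_comm, numberOp, map_sum]
    refine Finset.sum_congr rfl fun l _ => ?_
    rw [← map_sum, ← Finset.sum_mul]
    congr 2
    conv_rhs => rw [← sum_smul_eBar (eBar l), map_sum]
    refine Finset.sum_congr rfl fun i _ => ?_
    rw [map_smul]
    congr 1
    simp [eBar, eq_comm]
  have h5 : ∑ i : Fin n, ∑ l : Fin n, ∑ p : Fin n × Fin n with p.1 < p.2, sGen c (Equiv.swap p.1 p.2) •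
          φ.1 ((((if p.1 = l then 1 else 0) - (if p.2 = l then 1 else 0) : ℂ) •
            ((if p.1 = i then 1 else 0) - (if p.2 = i then 1 else 0) : ℂ) •
            (ExteriorAlgebra.ι ℂ (eBar i) * contract l v)))
      -- The indicator coefficients collapse the sums over `i` and `l` to `(ẽ_p - ẽ_q) ∧ (ι_p - ι_q)
      -- v`, which `map_permRefl_swap` identifies with `v - s v`.
      = ∑ p : Fin n × Fin n with p.1 < p.2, (sGen c (Equiv.swap p.1 p.2) - 1) • φ.1 v := by
    have e : ∀ p : Fin n × Fin n, (sGen c (Equiv.swap p.1 p.2) - 1) • φ.1 v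
        = ∑ i : Fin n, ∑ l : Fin n, sGen c (Equiv.swap p.1 p.2) •
          φ.1 ((((if p.1 = l then 1 else 0) - (if p.2 = l then 1 else 0) : ℂ) •
            ((if p.1 = i then 1 else 0) - (if p.2 = i then 1 else 0) : ℂ) •
            (ExteriorAlgebra.ι ℂ (eBar i) * contract l v))) := by
      intro p
      have hs : sGen c (Equiv.swap p.1 p.2) • sGen c (Equiv.swap p.1 p.2) • φ.1 v = φ.1 v := by
        rw [← mul_smul, ← sGen_mul, Equiv.swap_mul_self, sGen_one, one_smul]
      have hr := congrArg φ.1 (map_permRefl_swap p.1 p.2 v)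
      rw [φ.2, map_sub] at hr
      have hr' : φ.1 (ExteriorAlgebra.ι ℂ (eBar p.1 - eBar p.2)
          * (contract p.1 v - contract p.2 v)) = φ.1 v - sGen c (Equiv.swap p.1 p.2) • φ.1 v := by
        rw [hr, sub_sub_cancel]
      simp only [← Finset.smul_sum, ← map_sum, sub_smul, ite_smul, one_smul, zero_smul,
        Finset.sum_sub_distrib, Finset.sum_ite_eq, Finset.mem_univ, if_true, smul_sub]
      rw [show ExteriorAlgebra.ι ℂ (eBar p.1) * contract p.1 v
          - ExteriorAlgebra.ι ℂ (eBar p.1) * contract p.2 v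
          - (ExteriorAlgebra.ι ℂ (eBar p.2) * contract p.1 v
          - ExteriorAlgebra.ι ℂ (eBar p.2) * contract p.2 v)
          = ExteriorAlgebra.ι ℂ (eBar p.1 - eBar p.2) * (contract p.1 v - contract p.2 v) by
        rw [map_sub]; noncomm_ring]
      rw [hr', smul_sub, hs]
    simp only [e]
    conv_rhs => rw [Finset.sum_comm]
    refine Finset.sum_congr rfl fun i _ => ?_
    rw [Finset.sum_comm]
  rw [h1, h2, sub_add_eq_add_sub, add_sub_assoc, ← Finset.sum_sub_distrib]
  simp only [← Finset.sum_sub_distrib, h3]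
  simp only [Finset.sum_sub_distrib, ← Finset.smul_sum, h4, h5]
  rw [eulerElt, add_smul, Finset.sum_smul, smul_assoc, Finset.sum_smul]
  simp only [sub_smul, one_smul, Finset.sum_sub_distrib]
  rw [← neg_sub (∑ x : Fin n × Fin n with x.1 < x.2, sGen c (Equiv.swap x.1 x.2) • φ.1 v), smul_neg]
  abel

end operators

/-! ### The algebraic filtration and the homotopy -/

section filtration

variable {n : ℕ} {c : ℂ}

theorem xGen_gradedPiece (w : Refl n) (k : ℤ) {u : LRep n c} (hu : u ∈ gradedPiece n c k) :
    xGen c w • u ∈ gradedPiece n c (k + 1) := by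
  rw [mem_gradedPiece] at hu ⊢
  rw [← mul_smul, gradingElt_xGen, add_smul, mul_smul, hu, smul_comm]
  push_cast
  rw [add_smul, one_smul]

theorem sGen_gradedPiece (σ : Equiv.Perm (Fin n)) (k : ℤ) {u : LRep n c}
    (hu : u ∈ gradedPiece n c k) : sGen c σ • u ∈ gradedPiece n c k := by
  rw [mem_gradedPiece] at hu ⊢
  rw [← mul_smul, ← sGen_gradingElt, mul_smul, hu, smul_comm]

/-- The component along `λ` of the Koszul differential of the symmetrization of `u ⊗ v`. -/
def koszulAvg (lam : Module.Dual ℂ (ExteriorAlgebra ℂ (Refl n)))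
    (v : ExteriorAlgebra ℂ (Refl n)) : Module.End ℂ (LRep n c) :=
  ∑ σ : Equiv.Perm (Fin n), ∑ l, lam (contract l (ExteriorAlgebra.map (permRefl σ) v)) •
    (actL (xGen c (eBar l)) ∘ₗ actL (sGen c σ))

theorem koszulAvg_apply (lam : Module.Dual ℂ (ExteriorAlgebra ℂ (Refl n)))
    (v : ExteriorAlgebra ℂ (Refl n)) (u : LRep n c) : koszulAvg lam v u
      = ∑ σ : Equiv.Perm (Fin n), ∑ l, lam (contract l (ExteriorAlgebra.map (permRefl σ) v)) •
        xGen c (eBar l) • sGen c σ • u := by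
  simp [koszulAvg, LinearMap.sum_apply, actL_apply]

/-- The power of the ideal and the `𝐡`-eigenvalue both rise by one. Since the bound `2j - i` counts
the power twice, this gains one step of the filtration. -/
theorem koszulAvg_decFilt (lam : Module.Dual ℂ (ExteriorAlgebra ℂ (Refl n)))
    (v : ExteriorAlgebra ℂ (Refl n)) (i : ℤ) {u : LRep n c} (hu : u ∈ decFilt n c (i - 1)) :
    koszulAvg lam v u ∈ decFilt n c i := by
  suffices h : decFilt n c (i - 1) ≤ (decFilt n c i).comap (koszulAvg lam v) from h hu
  refine iSup_le fun j => ?_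
  rw [← Submodule.map_le_iff_le_comap]
  refine le_trans ?_ (le_iSup _ (j + 1))
  refine (Submodule.map_inf_le _).trans (inf_le_inf ?_ ?_)
  · rintro _ ⟨_, ⟨p, hp, rfl⟩, rfl⟩
    refine ⟨_, sum_perm_koszul_mem_pow lam j hp v, ?_⟩
    rw [koszulAvg_apply, map_sum]
    refine Finset.sum_congr rfl fun σ _ => ?_
    rw [koszul, map_sum]
    refine Finset.sum_congr rfl fun l _ => ?_
    rw [map_smul, ← toL_smul, ← toL_smul, xGen_smul_eq, permAlg_apply]
  · simp only [Submodule.map_iSup]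
    refine iSup₂_le fun k hk => ?_
    refine le_trans ?_ (le_iSup₂_of_le (k + 1) (by push_cast; omega) le_rfl)
    rintro _ ⟨u, hu, rfl⟩
    rw [koszulAvg_apply]
    exact sum_mem fun σ _ => sum_mem fun l _ =>
      Submodule.smul_mem _ _ (xGen_gradedPiece _ _ (sGen_gradedPiece σ k hu))

/-- The equivariant maps `Λ^* 𝔥 → F^alg_i`. -/
def filtL (n : ℕ) (c : ℂ) (i : ℤ) : Submodule ℂ (equivariantL n c) where
  carrier := {φ | ∀ v, φ.1 v ∈ algFilt n c i}
  add_mem' hφ hψ v := add_mem (hφ v) (hψ v)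
  zero_mem' _ := zero_mem _
  smul_mem' a _ hφ v := Submodule.smul_mem _ a (hφ v)

theorem diffL_mem_filtL (i : ℤ) (φ : equivariantL n c) (hφ : φ ∈ filtL n c i) :
    diffL n c φ ∈ filtL n c (i + 1) := by
  intro v
  rw [diffL_apply]
  exact sum_mem fun l _ => xGen_algFilt _ _ _ (hφ _)

/-- Adjoint to `koszulAvg_decFilt`. By equivariance of `sφ` and invariance of the form, the pairing
of `(sφ)(v)` with `w` can be averaged over `S_n`. Moving each `ỹ_l` across as `x̃_l` makes the
symmetrized Koszul differential of `w` appear, tested against values of `φ`. -/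
theorem htpyL_mem_filtL (hn : 0 < n) (i : ℤ) (φ : equivariantL n c) (hφ : φ ∈ filtL n c i) :
    htpyL n c φ ∈ filtL n c (i - 1) := by
  intro v
  rw [mem_algFilt_iff hn]
  intro w hw
  -- The basis separates the argument of `φ` from the rest: its coordinate functionals play the role
  -- of `λ` in `koszulAvg`.
  let b := Module.Free.chooseBasis ℂ (ExteriorAlgebra ℂ (Refl n))
  have h1 : ∀ σ : Equiv.Perm (Fin n), formL hn ((htpyL n c φ).1 v) w
      = ∑ k, formL hn (φ.1 (b k)) (∑ l,
          b.coord k (contract l (ExteriorAlgebra.map (permRefl σ) v)) •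
            xGen c (eBar l) • sGen c σ • w) := by
    intro σ
    rw [← formL_sGen hn σ, ← (htpyL n c φ).2, htpyL_apply, map_sum, LinearMap.sum_apply]
    simp only [formL_yGen, map_sum]
    rw [Finset.sum_comm]
    refine Finset.sum_congr rfl fun l _ => ?_
    conv_lhs => rw [← b.sum_repr (contract l (ExteriorAlgebra.map (permRefl σ) v)), map_sum,
      map_sum, LinearMap.sum_apply]
    refine Finset.sum_congr rfl fun k _ => ?_
    rw [LinearMap.map_smul, LinearMap.map_smul, LinearMap.smul_apply, LinearMap.map_smul]
    rfl
  have h2 : ∑ σ : Equiv.Perm (Fin n), formL hn ((htpyL n c φ).1 v) w = 0 := by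
    rw [Finset.sum_congr rfl fun σ _ => h1 σ, Finset.sum_comm]
    refine Finset.sum_eq_zero fun k _ => ?_
    rw [← map_sum, ← koszulAvg_apply]
    exact (mem_algFilt_iff hn).1 (hφ _) _ (koszulAvg_decFilt _ _ _ hw)
  rw [Finset.sum_const, ← Nat.cast_smul_eq_nsmul ℂ, smul_eq_zero] at h2
  refine h2.resolve_left (Nat.cast_ne_zero.2 ?_)
  exact Finset.card_ne_zero_of_mem (Finset.mem_univ 1)

/-! ### Spectrum and kernel of the Laplacian -/

theorem exists_eq_const_add_toL (hn : 0 < n) (u : LRep n c) :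
    ∃ (a : ℂ) (w : LRep n c), u = a • toL n c 1 + w ∧ RegularAt (eulerElt n c) w := by
  obtain ⟨p, rfl⟩ := toL_surjective n c u
  obtain ⟨a, f, rfl⟩ := exists_eq_const_add p
  refine ⟨a, toL n c (∑ i, xLin n c i * f i), by rw [map_add, map_smul], ?_⟩
  obtain ⟨Q, hQ, h⟩ := RegularAt.sum Finset.univ (fun i => xLin n c i * f i)
    (fun i => regularAt_euler_x hn i (f i))
  exact ⟨Q, hQ, by rw [← toL_smul, h, map_zero]⟩

theorem regularAt_euler_add_toL (hn : 0 < n) (u : LRep n c) (k : ℕ) (hk : 0 < k) :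
    RegularAt (eulerElt n c + (k : CherednikAlg n c)) u := by
  obtain ⟨p, rfl⟩ := toL_surjective n c u
  obtain ⟨Q, hQ, h⟩ := regularAt_euler_add hn p k hk
  exact ⟨Q, hQ, by rw [← toL_smul, h, map_zero]⟩

theorem regularAt_euler_euler (hn : 0 < n) (u : LRep n c) :
    RegularAt (eulerElt n c) (eulerElt n c • u) := by
  obtain ⟨a, w, rfl, hw⟩ := exists_eq_const_add_toL hn u
  rw [smul_add, smul_comm, ← toL_smul, eulerElt_smul_one, map_zero, smul_zero, zero_add]
  exact RegularAt.smul_of_intertwine rfl hw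

/-- The Laplacian `ds + sd` on equivariant maps `Λ^* 𝔥 → L_c`. -/
abbrev laplL (n : ℕ) (c : ℂ) : Module.End ℂ (equivariantL n c) :=
  diffL n c * htpyL n c + htpyL n c * diffL n c

theorem laplL_wedge (φ : equivariantL n c) {k : ℕ} (a : Fin k → Fin n) :
    (laplL n c φ).1 (wedge a) = (eulerElt n c + (k : CherednikAlg n c)) • φ.1 (wedge a) := by
  rw [diffL_htpyL_apply, numberOp_wedge, map_smul, add_smul]
  congr 1
  rw [← map_natCast (algebraMap ℂ (CherednikAlg n c)), Algebra.algebraMap_eq_smul_one,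
    smul_assoc, one_smul]

theorem aeval_laplL_wedge (φ : equivariantL n c) {k : ℕ} (a : Fin k → Fin n)
    (Q : Polynomial ℂ) : (Polynomial.aeval (laplL n c) Q φ).1 (wedge a)
      = Polynomial.aeval (eulerElt n c + (k : CherednikAlg n c)) Q • φ.1 (wedge a) := by
  induction Q using Polynomial.induction_on' with
  | add p q hp hq =>
    rw [map_add, map_add, add_smul, ← hp, ← hq]
    rfl
  | monomial r b =>
    rw [Polynomial.aeval_monomial, Polynomial.aeval_monomial, Module.End.mul_apply,
      Module.algebraMap_end_apply, ← Algebra.smul_def, smul_assoc]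
    change b • ((laplL n c ^ r) φ).1 (wedge a) = _
    congr 1
    induction r with
    | zero => simp
    | succ r ih => rw [pow_succ', pow_succ', Module.End.mul_apply, laplL_wedge, ih, mul_smul]

/-- The product of the individual polynomials serves all indices, and its constant term is still
nonzero. -/
theorem exists_common_polynomial {ι A V : Type*} [Ring A] [Algebra ℂ A] [AddCommGroup V]
    [Module A V] (s : Finset ι) (T : ι → A) (u : ι → V) (h : ∀ i, RegularAt (T i) (u i)) :
    ∃ Q : Polynomial ℂ, Q.eval 0 ≠ 0 ∧ ∀ i ∈ s, Polynomial.aeval (T i) Q • u i = 0 := by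
  classical
  induction s using Finset.induction_on with
  | empty => exact ⟨1, by simp, by simp⟩
  | insert j s _ ih =>
    obtain ⟨Q, hQ, hs⟩ := ih
    obtain ⟨R, hR, hj⟩ := h j
    refine ⟨Q * R, by rw [Polynomial.eval_mul]; exact mul_ne_zero hQ hR, fun i hi => ?_⟩
    rcases Finset.mem_insert.1 hi with rfl | hi
    · rw [map_mul, mul_smul, hj, smul_zero]
    · rw [mul_comm, map_mul, mul_smul, hs i hi, smul_zero]

theorem equivariantL_ext {φ ψ : equivariantL n c}
    (h : ∀ (k : ℕ) (a : Fin k → Fin n), k ≤ n → φ.1 (wedge a) = ψ.1 (wedge a)) : φ = ψ := by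
  refine Subtype.ext (LinearMap.ext_on_range span_wedge ?_)
  rintro ⟨k, a⟩
  by_cases ha : Function.Injective a
  · exact h k a (by simpa using Fintype.card_le_of_injective a ha)
  · simp only [wedge_of_not_injective a ha, map_zero]

/-- On exterior degree `k` the Laplacian is the Euler element plus `k`. For `k > 0` this is regular
everywhere; for `k = 0` it is regular on its own image. Finitely many wedges suffice, so one
polynomial works for the whole map. -/
theorem regularAt_laplL (hn : 0 < n) (φ : equivariantL n c) :
    RegularAt (laplL n c) (laplL n c φ) := by
  obtain ⟨Q, hQ, h⟩ := exists_common_polynomial Finset.univ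
    (fun a : (Σ k : Fin (n + 1), Fin k → Fin n) => eulerElt n c + ((a.1 : ℕ) : CherednikAlg n c))
    (fun a => (laplL n c φ).1 (wedge a.2)) (fun ⟨k, a⟩ => by
      rw [laplL_wedge]
      rcases Nat.eq_zero_or_pos k with hk | hk
      · simp only [hk, Nat.cast_zero, add_zero]
        exact regularAt_euler_euler hn _
      · exact regularAt_euler_add_toL hn _ _ hk)
  refine ⟨Q, hQ, equivariantL_ext fun k a hk => ?_⟩
  have := h ⟨⟨k, Nat.lt_succ_of_le hk⟩, a⟩ (Finset.mem_univ _)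
  exact (aeval_laplL_wedge _ a Q).trans this

theorem algebraMapInv_map_permRefl (σ : Equiv.Perm (Fin n)) (v : ExteriorAlgebra ℂ (Refl n)) :
    ExteriorAlgebra.algebraMapInv (ExteriorAlgebra.map (permRefl σ) v)
      = ExteriorAlgebra.algebraMapInv (R := ℂ) v := by
  change ((ExteriorAlgebra.algebraMapInv (R := ℂ)).comp
    (ExteriorAlgebra.map (permRefl σ))) v = _
  congr 1
  ext w
  simp [ExteriorAlgebra.algebraMapInv]

theorem algebraMapInv_ι_mul (w : Refl n) (v : ExteriorAlgebra ℂ (Refl n)) :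
    ExteriorAlgebra.algebraMapInv (R := ℂ) (ExteriorAlgebra.ι ℂ w * v) = 0 := by
  rw [map_mul]
  simp [ExteriorAlgebra.algebraMapInv]

/-- The equivariant map `Λ^* 𝔥 → Λ^0 𝔥 → L_c` with image spanned by `1`. -/
def oneL (n : ℕ) (c : ℂ) : equivariantL n c :=
  ⟨(ExteriorAlgebra.algebraMapInv (R := ℂ) (M := Refl n)).toLinearMap.smulRight (toL n c 1),
    fun σ v => by
      rw [LinearMap.smulRight_apply, LinearMap.smulRight_apply, smul_comm, sGen_one_poly,
        AlgHom.toLinearMap_apply, AlgHom.toLinearMap_apply, algebraMapInv_map_permRefl]⟩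

theorem oneL_apply (v : ExteriorAlgebra ℂ (Refl n)) :
    (oneL n c).1 v = ExteriorAlgebra.algebraMapInv v • toL n c 1 := rfl

/-- A regular operator is injective: this kills the values in positive exterior degree and, in
degree `0`, the part of `φ(1)` without constant term. -/
theorem eq_smul_oneL_of_laplL (hn : 0 < n) {φ : equivariantL n c} (h : laplL n c φ = 0) :
    ∃ a : ℂ, φ = a • oneL n c := by
  obtain ⟨a, w, hu, hw⟩ := exists_eq_const_add_toL hn (φ.1 1)
  have h0 : ∀ {k : ℕ} (b : Fin k → Fin n),
      (eulerElt n c + (k : CherednikAlg n c)) • φ.1 (wedge b) = 0 := by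
    intro k b
    rw [← laplL_wedge, h]
    rfl
  have hw0 : w = 0 := by
    have h1 := h0 (Fin.elim0 : Fin 0 → Fin n)
    rw [wedge_zero, Nat.cast_zero, add_zero, hu, smul_add, smul_comm, ← toL_smul,
      eulerElt_smul_one, map_zero, smul_zero, zero_add] at h1
    exact hw.eq_zero h1
  rw [hw0, add_zero] at hu
  refine ⟨a, equivariantL_ext fun k b _ => ?_⟩
  change _ = a • (oneL n c).1 (wedge b)
  rw [oneL_apply]
  rcases k with _ | k
  · rw [wedge_zero, hu, map_one ExteriorAlgebra.algebraMapInv, one_smul]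
  · rw [(regularAt_euler_add_toL hn _ (k + 1) k.succ_pos).eq_zero (h0 b)]
    obtain ⟨i, b, rfl⟩ : ∃ i b', b = Fin.cons i b' := ⟨b 0, Fin.tail b, (Fin.cons_self_tail b).symm⟩
    rw [wedge_cons, algebraMapInv_ι_mul, zero_smul, smul_zero]

/-- A map `Λ^* 𝔥 → F^alg_i` that is a cycle modulo `F^alg_i` is homologous to a multiple of the
class of `1`, modulo `F^alg_{i-1}`. -/
theorem exists_primitive (hn : 0 < n) (i : ℤ) (φ : equivariantL n c) (hφ : φ ∈ filtL n c i)
    (hd : diffL n c φ ∈ filtL n c i) : ∃ a : ℂ, a • oneL n c ∈ filtL n c i ∧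
      ∃ χ ∈ filtL n c (i - 1), φ - a • oneL n c - diffL n c χ ∈ filtL n c (i - 1) := by
  obtain ⟨q, hq, hq0, χ, hχ, h⟩ := exists_homotopy (diffL n c) (htpyL n c) diffL_mul_diffL
    (filtL n c) diffL_mem_filtL (htpyL_mem_filtL hn) (regularAt_laplL hn) i φ hφ hd
  obtain ⟨a, rfl⟩ := eq_smul_oneL_of_laplL hn hq0
  exact ⟨a, hq, χ, hχ, h⟩

/-! ### The position of `1` in the filtration -/

theorem decFilt_anti {i j : ℤ} (h : i ≤ j) : decFilt n c j ≤ decFilt n c i := by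
  refine iSup_mono fun k => inf_le_inf_left _ ?_
  exact biSup_mono fun l hl => by omega

theorem algFilt_mono (hn : 0 < n) {i j : ℤ} (h : i ≤ j) : algFilt n c i ≤ algFilt n c j := by
  intro u hu
  rw [mem_algFilt_iff hn] at hu ⊢
  exact fun w hw => hu w (decFilt_anti h hw)

/-- The terms `x̃_i ỹ_i p` vanish at `0`, and permutations do not change the value at `0`. -/
theorem evalZero_eulerElt (p : PolyRep n c) : evalZero n c (eulerElt n c • p) = 0 := by
  rw [eulerElt, add_smul, Finset.sum_smul, smul_assoc, Finset.sum_smul, map_add, map_smul,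
    map_sum, map_sum]
  simp [mul_smul, xGen_smul_eq, evalZero_mul, evalZero_xLin, sub_smul, evalZero_sGen]

theorem formL_one (hn : 0 < n) (p : PolyRep n c) :
    formL hn (toL n c 1) (toL n c p) = evalZero n c p := by
  rw [formL_toL, dunklForm_one]

theorem evalZero_of_mem_symIdeal {p : PolyRep n c} (hp : p ∈ symIdeal n c) :
    evalZero n c p = 0 := by
  have h : symIdeal n c ≤ RingHom.ker
      ((aeval (fun _ => (0 : ℂ))).comp (polyVal n c) : PolyRep n c →ₐ[ℂ] ℂ) :=
    Ideal.span_le.2 fun q hq => hq.2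
  exact h hp

theorem gradingElt_smul_eq (hn : 0 < n) {d : ℤ} (hd : 2 * (d : ℂ) = (c * n - 1) * (n - 1))
    (u : LRep n c) : gradingElt n c • u = eulerElt n c • u - (d : ℂ) • u := by
  have h : ((n : ℂ) - 1) * (1 - c * n) / 2 = -(d : ℂ) := by
    linear_combination (1 / 2 : ℂ) * hd
  rw [gradingElt_eq hn, add_smul, Algebra.algebraMap_eq_smul_one, smul_assoc, one_smul, h,
    neg_smul, sub_eq_add_neg]

/-- Pairing with `1` is evaluation at `0`, which kills the ideal and so every summand with `j > 0`.
For `j = 0` the eigenvalues satisfy `k < -d`, so the Euler element acts by `k + d ≠ 0`; as its image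
vanishes at `0`, so do these eigenvectors. -/
theorem one_mem_algFilt (hn : 0 < n) {d : ℤ} (hd : 2 * (d : ℂ) = (c * n - 1) * (n - 1)) :
    toL n c 1 ∈ algFilt n c d := by
  rw [mem_algFilt_iff hn]
  suffices h : decFilt n c d ≤ LinearMap.ker (formL hn (toL n c 1)) from fun w hw => h hw
  refine iSup_le fun j => ?_
  rcases j with _ | j
  · refine inf_le_right.trans (iSup₂_le fun k hk u hu => ?_)
    rw [mem_gradedPiece, gradingElt_smul_eq hn hd, sub_eq_iff_eq_add, ← add_smul] at hu
    obtain ⟨p, rfl⟩ := toL_surjective n c u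
    have h1 := congrArg (formL hn (toL n c 1)) hu
    rw [← toL_smul, formL_one, evalZero_eulerElt, map_smul] at h1
    refine (smul_eq_zero.1 h1.symm).resolve_left ?_
    rw [← Int.cast_add, Int.cast_eq_zero]
    push_cast at hk
    omega
  · refine inf_le_left.trans ?_
    rintro _ ⟨p, hp, rfl⟩
    rw [LinearMap.mem_ker, formL_one]
    exact evalZero_of_mem_symIdeal (Ideal.pow_le_self j.succ_ne_zero hp)

/-- The eigenvalue of `1` is `-d`, just below the strict bound `-(d - 1)` of the summand `j = 0`.
Together with `(1, 1) = 1` this excludes `1` from `F^alg_{d-1}`. -/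
theorem one_mem_decFilt (hn : 0 < n) {d : ℤ} (hd : 2 * (d : ℂ) = (c * n - 1) * (n - 1)) :
    toL n c 1 ∈ decFilt n c (d - 1) := by
  refine Submodule.mem_iSup_of_mem 0 ⟨⟨1, by simp, rfl⟩, ?_⟩
  refine Submodule.mem_iSup_of_mem (-d) (Submodule.mem_iSup_of_mem (by push_cast; omega) ?_)
  rw [mem_gradedPiece, gradingElt_smul_eq hn hd, ← toL_smul, eulerElt_smul_one, map_zero,
    zero_sub, Int.cast_neg, neg_smul]

theorem formL_one_one (hn : 0 < n) : formL hn (toL n c 1) (toL n c 1) = 1 := by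
  rw [formL_one, evalZero_one]

theorem one_notMem_algFilt (hn : 0 < n) {d : ℤ} (hd : 2 * (d : ℂ) = (c * n - 1) * (n - 1)) :
    toL n c 1 ∉ algFilt n c (d - 1) := fun h =>
  one_ne_zero ((formL_one_one hn).symm.trans
    ((mem_algFilt_iff hn).1 h _ (one_mem_decFilt hn hd)))

end filtration

/-! ### The homology of `d₁` -/

section homology

variable {n : ℕ} {c : ℂ}

theorem xGr_comm (w w' : Refl n) (g : GrL n c) : xGr w (xGr w' g) = xGr w' (xGr w g) := by
  have h : (xGr w * xGr w' : Module.End ℂ (GrL n c)) = xGr w' * xGr w :=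
    GrL_hom_ext fun i u hu => by
      simp only [Module.End.mul_apply, xGr_grMk, ← mul_smul, xGen_comm c w w']
  exact LinearMap.congr_fun h g

theorem dOne_apply (φ : HomSn n c) (v : ExteriorAlgebra ℂ (Refl n)) : (dOne n c φ).1 v
    = ∑ i : Fin n, xGr (eBar i) (φ.1 (ExteriorAlgebra.ι ℂ (eBar i) * v)) :=
  contraction_apply φ.1 v

theorem HomSn_ext {φ ψ : HomSn n c} (h : ∀ v, φ.1 v = ψ.1 v) : φ = ψ :=
  Subtype.ext (LinearMap.ext h)

theorem dOne_comp_dOne : dOne n c ∘ₗ dOne n c = 0 := by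
  refine LinearMap.ext fun φ => HomSn_ext fun v => ?_
  change (dOne n c (dOne n c φ)).1 v = 0
  rw [dOne_apply]
  simp only [dOne_apply, map_sum]
  refine sum_sum_eq_zero_of_antisymm _ fun i j => ?_
  rw [xGr_comm, ι_mul_ι_mul_swap, map_neg, map_neg, map_neg]

/-! ### Passage between filtered maps and the associated graded space -/

theorem grMk_congr {i j : ℤ} (h : i = j) {u : LRep n c} (hu : u ∈ algFilt n c i)
    (hu' : u ∈ algFilt n c j) : grMk i u hu = grMk j u hu' := by
  subst h
  rfl

theorem grMk_add (i : ℤ) {u w : LRep n c} (hu : u ∈ algFilt n c i) (hw : w ∈ algFilt n c i) :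
    grMk i (u + w) (add_mem hu hw) = grMk i u hu + grMk i w hw :=
  map_add (DirectSum.lof ℂ ℤ (grPiece n c) i ∘ₗ toGrPiece n c i) ⟨u, hu⟩ ⟨w, hw⟩

theorem grMk_smul (i : ℤ) (a : ℂ) {u : LRep n c} (hu : u ∈ algFilt n c i) :
    grMk i (a • u) (Submodule.smul_mem _ a hu) = a • grMk i u hu :=
  map_smul (DirectSum.lof ℂ ℤ (grPiece n c) i ∘ₗ toGrPiece n c i) a ⟨u, hu⟩

/-- The class in `Hom(Λ^* 𝔥, gr L_c)` of an equivariant map `Λ^* 𝔥 → F^alg_i`. -/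
def grVal (i : ℤ) (φ : filtL n c i) : ExteriorAlgebra ℂ (Refl n) →ₗ[ℂ] GrL n c where
  toFun v := grMk i (φ.1.1 v) (φ.2 v)
  map_add' v w := by
    simp only [map_add]
    exact grMk_add i _ _
  map_smul' a v := by
    simp only [map_smul]
    exact grMk_smul i a _

/-- The class in `Hom_{S_n}(Λ^* 𝔥, gr L_c)` of an equivariant map `Λ^* 𝔥 → F^alg_i`. -/
def grHom (n : ℕ) (c : ℂ) (i : ℤ) : filtL n c i →ₗ[ℂ] HomSn n c where
  toFun φ := ⟨grVal i φ, fun σ v => by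
    change grMk i (φ.1.1 _) _ = sGr σ (grMk i (φ.1.1 v) _)
    rw [sGr_grMk]
    simp only [φ.1.2 σ v]⟩
  map_add' φ ψ := Subtype.ext <| LinearMap.ext fun v => grMk_add i (φ.2 v) (ψ.2 v)
  map_smul' a φ := Subtype.ext <| LinearMap.ext fun v => grMk_smul i a (φ.2 v)

theorem grHom_apply (i : ℤ) (φ : filtL n c i) (v : ExteriorAlgebra ℂ (Refl n)) :
    (grHom n c i φ).1 v = grMk i (φ.1.1 v) (φ.2 v) := rfl

theorem toGrPiece_eq_zero_iff (i : ℤ) (u : algFilt n c i) :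
    toGrPiece n c i u = 0 ↔ u.1 ∈ algFilt n c (i - 1) :=
  (Submodule.Quotient.mk_eq_zero _).trans Iff.rfl

theorem grHom_eq_zero (i : ℤ) (φ : filtL n c i) (h : φ.1 ∈ filtL n c (i - 1)) :
    grHom n c i φ = 0 := by
  refine HomSn_ext fun v => ?_
  rw [grHom_apply, grMk, (toGrPiece_eq_zero_iff i _).2 (h v), map_zero]
  rfl

theorem dOne_grHom (i : ℤ) (φ : filtL n c i) :
    dOne n c (grHom n c i φ) = grHom n c (i + 1) ⟨diffL n c φ.1, diffL_mem_filtL i _ φ.2⟩ := by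
  refine HomSn_ext fun v => ?_
  rw [dOne_apply]
  simp only [grHom_apply, xGr_grMk]
  simp only [grMk, ← map_sum]
  congr 2
  refine Subtype.ext ?_
  rw [AddSubmonoidClass.coe_finsetSum]
  exact (diffL_apply _ _).symm

theorem component_xGr (w : Refl n) (i : ℤ) (g : GrL n c) (u : algFilt n c i)
    (h : DirectSum.component ℂ ℤ (grPiece n c) i g = toGrPiece n c i u) :
    DirectSum.component ℂ ℤ (grPiece n c) (i + 1) (xGr w g)
      = toGrPiece n c (i + 1) ⟨xGen c w • u.1, xGen_algFilt w i _ u.2⟩ := by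
  have key : DirectSum.component ℂ ℤ (grPiece n c) (i + 1) ∘ₗ xGr w
      = grPieceMap (actL (xGen c w)) i (i + 1) (xGen_algFilt w i) (fun u hu => by
        have h := xGen_algFilt w (i - 1) u hu
        rw [sub_add_cancel] at h
        rwa [add_sub_cancel_right, actL_apply]) ∘ₗ DirectSum.component ℂ ℤ (grPiece n c) i := by
    refine DirectSum.linearMap_ext ℂ fun j => LinearMap.ext fun y => ?_
    simp only [LinearMap.comp_apply, xGr, DirectSum.toModule_lof]
    by_cases hij : j = i
    · subst hij
      rw [DirectSum.component.lof_self, DirectSum.component.lof_self]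
    · rw [DirectSum.component.of, DirectSum.component.of, dif_neg (by omega), dif_neg hij, map_zero]
  have h2 := LinearMap.congr_fun key g
  rw [LinearMap.comp_apply, LinearMap.comp_apply, h] at h2
  exact h2

theorem component_sGr (σ : Equiv.Perm (Fin n)) (i : ℤ) (g : GrL n c) (u : algFilt n c i)
    (h : DirectSum.component ℂ ℤ (grPiece n c) i g = toGrPiece n c i u) :
    DirectSum.component ℂ ℤ (grPiece n c) i (sGr σ g)
      = toGrPiece n c i ⟨sGen c σ • u.1, sGen_algFilt σ i _ u.2⟩ := by
  have key : DirectSum.component ℂ ℤ (grPiece n c) i ∘ₗ sGr σ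
      = grPieceMap (actL (sGen c σ)) i i (sGen_algFilt σ i) (sGen_algFilt σ (i - 1))
        ∘ₗ DirectSum.component ℂ ℤ (grPiece n c) i := by
    refine DirectSum.linearMap_ext ℂ fun j => LinearMap.ext fun y => ?_
    simp only [LinearMap.comp_apply, sGr, DirectSum.toModule_lof]
    by_cases hij : j = i
    · subst hij
      rw [DirectSum.component.lof_self, DirectSum.component.lof_self]
    · rw [DirectSum.component.of, DirectSum.component.of, dif_neg hij, dif_neg hij, map_zero]
  have h2 := LinearMap.congr_fun key g
  rw [LinearMap.comp_apply, LinearMap.comp_apply, h] at h2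
  exact h2

/-- The components of an equivariant map `Λ^* 𝔥 → gr L_c` lift to equivariant maps to `L_c`. -/
theorem exists_lift (φ : HomSn n c) (i : ℤ) : ∃ χ : filtL n c i, ∀ v,
    DirectSum.component ℂ ℤ (grPiece n c) i (φ.1 v) = toGrPiece n c i ⟨χ.1.1 v, χ.2 v⟩ := by
  obtain ⟨s, hs⟩ := LinearMap.exists_rightInverse_of_surjective (toGrPiece n c i)
    (LinearMap.range_eq_top.2 (Submodule.mkQ_surjective _))
  let f : ExteriorAlgebra ℂ (Refl n) →ₗ[ℂ] algFilt n c i :=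
    s ∘ₗ DirectSum.component ℂ ℤ (grPiece n c) i ∘ₗ φ.1
  have hf : ∀ v, DirectSum.component ℂ ℤ (grPiece n c) i (φ.1 v) = toGrPiece n c i (f v) :=
    fun v => (LinearMap.congr_fun hs _).symm
  let N : ℂ := Fintype.card (Equiv.Perm (Fin n))
  have hN : N ≠ 0 := Nat.cast_ne_zero.2 Fintype.card_ne_zero
  -- Averaging a linear lift over the group makes it equivariant. It stays a lift, because each
  -- averaged term still projects to the component of `φ(v)`.
  let F : ExteriorAlgebra ℂ (Refl n) →ₗ[ℂ] LRep n c := N⁻¹ • ∑ σ : Equiv.Perm (Fin n),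
    actL (sGen c σ⁻¹) ∘ₗ (algFilt n c i).subtype ∘ₗ f ∘ₗ
      (ExteriorAlgebra.map (permRefl σ)).toLinearMap
  have hF : ∀ v, F v = N⁻¹ • ∑ σ : Equiv.Perm (Fin n),
      sGen c σ⁻¹ • (f (ExteriorAlgebra.map (permRefl σ) v) : LRep n c) := by
    intro v
    simp [F, LinearMap.sum_apply, actL_apply]
  have hmap : ∀ (σ τ : Equiv.Perm (Fin n)) (v : ExteriorAlgebra ℂ (Refl n)),
      ExteriorAlgebra.map (permRefl σ) (ExteriorAlgebra.map (permRefl τ) v)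
        = ExteriorAlgebra.map (permRefl (σ * τ)) v := by
    intro σ τ v
    rw [← AlgHom.comp_apply, ExteriorAlgebra.map_comp_map]
    rfl
  have hFeq : F ∈ equivariantL n c := by
    intro τ v
    rw [hF, hF, smul_comm (sGen c τ) N⁻¹, Finset.smul_sum (r := sGen c τ), ← Equiv.sum_comp (Equiv.mulRight τ)
      (fun σ => sGen c τ • sGen c σ⁻¹ • (f (ExteriorAlgebra.map (permRefl σ) v) : LRep n c))]
    congr 1
    refine Finset.sum_congr rfl fun σ _ => ?_
    rw [Equiv.coe_mulRight, hmap, ← mul_smul, ← sGen_mul, mul_inv_rev, mul_inv_cancel_left]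
  have hmem : ∀ v, F v ∈ algFilt n c i := by
    intro v
    rw [hF]
    exact Submodule.smul_mem _ _ (sum_mem fun σ _ => sGen_algFilt _ _ _ (f _).2)
  refine ⟨⟨⟨F, hFeq⟩, hmem⟩, fun v => ?_⟩
  have h1 : ∀ σ : Equiv.Perm (Fin n), toGrPiece n c i
      ⟨sGen c σ⁻¹ • (f (ExteriorAlgebra.map (permRefl σ) v) : LRep n c),
        sGen_algFilt _ _ _ (f _).2⟩
      = DirectSum.component ℂ ℤ (grPiece n c) i (φ.1 v) := by
    intro σ
    rw [← component_sGr σ⁻¹ i _ _ (hf (ExteriorAlgebra.map (permRefl σ) v)), ← φ.2, hmap,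
      inv_mul_cancel]
    congr 2
    have : permRefl (1 : Equiv.Perm (Fin n)) = LinearMap.id := rfl
    rw [this, ExteriorAlgebra.map_id]
    rfl
  have h2 : (⟨F v, hmem v⟩ : algFilt n c i) = N⁻¹ • ∑ σ : Equiv.Perm (Fin n),
      ⟨sGen c σ⁻¹ • (f (ExteriorAlgebra.map (permRefl σ) v) : LRep n c),
        sGen_algFilt _ _ _ (f _).2⟩ := by
    refine Subtype.ext ?_
    rw [Submodule.coe_smul, AddSubmonoidClass.coe_finsetSum]
    exact hF v
  change _ = toGrPiece n c i ⟨F v, hmem v⟩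
  rw [h2, map_smul, map_sum, Finset.sum_congr rfl fun σ _ => h1 σ, Finset.sum_const,
    Finset.card_univ, ← Nat.cast_smul_eq_nsmul ℂ, smul_smul, inv_mul_cancel₀ hN, one_smul]

/-- Each value of `φ` has finite support in the direct sum, and `Λ^* 𝔥` is finite-dimensional, so
the supports on a basis have a finite union. -/
theorem exists_eq_sum_grHom (φ : HomSn n c) (χ : ∀ i, filtL n c i) (h : ∀ i v,
    DirectSum.component ℂ ℤ (grPiece n c) i (φ.1 v) = toGrPiece n c i ⟨(χ i).1.1 v, (χ i).2 v⟩) :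
    ∃ S : Finset ℤ, φ = ∑ i ∈ S, grHom n c i (χ i) := by
  classical
  let b := Module.Free.chooseBasis ℂ (ExteriorAlgebra ℂ (Refl n))
  refine ⟨Finset.univ.biUnion fun k => DFinsupp.support (φ.1 (b k)), ?_⟩
  refine Subtype.ext (b.ext fun k => ?_)
  have hsum : (∑ i ∈ Finset.univ.biUnion fun k => DFinsupp.support (φ.1 (b k)),
      grHom n c i (χ i)).1 (b k)
      = ∑ i ∈ Finset.univ.biUnion fun k => DFinsupp.support (φ.1 (b k)),
        (grHom n c i (χ i)).1 (b k) := by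
    have e := map_sum ((LinearMap.applyₗ (b k) : _ →ₗ[ℂ] GrL n c) ∘ₗ (equivariantMaps n c).subtype)
      (fun i => (grHom n c i (χ i) : equivariantMaps n c))
      (Finset.univ.biUnion fun k => DFinsupp.support (φ.1 (b k)))
    exact e
  rw [hsum]
  have hi : ∀ i, (grHom n c i (χ i)).1 (b k)
      = DirectSum.of (grPiece n c) i (φ.1 (b k) i) := by
    intro i
    exact congrArg (DirectSum.of (grPiece n c) i) (h i (b k)).symm
  simp only [hi]
  conv_lhs => rw [← DirectSum.sum_support_of (φ.1 (b k))]
  refine Finset.sum_subset (Finset.subset_biUnion_of_mem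
    (fun k => DFinsupp.support (φ.1 (b k))) (Finset.mem_univ k)) fun i _ hi => ?_
  rw [DFinsupp.notMem_support_iff.1 hi, map_zero]

/-- The class of `dχ` in `F^alg_{i+1} / F^alg_i` is the component of `d₁ φ` in degree `i + 1`, which
vanishes. Hence each component of a cycle satisfies the hypothesis of `exists_primitive`. -/
theorem diffL_lift_mem (φ : HomSn n c) (hφ : dOne n c φ = 0) (i : ℤ) (χ : filtL n c i)
    (h : ∀ v, DirectSum.component ℂ ℤ (grPiece n c) i (φ.1 v)
      = toGrPiece n c i ⟨χ.1.1 v, χ.2 v⟩) : diffL n c χ.1 ∈ filtL n c i := by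
  intro v
  have h1 := congrArg (fun ψ : HomSn n c =>
    DirectSum.component ℂ ℤ (grPiece n c) (i + 1) (ψ.1 v)) hφ
  simp only [dOne_apply, map_sum] at h1
  rw [Finset.sum_congr rfl fun l _ => component_xGr (eBar l) i _ _ (h _), ← map_sum] at h1
  have h2 := (toGrPiece_eq_zero_iff _ _).1 (h1.trans (map_zero _))
  rw [AddSubmonoidClass.coe_finsetSum, add_sub_cancel_right] at h2
  rw [diffL_apply]
  exact h2

/-! ### Cycles and boundaries -/

theorem dOne_invClass (d : ℤ) (h1 : toL n c 1 ∈ algFilt n c d) :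
    dOne n c (invClass d (toL n c 1) h1 sGen_one_poly) = 0 := by
  refine HomSn_ext fun v => ?_
  rw [dOne_apply]
  refine Finset.sum_eq_zero fun i _ => ?_
  change xGr (eBar i) (ExteriorAlgebra.algebraMapInv (R := ℂ) _ • grMk d (toL n c 1) h1) = 0
  rw [algebraMapInv_ι_mul, zero_smul, map_zero]

/-- For `a ≠ 0`, the position of `1` in the filtration forces `d ≤ i`. If `d < i` the class in
degree `i` is zero, and if `d = i` it is `a` times the class of `1`. -/
theorem grHom_smul_oneL_mem_span (hn : 0 < n) {d : ℤ}
    (hd : 2 * (d : ℂ) = (c * n - 1) * (n - 1)) (h1 : toL n c 1 ∈ algFilt n c d) (i : ℤ) (a : ℂ)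
    (h : a • oneL n c ∈ filtL n c i) : grHom n c i ⟨a • oneL n c, h⟩
      ∈ Submodule.span ℂ {invClass d (toL n c 1) h1 sGen_one_poly} := by
  rcases eq_or_ne a 0 with rfl | ha
  · rw [grHom_eq_zero]
    · exact zero_mem _
    · change (0 : ℂ) • oneL n c ∈ _
      rw [zero_smul]
      exact zero_mem _
  have h2 := h 1
  change a • (oneL n c).1 1 ∈ _ at h2
  rw [oneL_apply, map_one, one_smul, Submodule.smul_mem_iff _ ha] at h2
  have hdi : d ≤ i := by
    by_contra hlt
    exact one_notMem_algFilt hn hd (algFilt_mono hn (by omega : i ≤ d - 1) h2)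
  rcases hdi.eq_or_lt with rfl | hlt
  · refine Submodule.mem_span_singleton.2 ⟨a, ?_⟩
    have e : (⟨a • oneL n c, h⟩ : filtL n c d) = a • ⟨oneL n c, fun v =>
        Submodule.smul_mem _ (ExteriorAlgebra.algebraMapInv v) h1⟩ := rfl
    rw [e, map_smul]
    congr 1
    refine HomSn_ext fun v => ?_
    change ExteriorAlgebra.algebraMapInv v • DirectSum.lof ℂ ℤ (grPiece n c) d
        (toGrPiece n c d ⟨toL n c 1, h1⟩)
      = DirectSum.lof ℂ ℤ (grPiece n c) d (toGrPiece n c d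
        (ExteriorAlgebra.algebraMapInv v • ⟨toL n c 1, h1⟩))
    rw [map_smul, map_smul]
  · rw [grHom_eq_zero]
    · exact zero_mem _
    · exact fun v => Submodule.smul_mem _ _ (Submodule.smul_mem _ _
        (algFilt_mono hn (by omega : d ≤ i - 1) h1))

/-- A cycle is a finite sum of classes of equivariant lifts, and `exists_primitive` applies to each
of them separately. -/
theorem ker_dOne_le (hn : 0 < n) {d : ℤ} (hd : 2 * (d : ℂ) = (c * n - 1) * (n - 1))
    (h1 : toL n c 1 ∈ algFilt n c d) (φ : HomSn n c) (hφ : dOne n c φ = 0) :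
    φ ∈ Submodule.span ℂ {invClass d (toL n c 1) h1 sGen_one_poly}
      ⊔ LinearMap.range (dOne n c) := by
  choose χ hχ using exists_lift φ
  obtain ⟨S, rfl⟩ := exists_eq_sum_grHom φ χ hχ
  refine sum_mem fun i _ => ?_
  obtain ⟨a, ha, ψ, hψ, h⟩ := exists_primitive hn i (χ i).1 (χ i).2
    (diffL_lift_mem _ hφ i (χ i) (hχ i))
  have hdψ : diffL n c ψ ∈ filtL n c i := by
    have := diffL_mem_filtL _ ψ hψ
    rwa [sub_add_cancel] at this
  -- The harmonic part, a boundary, and a remainder in `F^alg_{i-1}` whose class in degree `i` is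
  -- zero.
  have e : χ i = ⟨a • oneL n c, ha⟩ + ⟨diffL n c ψ, hdψ⟩
      + ⟨(χ i).1 - a • oneL n c - diffL n c ψ, sub_mem (sub_mem (χ i).2 ha) hdψ⟩ := by
    refine Subtype.ext ?_
    change (χ i).1 = a • oneL n c + diffL n c ψ + ((χ i).1 - a • oneL n c - diffL n c ψ)
    abel
  rw [e, map_add, map_add, grHom_eq_zero i ⟨(χ i).1 - a • oneL n c - diffL n c ψ, _⟩ h, add_zero]
  refine Submodule.add_mem_sup (grHom_smul_oneL_mem_span hn hd h1 i a ha)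
    ⟨grHom n c (i - 1) ⟨ψ, hψ⟩, ?_⟩
  rw [dOne_grHom]
  exact HomSn_ext fun v => grMk_congr (sub_add_cancel i 1) _ _

/-- If the class were a boundary, `1` would equal `∑ x̃_l u_l` modulo `F^alg_{d-1}`. Pairing with
`1`, which lies in `F^{d-1}`, kills the error term and also each `x̃_l u_l`, since `ỹ_l` annihilates
`1`; but `(1, 1) = 1`. -/
theorem invClass_notMem_range (hn : 0 < n) {d : ℤ}
    (hd : 2 * (d : ℂ) = (c * n - 1) * (n - 1)) (h1 : toL n c 1 ∈ algFilt n c d) :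
    invClass d (toL n c 1) h1 sGen_one_poly ∉ LinearMap.range (dOne n c) := by
  rintro ⟨ψ, hψ⟩
  obtain ⟨i, rfl⟩ : ∃ i, d = i + 1 := ⟨d - 1, by ring⟩
  obtain ⟨χ, hχ⟩ := exists_lift ψ i
  have h2 := congrArg (fun ψ : HomSn n c =>
    DirectSum.component ℂ ℤ (grPiece n c) (i + 1) (ψ.1 1)) hψ
  simp only [dOne_apply, map_sum] at h2
  rw [Finset.sum_congr rfl fun l _ => component_xGr (eBar l) i _ _ (hχ _), ← map_sum] at h2
  have h3 : DirectSum.component ℂ ℤ (grPiece n c) (i + 1)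
      ((invClass (i + 1) (toL n c 1) h1 sGen_one_poly).1 1)
      = toGrPiece n c (i + 1) ⟨toL n c 1, h1⟩ := by
    change DirectSum.component ℂ ℤ (grPiece n c) (i + 1)
      (ExteriorAlgebra.algebraMapInv (R := ℂ) 1 • grMk (i + 1) (toL n c 1) h1) = _
    rw [map_one, one_smul, grMk, DirectSum.component.lof_self]
  rw [h3, ← sub_eq_zero, ← map_sub, toGrPiece_eq_zero_iff] at h2
  have h4 := (mem_algFilt_iff hn).1 h2 _ (one_mem_decFilt hn hd)
  rw [AddSubgroupClass.coe_sub, AddSubmonoidClass.coe_finsetSum, map_sub, LinearMap.sub_apply,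
    formL_one_one, map_sum, LinearMap.sum_apply, Finset.sum_eq_zero, zero_sub] at h4
  · exact neg_ne_zero.2 one_ne_zero h4
  · intro l _
    rw [formL_xGen, ← toL_smul, yGen_smul_one, map_zero, map_zero]

theorem homology_dOne (hn : 0 < n) {d : ℤ} (hd : 2 * (d : ℂ) = (c * n - 1) * (n - 1)) :
    ∃ hone : toL n c 1 ∈ algFilt n c d, toL n c 1 ∉ algFilt n c (d - 1) ∧
      ∃ hker : invClass d (toL n c 1) hone sGen_one_poly ∈ LinearMap.ker (dOne n c),
        Module.finrank ℂ (homologyDOne n c) = 1 ∧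
        Submodule.span ℂ {(Submodule.Quotient.mk ⟨_, hker⟩ : homologyDOne n c)} = ⊤ := by
  have h1 := one_mem_algFilt hn hd
  have hker : invClass d (toL n c 1) h1 sGen_one_poly ∈ LinearMap.ker (dOne n c) :=
    dOne_invClass d h1
  have hspan : ∀ y : homologyDOne n c,
      ∃ a : ℂ, a • (Submodule.Quotient.mk ⟨_, hker⟩ : homologyDOne n c) = y := by
    intro y
    obtain ⟨⟨φ, hφ⟩, rfl⟩ := Submodule.Quotient.mk_surjective _ y
    obtain ⟨q, hq, b, hb, rfl⟩ := Submodule.mem_sup.1 (ker_dOne_le hn hd h1 φ hφ)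
    obtain ⟨a, rfl⟩ := Submodule.mem_span_singleton.1 hq
    refine ⟨a, ?_⟩
    rw [← Submodule.Quotient.mk_smul]
    refine ((Submodule.Quotient.eq _).2 ?_).symm
    change a • invClass d (toL n c 1) h1 sGen_one_poly + b
      - a • invClass d (toL n c 1) h1 sGen_one_poly ∈ LinearMap.range (dOne n c)
    rwa [add_sub_cancel_left]
  refine ⟨h1, one_notMem_algFilt hn hd, hker, finrank_eq_one _ ?_ hspan, ?_⟩
  · intro h0
    exact invClass_notMem_range hn hd h1 ((Submodule.Quotient.mk_eq_zero
      ((LinearMap.range (dOne n c)).submoduleOf (LinearMap.ker (dOne n c)))).1 h0)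
  · exact Submodule.eq_top_iff'.2 fun y => Submodule.mem_span_singleton.2 (hspan y)

/-- Coprime integers are not both even, so one of `m - 1`, `n - 1` is even and the integer division
by `2` is exact. -/
theorem two_mul_coprime_div {m n : ℕ} (h : Nat.Coprime m n) :
    2 * (((m : ℤ) - 1) * ((n : ℤ) - 1) / 2) = ((m : ℤ) - 1) * ((n : ℤ) - 1) := by
  refine Int.mul_ediv_cancel' ?_
  have h2 : ∀ k : ℕ, (2 : ℤ) ∣ ((2 * k + 1 : ℕ) : ℤ) - 1 := fun k => ⟨k, by push_cast; ring⟩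
  rcases Nat.even_or_odd m with hm | ⟨k, rfl⟩
  · rcases Nat.even_or_odd n with hn | ⟨k, rfl⟩
    · exact absurd (Nat.dvd_gcd hm.two_dvd hn.two_dvd) (by rw [h]; decide)
    · exact (h2 k).mul_left _
  · exact (h2 k).mul_right _

end homology

end

end Cherednik

/-- For coprime positive integers `m, n` and `c = m / n`, let `d₁` be the differential on
`Hom_{S_n}(Λ^* 𝔥, gr L_c)` for the algebraic filtration. Then `d₁² = 0`, the polynomial `1` lies in
`F^alg_i` but not in `F^alg_{i-1}` for `i = (m-1)(n-1)/2`, its class is a cycle, and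
`ker d₁ / im d₁` is one-dimensional and spanned by the class of `1`. -/
theorem mainTheorem8 (m n : ℕ) (hm : 0 < m) (hn : 0 < n) (hmn : Nat.Coprime m n) :
    Cherednik.dOne n ((m : ℂ) / n) ∘ₗ Cherednik.dOne n ((m : ℂ) / n) = 0 ∧
    ∃ hone : Cherednik.toL n ((m : ℂ) / n) 1 ∈
        Cherednik.algFilt n ((m : ℂ) / n) (((m : ℤ) - 1) * ((n : ℤ) - 1) / 2),
      Cherednik.toL n ((m : ℂ) / n) 1 ∉
        Cherednik.algFilt n ((m : ℂ) / n) (((m : ℤ) - 1) * ((n : ℤ) - 1) / 2 - 1) ∧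
      ∃ hker : Cherednik.invClass (((m : ℤ) - 1) * ((n : ℤ) - 1) / 2)
          (Cherednik.toL n ((m : ℂ) / n) 1) hone Cherednik.sGen_one_poly ∈
          LinearMap.ker (Cherednik.dOne n ((m : ℂ) / n)),
        Module.finrank ℂ (Cherednik.homologyDOne n ((m : ℂ) / n)) = 1 ∧
        Submodule.span ℂ {(Submodule.Quotient.mk ⟨_, hker⟩ :
          Cherednik.homologyDOne n ((m : ℂ) / n))} = ⊤ := by
  have hn' : (n : ℂ) ≠ 0 := Nat.cast_ne_zero.2 hn.ne'
  refine ⟨Cherednik.dOne_comp_dOne, Cherednik.homology_dOne hn ?_⟩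
  rw [div_mul_cancel₀ _ hn']
  exact_mod_cast congrArg (Int.cast : ℤ → ℂ) (Cherednik.two_mul_coprime_div hmn)
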